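/- Use coordinates $(w,z_1,z_2,\zeta)$ on $\mathbb{C}^4$. For a real hypersurface $M_0\ni 0$ given by $\Re(w)=Q(z_1,z_2,\zeta)$, let $\mathfrak{hol}(M_0)$ be the real Lie algebra of its infinitesimal symmetries at $0$, i.e. of germs at $0$ of holomorphic vector fields whose real part is tangent to $M_0$. In each of the following three cases $\mathfrak{hol}(M_0)$ is a $\mathbb{Z}$-graded real Lie algebra $\mathfrak{hol}(M_0)=\mathfrak a_{-2}\oplus\mathfrak a_{-1}\oplus\mathfrak a_0$ (a direct sum with $[\mathfrak a_i,\mathfrak a_j]\subseteq\mathfrak a_{i+j}$, where $\mathfrak a_k=0$ for all other $k$) with $\mathfrak a_{-2}=\{2bi\,\partial_w : b\in\mathbb{R}\}$. **Type I.** Let $M_0$ be given by $$\begin{aligned}\Re(w)=\;&z_1\overline{z_2}+\overline{z_1}z_2+\frac{\Re\left(-(1+i)(\overline{\zeta}+\overline{\zeta}^2)z_1^2-2\sqrt2\,i z_1z_2\overline{\zeta}^2+(1-i)(\overline{\zeta}+\overline{\zeta}^2)z_2^2\right)}{|2\zeta+1|^2}\\ &+\frac{2|\zeta|^2}{|2\zeta+1|^2}\Big(-2\Re\left(z_1\overline{z_2}((1+i)|\zeta|^2+2i\Re(\zeta)+i)\right)+\sqrt2|z_1|^2(|\zeta|^2+\Re((1-i)\zeta))\\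 &+\sqrt2|z_2|^2(|\zeta|^2+\Re((1+i)\zeta))+\Re\left(z_1^2((i-1)|\zeta|^2-2\overline{\zeta}-1-i)\right)-2\sqrt2\,\Re\left(iz_1z_2(|\zeta|^2+\overline{\zeta})\right)\\ &+\Re\left(z_2^2((1+i)|\zeta|^2+2\overline{\zeta}+1-i)\right)\Big).\end{aligned}$$ Then $\dim_{\mathbb{R}}\mathfrak{hol}(M_0)=8$, $\mathfrak a_{-1}$ consists of the fields $$2(\overline{a_1}z_2+\overline{a_2}z_1)\partial_w+\Big(a_1-\overline{a_1}\tfrac{\sqrt2 i\zeta^2}{2\zeta+1}-\overline{a_2}\tfrac{(1+i)(\zeta+1)\zeta}{2\zeta+1}\Big)\partial_{z_1}+\Big(a_2-\overline{a_1}\tfrac{(i-1)(\zeta+1)\zeta}{2\zeta+1}-\overline{a_2}\tfrac{\sqrt2 i\zeta^2}{2\zeta+1}\Big)\partial_{z_2},$$ and $\mathfrak a_0$ of the fields $$\begin{aligned}&\left(2cw+\overline d(-(1+i)z_1^2+(1-i)z_2^2)\right)\partial_w+d(2\zeta+1)\partial_\zeta\\ &+\Big(cz_1+de^{-i\pi/4}z_2+2\overline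 d\,\tfrac{-e^{i\pi/4}(\zeta^2+\zeta+\frac12)z_2+i(\zeta^2+\zeta)z_1}{2\zeta+1}\Big)\partial_{z_1}\\ &+\Big(cz_2+de^{i\pi/4}z_1-2\overline d\,\tfrac{e^{-i\pi/4}(\zeta^2+\zeta+\frac12)z_1+i(\zeta^2+\zeta)z_2}{2\zeta+1}\Big)\partial_{z_2},\end{aligned}$$ where $a_1,a_2,d\in\mathbb{C}$, $c\in\mathbb{R}$. These symmetries are not all polynomial vector fields: both $\mathfrak a_{-1}$ and $\mathfrak a_0$ contain non-polynomial ones; precisely, the symmetry with parameters $b,a_1,a_2,c,d$ (the sum of the three fields above) is polynomial if and only if $d=0$ and $(1+i)\overline{a_2}=\sqrt2\,i\,\overline{a_1}$. **Type II.** Let $M_0$ be given by $$\begin{aligned}\Re(w)=\;&\frac{z_1\overline{z_2}+\overline{z_1}z_2+2\Re(z_1z_2\overline{\zeta})+\Re(z_2^2(\overline{\zeta}^2+\overline{\zeta}))}{1-|\zeta|^2}\\&+\frac{|\zeta|^2}{(1-|\zeta|^2)^2}\left(2|z_2|^2\Re(1+\overline{\zeta})+\Re(z_2^2(|\zeta|^2+\overline{\zeta}^2+2\overline{\zeta}))\right).\end{aligned}$$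 Then $\dim_{\mathbb{R}}\mathfrak{hol}(M_0)=8$, all symmetries are polynomial vector fields, $\mathfrak a_{-1}$ consists of the fields $$2(\overline{a_2}z_1+\overline{a_1}z_2)\partial_w+(a_1-\overline{a_1}\zeta-\overline{a_2}\zeta-\overline{a_2}\zeta^2)\partial_{z_1}+(a_2-\overline{a_2}\zeta)\partial_{z_2},$$ and $\mathfrak a_0$ of the fields $$\begin{aligned}&(2cw+2\overline d(z_2^2+2z_1z_2))\partial_w+2(d-\overline d\zeta)(1+\zeta)\partial_\zeta+(cz_2-2\overline dz_2(1+\zeta))\partial_{z_2}\\&+(cz_1+d(z_2+2z_1)-\overline dz_2-2\overline d\zeta(2z_2+z_1+z_2\zeta))\partial_{z_1},\end{aligned}$$ where $a_1,a_2,d\in\mathbb{C}$, $c\in\mathbb{R}$. **Type III.** Let $M_0$ be given by $$\begin{aligned}\Re(w)=\;&2\,\frac{\Re(2|z_1|^2+\zeta\overline{z_1}^2)}{1-|\zeta|^2}+\frac{\Re\left(-9|z_1|^2-3|z_2|^2-6\overline{z_1}^2\zeta+4\sqrt3z_1\overline{z_2}\zeta+2\sqrt3\,\overline{z_1z_2}\zeta^2\right)}{(1-|\zeta|^2)^2}\\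 &+2\,\frac{\Re\left(3|z_1|^2+|z_2|^2+3\overline{z_1}^2\zeta-2\sqrt3z_1\overline{z_2}\zeta+\overline{z_2}^2\zeta^3-2\sqrt3\,\overline{z_1z_2}\zeta^2\right)}{(1-|\zeta|^2)^3}.\end{aligned}$$ Then $\dim_{\mathbb{R}}\mathfrak{hol}(M_0)=9$, all symmetries are polynomial vector fields, $\mathfrak a_{-1}$ consists of the fields $$2(\overline{a_1}z_1-\overline{a_2}z_2)\partial_w+(a_1-2\overline{a_1}\zeta+\sqrt3\,\overline{a_2}\zeta^2)\partial_{z_1}+(a_2-\sqrt3\,\overline{a_1}\zeta^2+2\overline{a_2}\zeta^3)\partial_{z_2},$$ and $\mathfrak a_0$ of the fields $$\begin{aligned}&(2\Re(c_2)w+2\overline{c_1}z_1^2)\partial_w+(c_2z_1+\sqrt3\,\overline{c_1}z_2-4\overline{c_1}z_1\zeta)\partial_{z_1}\\&+(\sqrt3c_1z_1+c_2z_2+2i\Im(c_2)z_2-2\sqrt3\,\overline{c_1}z_1\zeta^2)\partial_{z_2}+(c_1-\overline{c_1}\zeta^2+2i\Im(c_2)\zeta)\partial_\zeta,\end{aligned}$$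 where $a_1,a_2,c_1,c_2\in\mathbb{C}$. Moreover $\mathfrak{hol}(M_0)$ is isomorphic, as a real Lie algebra, to the contact parabolic subalgebra of the split real form of $\mathrm{Lie}(G_2)$, i.e. to the maximal parabolic subalgebra generated by a Borel subalgebra and the root space of the negative of the short simple root. -/

import Mathlib

open Complex Filter Topology ComplexConjugate

noncomputable section

/-- The space `ℂ⁴` with coordinates `p 0 = w`, `p 1 = z₁`, `p 2 = z₂`, `p 3 = ζ`. -/
abbrev C4 : Type := Fin 4 → ℂ

/-! ### The Lie algebra of germs at the origin of holomorphic vector fields on `ℂ⁴`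

The map `X : C4 → C4` stands for the vector field
`X 0 ∂/∂w + X 1 ∂/∂z₁ + X 2 ∂/∂z₂ + X 3 ∂/∂ζ`. -/

/-- The real vector space of germs at `0` of holomorphic maps `ℂ⁴ → ℂ⁴`. -/
def holGermSubmodule : Submodule ℝ (Germ (𝓝 (0 : C4)) C4) where
  carrier := {g | ∃ X : C4 → C4, AnalyticAt ℂ X 0 ∧ g = (X : Germ (𝓝 (0 : C4)) C4)}
  add_mem' := by
    rintro _ _ ⟨X, hX, rfl⟩ ⟨Y, hY, rfl⟩
    exact ⟨X + Y, hX.add hY, rfl⟩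
  zero_mem' := ⟨0, analyticAt_const, rfl⟩
  smul_mem' := by
    rintro t _ ⟨X, hX, rfl⟩
    refine ⟨t • X, ?_, rfl⟩
    have h : t • X = (t : ℂ) • X := by
      funext p i
      simp [Complex.real_smul]
    rw [h]
    exact hX.const_smul

/-- Germs at `0` of holomorphic vector fields on `ℂ⁴`. -/
def HolGerm : Type := holGermSubmodule

instance : AddCommGroup HolGerm := inferInstanceAs (AddCommGroup holGermSubmodule)

instance : Module ℝ HolGerm := inferInstanceAs (Module ℝ holGermSubmodule)

namespace HolGerm

/-- The underlying germ of a map. -/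
def germ (X : HolGerm) : Germ (𝓝 (0 : C4)) C4 := X.1

/-- The germ of a vector field that is holomorphic near `0`. -/
def of (V : C4 → C4) (hV : AnalyticAt ℂ V 0) : HolGerm := ⟨(V : Germ (𝓝 (0 : C4)) C4), V, hV, rfl⟩

theorem exists_rep (X : HolGerm) : ∃ V, ∃ hV : AnalyticAt ℂ V 0, X = of V hV := by
  obtain ⟨g, V, hV, rfl⟩ := X
  exact ⟨V, hV, rfl⟩

theorem ext_germ {X Y : HolGerm} (h : X.germ = Y.germ) : X = Y := Subtype.ext h

theorem of_eq_of {V W : C4 → C4} {hV : AnalyticAt ℂ V 0} {hW : AnalyticAt ℂ W 0}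
    (h : V =ᶠ[𝓝 0] W) : of V hV = of W hW :=
  ext_germ (Germ.coe_eq.2 h)

theorem analyticAt_lieBracket {V W : C4 → C4} (hV : AnalyticAt ℂ V 0) (hW : AnalyticAt ℂ W 0) :
    AnalyticAt ℂ (VectorField.lieBracket ℂ V W) 0 :=
  (ContDiffAt.lieBracket_vectorField (n := ⊤) (m := ⊤) hV.contDiffAt hW.contDiffAt
    le_top).analyticAt

/-- The bracket of germs of maps induced by the Lie bracket of vector fields. -/
def germBracket (f g : Germ (𝓝 (0 : C4)) C4) : Germ (𝓝 (0 : C4)) C4 :=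
  Quotient.map₂ (fun V W : C4 → C4 => VectorField.lieBracket ℂ V W)
    (fun _ _ hV _ _ hW => Filter.EventuallyEq.lieBracket_vectorField hV hW) f g

/-- The Lie bracket of vector fields `[X, Y] = DY(X) - DX(Y)`. -/
instance : Bracket HolGerm HolGerm where
  bracket X Y := ⟨germBracket X.germ Y.germ, by
    obtain ⟨V, hV, rfl⟩ := X.exists_rep
    obtain ⟨W, hW, rfl⟩ := Y.exists_rep
    exact ⟨_, analyticAt_lieBracket hV hW, rfl⟩⟩

theorem of_lie_of {V W : C4 → C4} (hV : AnalyticAt ℂ V 0) (hW : AnalyticAt ℂ W 0) :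
    ⁅of V hV, of W hW⁆ = of (VectorField.lieBracket ℂ V W) (analyticAt_lieBracket hV hW) := rfl

theorem of_add_of {V W : C4 → C4} (hV : AnalyticAt ℂ V 0) (hW : AnalyticAt ℂ W 0) :
    of V hV + of W hW = of (V + W) (hV.add hW) := rfl

theorem of_zero : (0 : HolGerm) = of 0 analyticAt_const := rfl

theorem analyticAt_real_smul {V : C4 → C4} (hV : AnalyticAt ℂ V 0) (t : ℝ) :
    AnalyticAt ℂ ((t : ℂ) • V) 0 := hV.const_smul

theorem smul_of {V : C4 → C4} (hV : AnalyticAt ℂ V 0) (t : ℝ) :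
    t • of V hV = of ((t : ℂ) • V) (analyticAt_real_smul hV t) := by
  apply ext_germ
  change ((t • V : C4 → C4) : Germ (𝓝 (0 : C4)) C4) = _
  have h : t • V = (t : ℂ) • V := by
    funext p i
    simp [Complex.real_smul]
  rw [h]
  rfl

instance : LieRing HolGerm where
  add_lie X Y Z := by
    obtain ⟨U, hU, rfl⟩ := X.exists_rep
    obtain ⟨V, hV, rfl⟩ := Y.exists_rep
    obtain ⟨W, hW, rfl⟩ := Z.exists_rep
    simp only [of_lie_of, of_add_of]
    apply of_eq_of
    filter_upwards [hU.eventually_analyticAt, hV.eventually_analyticAt] with p h1 h2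
    exact VectorField.lieBracket_add_left h1.differentiableAt h2.differentiableAt
  lie_add X Y Z := by
    obtain ⟨U, hU, rfl⟩ := X.exists_rep
    obtain ⟨V, hV, rfl⟩ := Y.exists_rep
    obtain ⟨W, hW, rfl⟩ := Z.exists_rep
    simp only [of_lie_of, of_add_of]
    apply of_eq_of
    filter_upwards [hV.eventually_analyticAt, hW.eventually_analyticAt] with p h1 h2
    exact VectorField.lieBracket_add_right h1.differentiableAt h2.differentiableAt
  lie_self X := by
    obtain ⟨U, hU, rfl⟩ := X.exists_rep
    rw [of_lie_of, of_zero]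
    apply of_eq_of
    rw [VectorField.lieBracket_self]
  leibniz_lie X Y Z := by
    obtain ⟨U, hU, rfl⟩ := X.exists_rep
    obtain ⟨V, hV, rfl⟩ := Y.exists_rep
    obtain ⟨W, hW, rfl⟩ := Z.exists_rep
    simp only [of_lie_of, of_add_of]
    apply of_eq_of
    filter_upwards [hU.eventually_analyticAt, hV.eventually_analyticAt,
      hW.eventually_analyticAt] with p h1 h2 h3
    exact VectorField.leibniz_identity_lieBracket (n := ⊤) le_top h1.contDiffAt h2.contDiffAt
      h3.contDiffAt

instance : LieAlgebra ℝ HolGerm where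
  lie_smul t X Y := by
    obtain ⟨U, hU, rfl⟩ := X.exists_rep
    obtain ⟨V, hV, rfl⟩ := Y.exists_rep
    simp only [of_lie_of, smul_of]
    apply of_eq_of
    filter_upwards [hV.eventually_analyticAt] with p h1
    exact VectorField.lieBracket_const_smul_right h1.differentiableAt

/-- The germ is represented by a vector field with polynomial coefficients. -/
def IsPolynomial (X : HolGerm) : Prop :=
  ∃ P : Fin 4 → MvPolynomial (Fin 4) ℂ,
    X.germ = ((fun p i => MvPolynomial.eval p (P i) : C4 → C4) : Germ (𝓝 (0 : C4)) C4)

end HolGerm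

/-! ### Infinitesimal symmetries of a real hypersurface -/

/-- The infinitesimal symmetries `hol(M)` at `0` of the hypersurface `M = {ρ = 0}` in `ℂ⁴`: germs at
`0` of holomorphic vector fields `X` whose real part is tangent to `M`. Under the identification of
`X` with a `ℂ⁴`-valued map, `2 Re X` is the real vector field on `ℂ⁴ = ℝ⁸` with value `X p` at `p`,
and `fderiv ℝ ρ p (X p)` is the derivative of `ρ` along it. -/
def infSym (ρ : C4 → ℝ) : Submodule ℝ HolGerm where
  carrier := {X | ∃ V : C4 → C4, X.germ = (V : Germ (𝓝 (0 : C4)) C4) ∧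
    ∀ᶠ p in 𝓝 (0 : C4), ρ p = 0 → fderiv ℝ ρ p (V p) = 0}
  add_mem' := by
    rintro X Y ⟨V, hV, h1⟩ ⟨W, hW, h2⟩
    refine ⟨V + W, ?_, ?_⟩
    · change X.germ + Y.germ = _
      rw [hV, hW]
      rfl
    · filter_upwards [h1, h2] with p a b hp
      rw [Pi.add_apply, map_add, a hp, b hp, add_zero]
  zero_mem' := ⟨0, rfl, Eventually.of_forall fun p _ => by simp⟩
  smul_mem' := by
    rintro t X ⟨V, hV, h1⟩
    refine ⟨t • V, ?_, ?_⟩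
    · change t • X.germ = _
      rw [hV]
      rfl
    · filter_upwards [h1] with p a hp
      rw [Pi.smul_apply, map_smul, a hp, smul_zero]

/-- The real subspace `h` is the direct sum of the real subspaces `a k`, `k ∈ ℤ`, with
`[a i, a j] ⊆ a (i + j)`, and `a k = 0` unless `k ∈ {-2, -1, 0}`. -/
structure IsGradedBy (h : Submodule ℝ HolGerm) (a : ℤ → Submodule ℝ HolGerm) : Prop where
  indep : iSupIndep a
  iSup_eq : ⨆ k, a k = h
  lie_mem : ∀ i j : ℤ, ∀ X ∈ a i, ∀ Y ∈ a j, ⁅X, Y⁆ ∈ a (i + j)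
  eq_bot : ∀ k : ℤ, k ≠ -2 → k ≠ -1 → k ≠ 0 → a k = ⊥

/-! ### The three models `Re w = Q(z₁, z₂, ζ)` -/

/-- The defining function `Re w - Q(z₁, z₂, ζ)`. -/
def graphFun (Q : ℂ → ℂ → ℂ → ℝ) : C4 → ℝ := fun p => (p 0).re - Q (p 1) (p 2) (p 3)

/-- The right-hand side of the defining equation of the type I model. -/
def QI (z₁ z₂ ζ : ℂ) : ℝ :=
  (z₁ * conj z₂ + conj z₁ * z₂).re
  + (-(1 + I) * (conj ζ + conj ζ ^ 2) * z₁ ^ 2 - 2 * √2 * I * z₁ * z₂ * conj ζ ^ 2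
      + (1 - I) * (conj ζ + conj ζ ^ 2) * z₂ ^ 2).re / ‖2 * ζ + 1‖ ^ 2
  + 2 * ‖ζ‖ ^ 2 / ‖2 * ζ + 1‖ ^ 2 *
    (-2 * (z₁ * conj z₂ * ((1 + I) * ‖ζ‖ ^ 2 + 2 * I * ζ.re + I)).re
      + √2 * ‖z₁‖ ^ 2 * (‖ζ‖ ^ 2 + ((1 - I) * ζ).re)
      + √2 * ‖z₂‖ ^ 2 * (‖ζ‖ ^ 2 + ((1 + I) * ζ).re)
      + (z₁ ^ 2 * ((I - 1) * ‖ζ‖ ^ 2 - 2 * conj ζ - 1 - I)).re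
      - 2 * √2 * (I * z₁ * z₂ * (‖ζ‖ ^ 2 + conj ζ)).re
      + (z₂ ^ 2 * ((1 + I) * ‖ζ‖ ^ 2 + 2 * conj ζ + 1 - I)).re)

/-- The right-hand side of the defining equation of the type II model. -/
def QII (z₁ z₂ ζ : ℂ) : ℝ :=
  ((z₁ * conj z₂ + conj z₁ * z₂).re + 2 * (z₁ * z₂ * conj ζ).re
      + (z₂ ^ 2 * (conj ζ ^ 2 + conj ζ)).re) / (1 - ‖ζ‖ ^ 2)
  + ‖ζ‖ ^ 2 / (1 - ‖ζ‖ ^ 2) ^ 2 *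
    (2 * ‖z₂‖ ^ 2 * (1 + conj ζ).re + (z₂ ^ 2 * (‖ζ‖ ^ 2 + conj ζ ^ 2 + 2 * conj ζ)).re)

/-- The right-hand side of the defining equation of the type III model. -/
def QIII (z₁ z₂ ζ : ℂ) : ℝ :=
  2 * ((2 * ‖z₁‖ ^ 2 + ζ * conj z₁ ^ 2 : ℂ).re / (1 - ‖ζ‖ ^ 2))
  + (-9 * ‖z₁‖ ^ 2 - 3 * ‖z₂‖ ^ 2 - 6 * conj z₁ ^ 2 * ζ + 4 * √3 * z₁ * conj z₂ * ζ
      + 2 * √3 * conj (z₁ * z₂) * ζ ^ 2 : ℂ).re / (1 - ‖ζ‖ ^ 2) ^ 2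
  + 2 * ((3 * ‖z₁‖ ^ 2 + ‖z₂‖ ^ 2 + 3 * conj z₁ ^ 2 * ζ - 2 * √3 * z₁ * conj z₂ * ζ
      + conj z₂ ^ 2 * ζ ^ 3 - 2 * √3 * conj (z₁ * z₂) * ζ ^ 2 : ℂ).re / (1 - ‖ζ‖ ^ 2) ^ 3)

/-! ### The explicit symmetries

Components are listed in the order `∂/∂w, ∂/∂z₁, ∂/∂z₂, ∂/∂ζ`. -/

/-- The elements of degree `-2`, for all three models. -/
def fieldNegTwo (b : ℝ) : C4 → C4 := fun _ => ![2 * b * I, 0, 0, 0]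

/-- The elements of degree `-1` for type I. -/
def fieldINegOne (a₁ a₂ : ℂ) : C4 → C4 := fun p =>
  let z₁ := p 1; let z₂ := p 2; let ζ := p 3
  ![2 * (conj a₁ * z₂ + conj a₂ * z₁),
    a₁ - conj a₁ * (√2 * I * ζ ^ 2 / (2 * ζ + 1))
      - conj a₂ * ((1 + I) * (ζ + 1) * ζ / (2 * ζ + 1)),
    a₂ - conj a₁ * ((I - 1) * (ζ + 1) * ζ / (2 * ζ + 1))
      - conj a₂ * (√2 * I * ζ ^ 2 / (2 * ζ + 1)),
    0]

/-- The elements of degree `0` for type I. -/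
def fieldIZero (c : ℝ) (d : ℂ) : C4 → C4 := fun p =>
  let w := p 0; let z₁ := p 1; let z₂ := p 2; let ζ := p 3
  ![2 * c * w + conj d * (-(1 + I) * z₁ ^ 2 + (1 - I) * z₂ ^ 2),
    c * z₁ + d * exp (-(I * Real.pi / 4)) * z₂
      + 2 * conj d * ((-exp (I * Real.pi / 4) * (ζ ^ 2 + ζ + 1 / 2) * z₂
        + I * (ζ ^ 2 + ζ) * z₁) / (2 * ζ + 1)),
    c * z₂ + d * exp (I * Real.pi / 4) * z₁
      - 2 * conj d * ((exp (-(I * Real.pi / 4)) * (ζ ^ 2 + ζ + 1 / 2) * z₁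
        + I * (ζ ^ 2 + ζ) * z₂) / (2 * ζ + 1)),
    d * (2 * ζ + 1)]

/-- The elements of degree `-1` for type II. -/
def fieldIINegOne (a₁ a₂ : ℂ) : C4 → C4 := fun p =>
  let z₁ := p 1; let z₂ := p 2; let ζ := p 3
  ![2 * (conj a₂ * z₁ + conj a₁ * z₂),
    a₁ - conj a₁ * ζ - conj a₂ * ζ - conj a₂ * ζ ^ 2,
    a₂ - conj a₂ * ζ,
    0]

/-- The elements of degree `0` for type II. -/
def fieldIIZero (c : ℝ) (d : ℂ) : C4 → C4 := fun p =>
  let w := p 0; let z₁ := p 1; let z₂ := p 2; let ζ := p 3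
  ![2 * c * w + 2 * conj d * (z₂ ^ 2 + 2 * z₁ * z₂),
    c * z₁ + d * (z₂ + 2 * z₁) - conj d * z₂ - 2 * conj d * ζ * (2 * z₂ + z₁ + z₂ * ζ),
    c * z₂ - 2 * conj d * z₂ * (1 + ζ),
    2 * (d - conj d * ζ) * (1 + ζ)]

/-- The elements of degree `-1` for type III. -/
def fieldIIINegOne (a₁ a₂ : ℂ) : C4 → C4 := fun p =>
  let z₁ := p 1; let z₂ := p 2; let ζ := p 3
  ![2 * (conj a₁ * z₁ - conj a₂ * z₂),
    a₁ - 2 * conj a₁ * ζ + √3 * conj a₂ * ζ ^ 2,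
    a₂ - √3 * conj a₁ * ζ ^ 2 + 2 * conj a₂ * ζ ^ 3,
    0]

/-- The elements of degree `0` for type III. -/
def fieldIIIZero (c₁ c₂ : ℂ) : C4 → C4 := fun p =>
  let w := p 0; let z₁ := p 1; let z₂ := p 2; let ζ := p 3
  ![2 * c₂.re * w + 2 * conj c₁ * z₁ ^ 2,
    c₂ * z₁ + √3 * conj c₁ * z₂ - 4 * conj c₁ * z₁ * ζ,
    √3 * c₁ * z₁ + c₂ * z₂ + 2 * I * c₂.im * z₂ - 2 * √3 * conj c₁ * z₁ * ζ ^ 2,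
    c₁ - conj c₁ * ζ ^ 2 + 2 * I * c₂.im * ζ]

/-! ### The contact parabolic subalgebra of the split real form of `Lie(G₂)` -/

/-- The class in `LieAlgebra.g₂ ℝ` of a Chevalley generator. -/
def g2Gen (x : CartanMatrix.Generators (Fin 2)) : LieAlgebra.g₂ ℝ :=
  (LieSubmodule.Quotient.mk (FreeLieAlgebra.of ℝ x) :
    FreeLieAlgebra ℝ (CartanMatrix.Generators (Fin 2)) ⧸
      CartanMatrix.Relations.toIdeal ℝ CartanMatrix.G₂)

/-- The contact parabolic subalgebra of the split real Lie algebra of type `G₂`: the standard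
(maximal) parabolic generated by the Borel subalgebra (the `H i` and `E i`) and the negative root
vector of the short simple root. In the Cartan matrix `!![2, -3; -1, 2]`, where
`[H i, E j] = CM i j • E j`, the simple root `0` is the short one and `1` is the long one, the one
that is not orthogonal to the highest root. -/
def g2ContactParabolic : LieSubalgebra ℝ (LieAlgebra.g₂ ℝ) :=
  LieSubalgebra.lieSpan ℝ (LieAlgebra.g₂ ℝ)
    {g2Gen (.H 0), g2Gen (.H 1), g2Gen (.E 0), g2Gen (.E 1), g2Gen (.F 0)}

end

set_option linter.unusedSimpArgs false
set_option linter.unnecessarySeqFocus false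

noncomputable section

/-! Each hypersurface is presented through a real symmetric form K on ℂ² and a holomorphic curve
B(ζ) of matrices with B(0) = 0 and KB symmetric: it consists of the points with z = a - B(ζ)ā and Re
w = Re K(ā, z). For fixed a and imaginary b the curve ζ ↦ (b + K(ā, z), z, ζ) lies in the
hypersurface. With ξ = ā, the differential of Re w - Q is the real part of θ = dw - 2K(ξ, dz) - K(ξ,
B'ξ)dζ (`IsGraph.fderiv_graphFun`), so a field V is a symmetry exactly when Re θ(V) = 0 in the
parameters (b, a, ζ) (`IsGraph.mem_infSym_iff`).

Upper bound. Along such a curve θ(V) is holomorphic in ζ with zero real part, so its ζ-derivative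
vanishes. Polarization makes ξ independent of the base point; the derivative is a polynomial of
degree at most 4 in ξ, and its homogeneous parts are linear differential equations for the
coefficients f, g₁, g₂, h of ∂_w, ∂_{z₁}, ∂_{z₂}, ∂_ζ (`IsGraph.determining`). The same polarization
at ξ = 0 gives a reflection formula for f: it is at most quadratic in z, and its 2-jet at the origin
is tied to the conjugates of the 1-jets of the other coefficients (`IsGraph.cubic`,
`IsGraph.reality`). For each model, cross-differentiation in the differential ring of germs then
shows that a symmetry vanishes when all values at 0 and f_w(0) vanish, together with Im h_ζ(0) for
type III (`modelI_eq_zero`, `modelII_eq_zero`, `modelIII_eq_zero`). As f(0) is imaginary and f_w(0)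
is real, this leaves 8, 8 and 9 real parameters.

Lower bound and grading. On the parametrization the ζ-dependence of θ of the listed fields cancels
and an imaginary number remains, so they are symmetries and realize every such jet. They are
eigenvectors of the bracket with the weighted Euler field 2w∂_w + z₁∂_{z₁} + z₂∂_{z₂}, and the
grading is the eigenspace decomposition (`exists_grading`). For type I, non-polynomiality is the
obstruction to cancelling the denominator at ζ = -1/2.

Type III and G₂. Five symmetries satisfy the relations of the generators E₀, E₁, F₀, H₀, H₁ of the
parabolic. These relations alone make nine explicit brackets span the generated subalgebra
(`G2Rel.lieSpan_eq`). If the nine brackets are independent on both sides, the subalgebra generated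
by the pairs of generators in the product projects isomorphically to both factors
(`G2Rel.nonempty_lieEquiv`). Independence follows from the dimension count on the side of the
symmetries, and from a seven-dimensional matrix representation on the side of G₂. -/

/-! ### Polarization of analytic functions -/

/-- An analytic function on a disc whose real part vanishes on the real axis is antisymmetric under
reflection in the real axis. -/
theorem eq_neg_conj_of_re_eq_zero {φ : ℂ → ℂ} {r : ℝ} (hr : 0 < r)
    (hφ : DifferentiableOn ℂ φ (Metric.ball 0 r))
    (h : ∀ t : ℝ, |t| < r → (φ t).re = 0) {t : ℂ} (ht : ‖t‖ < r) :
    φ t = -conj (φ (conj t)) := by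
  have ho : IsOpen (Metric.ball (0 : ℂ) r) := Metric.isOpen_ball
  -- The sum of φ and its Schwarz reflection is holomorphic and equals 2 Re φ = 0 on the real axis,
  -- so the identity theorem applies.
  have h1 : DifferentiableOn ℂ (fun t => φ t + conj (φ (conj t))) (Metric.ball 0 r) := by
    intro z hz
    refine DifferentiableAt.differentiableWithinAt ?_
    have hz' : conj z ∈ Metric.ball (0 : ℂ) r := by simpa using hz
    have h2 := (hφ.differentiableAt (ho.mem_nhds hz'))
    have h3 := h2.conj_conj
    simp only [Complex.conj_conj] at h3
    exact (hφ.differentiableAt (ho.mem_nhds hz)).add h3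
  have h2 : AnalyticOnNhd ℂ (fun t => φ t + conj (φ (conj t))) (Metric.ball 0 r) :=
    h1.analyticOnNhd ho
  have h3 : ∃ᶠ z in 𝓝[≠] (0 : ℂ), φ z + conj (φ (conj z)) = 0 := by
    rw [Filter.frequently_iff]
    intro U hU
    rw [mem_nhdsWithin] at hU
    obtain ⟨V, hV, h0, hVU⟩ := hU
    obtain ⟨ε, hε, hεV⟩ := Metric.isOpen_iff.1 hV 0 h0
    have hm : 0 < min ε r / 2 := by positivity
    have hm1 : min ε r / 2 < ε := by
      have := min_le_left ε r
      linarith [lt_min hε hr]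
    have hm2 : min ε r / 2 < r := by
      have := min_le_right ε r
      linarith [lt_min hε hr]
    refine ⟨((min ε r / 2 : ℝ) : ℂ), hVU ⟨hεV ?_, ?_⟩, ?_⟩
    · rw [mem_ball_zero_iff, Complex.norm_real, Real.norm_of_nonneg hm.le]
      exact hm1
    · simpa using hm.ne'
    · rw [Complex.conj_ofReal, Complex.add_conj, h _ (by rwa [abs_of_pos hm])]
      simp
  have h4 := h2.eqOn_zero_of_preconnected_of_frequently_eq_zero
    (convex_ball (0 : ℂ) r).isPreconnected (Metric.mem_ball_self hr) h3
  have h5 := h4 (mem_ball_zero_iff.2 ht)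
  exact eq_neg_of_add_eq_zero_left h5

/-- Polarization: the real part of an analytic function of `(p, q)` vanishes on the totally real
subspace `q = conj p`. -/
theorem AnalyticAt.eq_neg_conj_swap {n : ℕ} {K : (Fin n → ℂ) × (Fin n → ℂ) → ℂ}
    (hK : AnalyticAt ℂ K 0) (h : ∀ᶠ p in 𝓝 (0 : Fin n → ℂ), (K (p, star p)).re = 0) :
    ∀ᶠ x in 𝓝 (0 : (Fin n → ℂ) × (Fin n → ℂ)), K x = -conj (K (star x.2, star x.1)) := by
  have hA := hK.eventually_analyticAt
  obtain ⟨r, hr, hrA⟩ := Metric.eventually_nhds_iff_ball.1 hA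
  obtain ⟨r', hr', hrB⟩ := Metric.eventually_nhds_iff_ball.1 h
  set ρ := min r r' with hρ
  have hρ0 : 0 < ρ := lt_min hr hr'
  filter_upwards [Metric.ball_mem_nhds (0 : (Fin n → ℂ) × (Fin n → ℂ)) (ε := ρ / 4)
    (by positivity)] with x hx
  obtain ⟨p, q⟩ := x
  rw [mem_ball_zero_iff, Prod.norm_def, max_lt_iff] at hx
  obtain ⟨hp, hq⟩ := hx
  simp only at hp hq
  -- The points p0, p1 are chosen so that the complex line t ↦ (p0 + t p1, star p0 + t star p1) lies
  -- in the totally real subspace for real t and passes through (p, q) at t = i.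
  set p0 : Fin n → ℂ := (2⁻¹ : ℂ) • (p + star q) with hp0
  set p1 : Fin n → ℂ := (-(2⁻¹ : ℂ) * I) • (p - star q) with hp1
  have hI2 : I * I = -1 := Complex.I_mul_I
  have e1 : p0 + I • p1 = p := by
    funext i
    simp only [hp0, hp1, Pi.add_apply, Pi.smul_apply, Pi.sub_apply, smul_eq_mul, Pi.star_apply]
    linear_combination (-(2⁻¹ : ℂ)) * (p i - star (q i)) * hI2
  have e2 : star p0 + I • star p1 = q := by
    funext i
    simp only [hp0, hp1, Pi.add_apply, Pi.smul_apply, Pi.sub_apply, smul_eq_mul, Pi.star_apply,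
      star_mul', star_add, star_sub, star_neg, Complex.star_def, Complex.conj_I, map_inv₀,
      Complex.conj_ofNat, Complex.conj_conj]
    linear_combination (2⁻¹ : ℂ) * (conj (p i) - q i) * hI2
  have n0 : ‖p0‖ < ρ / 4 := by
    rw [hp0, norm_smul]
    have := norm_add_le p (star q)
    rw [norm_star] at this
    norm_num
    linarith
  have n1 : ‖p1‖ < ρ / 4 := by
    rw [hp1, norm_smul]
    have := norm_sub_le p (star q)
    rw [norm_star] at this
    norm_num
    linarith
  have bound : ∀ (u v : Fin n → ℂ), ‖u‖ < ρ / 4 → ‖v‖ < ρ / 4 → ∀ t : ℂ, ‖t‖ < 2 →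
      ‖u + t • v‖ < ρ := by
    intro u v hu hv t ht
    have h1 := norm_add_le u (t • v)
    rw [norm_smul] at h1
    have : ‖t‖ * ‖v‖ ≤ 2 * ‖v‖ := by gcongr
    linarith
  have n0' : ‖star p0‖ < ρ / 4 := by rwa [norm_star]
  have n1' : ‖star p1‖ < ρ / 4 := by rwa [norm_star]
  -- At t = -i, the conjugate of i, the line passes through (star q, star p). The disc of radius 2
  -- contains both ±i, and the bounds ρ/4 keep the line inside the domain there.
  have main := eq_neg_conj_of_re_eq_zero (φ := fun t : ℂ => K (p0 + t • p1, star p0 + t • star p1))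
    (r := 2) two_pos ?_ ?_ (t := I) (by simp)
  · simp only [e1, e2] at main
    rw [main]
    congr 3
    rw [← e2, ← e1]
    simp [star_add, star_smul]
  · intro t ht
    rw [mem_ball_zero_iff] at ht
    refine DifferentiableAt.differentiableWithinAt ?_
    have hin : (p0 + t • p1, star p0 + t • star p1) ∈
        Metric.ball (0 : (Fin n → ℂ) × (Fin n → ℂ)) r := by
      rw [mem_ball_zero_iff, Prod.norm_def, max_lt_iff]
      exact ⟨(bound _ _ n0 n1 t ht).trans_le (min_le_left _ _),
        (bound _ _ n0' n1' t ht).trans_le (min_le_left _ _)⟩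
    have hd := (hrA _ hin).differentiableAt
    exact hd.comp (f := fun t : ℂ => (p0 + t • p1, star p0 + t • star p1)) t (by fun_prop)
  · intro t ht
    have hin : p0 + (t : ℂ) • p1 ∈ Metric.ball (0 : Fin n → ℂ) r' := by
      rw [mem_ball_zero_iff]
      exact (bound _ _ n0 n1 t (by simpa using ht)).trans_le (min_le_right _ _)
    have h1 := hrB _ hin
    have h2 : star (p0 + (t : ℂ) • p1) = star p0 + (t : ℂ) • star p1 := by
      simp [star_add, star_smul]
    rwa [h2] at h1

/-- Polarization: an analytic function of `(p, q)` that vanishes on the totally real subspace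
`q = conj p` is zero. -/
theorem AnalyticAt.eventually_eq_zero_of_conj {n : ℕ} {K : (Fin n → ℂ) × (Fin n → ℂ) → ℂ}
    (hK : AnalyticAt ℂ K 0) (h : ∀ᶠ p in 𝓝 (0 : Fin n → ℂ), K (p, star p) = 0) :
    ∀ᶠ x in 𝓝 (0 : (Fin n → ℂ) × (Fin n → ℂ)), K x = 0 := by
  have h1 := hK.eq_neg_conj_swap (h.mono fun p hp => by simp [hp])
  -- The reflection identities for K and for iK have opposite signs, which forces K = 0.
  have h2 := (analyticAt_const (v := I)).mul hK |>.eq_neg_conj_swap (h.mono fun p hp => by simp [hp])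
  filter_upwards [h1, h2] with x e1 e2
  have e3 : I * K x = -conj (I * K (star x.2, star x.1)) := e2
  rw [map_mul, Complex.conj_I] at e3
  have h3 : I * (2 * K x) = 0 := by linear_combination e3 + I * e1
  simpa using h3

/-! ### The differential ring of scalar germs -/

/-- The ring of germs at `0` of holomorphic functions on `ℂ⁴`. -/
def scalarGermSubring : Subring (Germ (𝓝 (0 : C4)) ℂ) where
  carrier := {g | ∃ F : C4 → ℂ, AnalyticAt ℂ F 0 ∧ g = (F : Germ (𝓝 (0 : C4)) ℂ)}
  add_mem' := by
    rintro _ _ ⟨X, hX, rfl⟩ ⟨Y, hY, rfl⟩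
    exact ⟨X + Y, hX.add hY, rfl⟩
  zero_mem' := ⟨0, analyticAt_const, rfl⟩
  mul_mem' := by
    rintro _ _ ⟨X, hX, rfl⟩ ⟨Y, hY, rfl⟩
    exact ⟨X * Y, hX.mul hY, rfl⟩
  one_mem' := ⟨1, analyticAt_const, rfl⟩
  neg_mem' := by
    rintro _ ⟨X, hX, rfl⟩
    exact ⟨-X, hX.neg, rfl⟩

/-- Germs at `0` of holomorphic functions on `ℂ⁴`. -/
def HolFun : Type := scalarGermSubring

instance : CommRing HolFun := inferInstanceAs (CommRing scalarGermSubring)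

namespace HolFun

/-- The germ of a function that is holomorphic near `0`. -/
def of (F : C4 → ℂ) (hF : AnalyticAt ℂ F 0) : HolFun := ⟨(F : Germ (𝓝 (0 : C4)) ℂ), F, hF, rfl⟩

theorem exists_rep (x : HolFun) : ∃ F, ∃ hF : AnalyticAt ℂ F 0, x = of F hF := by
  obtain ⟨g, F, hF, rfl⟩ := x
  exact ⟨F, hF, rfl⟩

theorem of_eq_of {F G : C4 → ℂ} {hF : AnalyticAt ℂ F 0} {hG : AnalyticAt ℂ G 0} :
    of F hF = of G hG ↔ F =ᶠ[𝓝 0] G :=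
  Subtype.ext_iff.trans Germ.coe_eq

theorem of_add {F G : C4 → ℂ} (hF : AnalyticAt ℂ F 0) (hG : AnalyticAt ℂ G 0) :
    of F hF + of G hG = of (F + G) (hF.add hG) := rfl

theorem of_mul {F G : C4 → ℂ} (hF : AnalyticAt ℂ F 0) (hG : AnalyticAt ℂ G 0) :
    of F hF * of G hG = of (F * G) (hF.mul hG) := rfl

theorem of_neg {F : C4 → ℂ} (hF : AnalyticAt ℂ F 0) : -of F hF = of (-F) hF.neg := rfl

theorem of_sub {F G : C4 → ℂ} (hF : AnalyticAt ℂ F 0) (hG : AnalyticAt ℂ G 0) :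
    of F hF - of G hG = of (F - G) (hF.sub hG) := by
  rw [sub_eq_add_neg, of_neg, of_add]
  simp only [sub_eq_add_neg]

/-- Constants. -/
def C : ℂ →+* HolFun where
  toFun c := of (fun _ => c) analyticAt_const
  map_one' := rfl
  map_mul' _ _ := rfl
  map_zero' := rfl
  map_add' _ _ := rfl

theorem C_def (c : ℂ) : C c = of (fun _ => c) analyticAt_const := rfl

theorem analyticAt_coord (i : Fin 4) (q : C4) : AnalyticAt ℂ (fun p : C4 => p i) q :=
  (ContinuousLinearMap.proj (R := ℂ) (φ := fun _ : Fin 4 => ℂ) i).analyticAt q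

/-- The coordinate functions. -/
def X (i : Fin 4) : HolFun := of (fun p => p i) (analyticAt_coord i 0)

/-- The value at `0`. -/
def ev : HolFun →+* ℂ where
  toFun x := Germ.value x.1
  map_one' := rfl
  map_mul' x y := by
    obtain ⟨F, hF, rfl⟩ := x.exists_rep
    obtain ⟨G, hG, rfl⟩ := y.exists_rep
    rfl
  map_zero' := rfl
  map_add' x y := by
    obtain ⟨F, hF, rfl⟩ := x.exists_rep
    obtain ⟨G, hG, rfl⟩ := y.exists_rep
    rfl

@[simp] theorem ev_of {F : C4 → ℂ} (hF : AnalyticAt ℂ F 0) : ev (of F hF) = F 0 := rfl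
@[simp] theorem ev_C (c : ℂ) : ev (C c) = c := rfl
@[simp] theorem ev_X (i : Fin 4) : ev (X i) = 0 := rfl

theorem analyticAt_partial {F : C4 → ℂ} (hF : AnalyticAt ℂ F 0) (i : Fin 4) :
    AnalyticAt ℂ (fun p => fderiv ℂ F p (Pi.single i 1)) 0 :=
  ((ContinuousLinearMap.apply ℂ ℂ (Pi.single i 1 : C4)).analyticAt _).comp hF.fderiv

/-- The partial derivatives. -/
def d (i : Fin 4) (x : HolFun) : HolFun :=
  ⟨Quotient.map (fun F : C4 → ℂ => fun p => fderiv ℂ F p (Pi.single i 1))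
    (fun F G h => by
      have h1 : F =ᶠ[𝓝 0] G := h
      exact (h1.fderiv (𝕜 := ℂ)).mono fun p hp => by simp only [hp]) x.1, by
    obtain ⟨F, hF, rfl⟩ := x.exists_rep
    exact ⟨_, analyticAt_partial hF i, rfl⟩⟩

theorem d_of {F : C4 → ℂ} (hF : AnalyticAt ℂ F 0) (i : Fin 4) :
    d i (of F hF) = of (fun p => fderiv ℂ F p (Pi.single i 1)) (analyticAt_partial hF i) := rfl

theorem d_add (i : Fin 4) (x y : HolFun) : d i (x + y) = d i x + d i y := by
  obtain ⟨F, hF, rfl⟩ := x.exists_rep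
  obtain ⟨G, hG, rfl⟩ := y.exists_rep
  rw [of_add, d_of, d_of, d_of, of_add, of_eq_of]
  filter_upwards [hF.eventually_analyticAt, hG.eventually_analyticAt] with p h1 h2
  rw [fderiv_add h1.differentiableAt h2.differentiableAt]
  rfl

theorem d_mul (i : Fin 4) (x y : HolFun) : d i (x * y) = d i x * y + x * d i y := by
  obtain ⟨F, hF, rfl⟩ := x.exists_rep
  obtain ⟨G, hG, rfl⟩ := y.exists_rep
  rw [of_mul, d_of, d_of, d_of, of_mul, of_mul, of_add, of_eq_of]
  filter_upwards [hF.eventually_analyticAt, hG.eventually_analyticAt] with p h1 h2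
  rw [fderiv_mul h1.differentiableAt h2.differentiableAt]
  simp only [FunLike.coe_add, Pi.add_apply, FunLike.coe_smul, Pi.smul_apply, smul_eq_mul,
    Pi.mul_apply]
  ring

@[simp] theorem d_C (i : Fin 4) (c : ℂ) : d i (C c) = 0 := by
  rw [C_def, d_of, ← map_zero C, C_def, of_eq_of]
  exact Eventually.of_forall fun p => by simp

@[simp] theorem d_zero (i : Fin 4) : d i 0 = 0 := by rw [← map_zero C, d_C, map_zero]
@[simp] theorem d_one (i : Fin 4) : d i 1 = 0 := by rw [← map_one C, d_C]

theorem d_neg (i : Fin 4) (x : HolFun) : d i (-x) = -d i x := by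
  have h := d_add i x (-x)
  rw [add_neg_cancel, d_zero] at h
  linear_combination -h

theorem d_sub (i : Fin 4) (x y : HolFun) : d i (x - y) = d i x - d i y := by
  rw [sub_eq_add_neg, d_add, d_neg, ← sub_eq_add_neg]

@[simp] theorem d_ofNat (i : Fin 4) (n : ℕ) [n.AtLeastTwo] :
    d i (OfNat.ofNat n : HolFun) = 0 := by
  rw [← map_ofNat C n, d_C]

theorem d_X (i j : Fin 4) : d i (X j) = if i = j then 1 else 0 := by
  have h : d i (X j) = C (if i = j then 1 else 0) := by
    rw [X, d_of, C_def, of_eq_of]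
    refine Eventually.of_forall fun p => ?_
    have h2 : fderiv ℂ (fun p : C4 => p j) p
        = ContinuousLinearMap.proj (R := ℂ) (φ := fun _ : Fin 4 => ℂ) j :=
      (ContinuousLinearMap.proj (R := ℂ) (φ := fun _ : Fin 4 => ℂ) j).fderiv
    simp only [h2, ContinuousLinearMap.proj_apply, Pi.single_apply, eq_comm]
  rw [h]
  split_ifs <;> simp

theorem d_comm (i j : Fin 4) (x : HolFun) : d i (d j x) = d j (d i x) := by
  obtain ⟨F, hF, rfl⟩ := x.exists_rep
  rw [d_of, d_of, d_of, d_of, of_eq_of]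
  filter_upwards [hF.eventually_analyticAt] with p hp
  have h1 : DifferentiableAt ℂ (fderiv ℂ F) p := hp.fderiv.differentiableAt
  have h2 : IsSymmSndFDerivAt ℂ F p :=
    (hp.contDiffAt (n := 2)).isSymmSndFDerivAt (by simp)
  rw [fderiv_clm_apply h1 (differentiableAt_const _), fderiv_clm_apply h1 (differentiableAt_const _)]
  simpa using h2.eq _ _

/-- A germ with vanishing partial derivatives is constant. -/
theorem eq_C_of_d_eq_zero {x : HolFun} (h : ∀ i, d i x = 0) : x = C (ev x) := by
  obtain ⟨F, hF, rfl⟩ := x.exists_rep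
  have h1 : ∀ᶠ p in 𝓝 (0 : C4), fderiv ℂ F p = 0 := by
    have h2 : ∀ i, ∀ᶠ p in 𝓝 (0 : C4), fderiv ℂ F p (Pi.single i 1) = 0 := fun i => by
      have h3 := h i
      rw [d_of, ← map_zero C, C_def, of_eq_of] at h3
      exact h3
    filter_upwards [eventually_all.2 h2] with p hp
    ext v
    have hv : v = ∑ i, v i • (Pi.single i 1 : C4) := by
      funext j
      simp [Finset.sum_apply, Pi.single_apply]
    rw [hv, map_sum]
    simp [hp]
  obtain ⟨r, hr, hb⟩ := Metric.eventually_nhds_iff_ball.1 (h1.and hF.eventually_analyticAt)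
  rw [ev_of, C_def, of_eq_of]
  filter_upwards [Metric.ball_mem_nhds (0 : C4) hr] with p hp
  exact (convex_ball (0 : C4) r).is_const_of_fderivWithin_eq_zero (𝕜 := ℂ)
    (fun q hq => (hb q hq).2.differentiableAt.differentiableWithinAt)
    (fun q hq => by
      rw [fderivWithin_of_isOpen Metric.isOpen_ball hq, (hb q hq).1]) hp (Metric.mem_ball_self hr)

theorem C_mul_inv_C {c : ℂ} (hc : c ≠ 0) : C c * C c⁻¹ = 1 := by
  rw [← map_mul, mul_inv_cancel₀ hc, map_one]

/-- Cancellation of a nonzero constant factor. -/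
theorem eq_zero_of_C_mul {c : ℂ} (hc : c ≠ 0) {x : HolFun} (h : C c * x = 0) : x = 0 := by
  have h1 := C_mul_inv_C hc
  linear_combination (-x) * h1 + C c⁻¹ * h

theorem eq_zero_of_ofNat_mul {n : ℕ} [n.AtLeastTwo] {x : HolFun}
    (h : (OfNat.ofNat n : HolFun) * x = 0) : x = 0 := by
  rw [← map_ofNat C n] at h
  exact eq_zero_of_C_mul (OfNat.ofNat_ne_zero n) h

end HolFun

/-! ### Coefficients of germs of vector fields, and the hypersurfaces defined by K and B -/

section

namespace HolGerm

theorem analyticAt_apply {V : C4 → C4} (hV : AnalyticAt ℂ V 0) (i : Fin 4) :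
    AnalyticAt ℂ (fun p => V p i) 0 := analyticAt_pi_iff.1 hV i

/-- The coefficients of a germ of a vector field. -/
def comp (i : Fin 4) (X : HolGerm) : HolFun :=
  ⟨X.1.map fun v => v i, by
    obtain ⟨V, hV, rfl⟩ := X.exists_rep
    exact ⟨_, analyticAt_apply hV i, rfl⟩⟩

theorem comp_of {V : C4 → C4} (hV : AnalyticAt ℂ V 0) (i : Fin 4) :
    comp i (of V hV) = HolFun.of (fun p => V p i) (analyticAt_apply hV i) := rfl

theorem ext_comp {X Y : HolGerm} (h : ∀ i, comp i X = comp i Y) : X = Y := by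
  obtain ⟨V, hV, rfl⟩ := X.exists_rep
  obtain ⟨W, hW, rfl⟩ := Y.exists_rep
  simp only [comp_of, HolFun.of_eq_of] at h
  apply of_eq_of
  filter_upwards [eventually_all.2 h] with p hp
  exact funext hp

theorem comp_add (i : Fin 4) (X Y : HolGerm) : comp i (X + Y) = comp i X + comp i Y := by
  obtain ⟨V, hV, rfl⟩ := X.exists_rep
  obtain ⟨W, hW, rfl⟩ := Y.exists_rep
  rfl

theorem comp_smul (i : Fin 4) (t : ℝ) (X : HolGerm) :
    comp i (t • X) = HolFun.C t * comp i X := by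
  obtain ⟨V, hV, rfl⟩ := X.exists_rep
  rw [smul_of]
  rfl

theorem comp_zero (i : Fin 4) : comp i 0 = 0 := rfl

/-- With this formula, brackets of symmetries become computations in the differential ring `HolFun`,
where `ring` and `linear_combination` apply. -/
theorem comp_lie (i : Fin 4) (X Y : HolGerm) :
    comp i ⁅X, Y⁆ = ∑ j, (comp j X * HolFun.d j (comp i Y) - comp j Y * HolFun.d j (comp i X)) := by
  obtain ⟨V, hV, rfl⟩ := X.exists_rep
  obtain ⟨W, hW, rfl⟩ := Y.exists_rep
  have key : ∀ {V : C4 → C4} {p : C4}, AnalyticAt ℂ V p → ∀ v : C4,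
      fderiv ℂ V p v i = ∑ j, v j * fderiv ℂ (fun p => V p i) p (Pi.single j 1) := by
    intro V p hV v
    have h1 : fderiv ℂ (fun p => V p i) p v = fderiv ℂ V p v i := by
      rw [fderiv_apply hV.differentiableAt]
      rfl
    rw [← h1]
    have hv : v = ∑ j, v j • (Pi.single j 1 : C4) := by
      funext k
      simp [Finset.sum_apply, Pi.single_apply]
    conv_lhs => rw [hv, map_sum]
    simp
  rw [of_lie_of]
  simp only [comp_of, HolFun.d_of, HolFun.of_mul, HolFun.of_sub, Fin.sum_univ_four, HolFun.of_add]
  rw [HolFun.of_eq_of]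
  filter_upwards [hV.eventually_analyticAt, hW.eventually_analyticAt] with p h1 h2
  simp only [VectorField.lieBracket, Pi.sub_apply, key h1, key h2, Fin.sum_univ_four, Pi.add_apply,
    Pi.mul_apply]
  ring

theorem germ_eq_iff {X : HolGerm} {V : C4 → C4} (hV : AnalyticAt ℂ V 0) :
    X.germ = (V : Germ (𝓝 (0 : C4)) C4) ↔ X = of V hV :=
  ⟨fun h => ext_germ h, fun h => by rw [h]; rfl⟩

end HolGerm

/-! ### Tubular models

`M` is the hypersurface of all points `(w, z, s)` with `z = a - B(s) ā` and `Re w = Re K(ā, z)`. -/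

/-- A real symmetric form `K` on `ℂ²` and a holomorphic curve `B` of `2 × 2` matrices through `0`
that is symmetric with respect to `K`. -/
structure CRModel where
  k₁ : ℝ
  k₂ : ℝ
  k₃ : ℝ
  b : Fin 2 → Fin 2 → ℂ → ℂ
  an : ∀ i j, AnalyticAt ℂ (b i j) 0
  zero : ∀ i j, b i j 0 = 0
  symm : ∀ s, k₁ * b 0 1 s + k₂ * b 1 1 s = k₂ * b 0 0 s + k₃ * b 1 0 s

namespace CRModel

variable (M : CRModel)

/-- The form `K(u, v)`. -/
def K (u₁ u₂ v₁ v₂ : ℂ) : ℂ := M.k₁ * u₁ * v₁ + M.k₂ * (u₁ * v₂ + u₂ * v₁) + M.k₃ * u₂ * v₂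

/-- The first entry of `a - B(s) ξ`. -/
def z₁ (a₁ ξ₁ ξ₂ s : ℂ) : ℂ := a₁ - (M.b 0 0 s * ξ₁ + M.b 0 1 s * ξ₂)

/-- The second entry of `a - B(s) ξ`. -/
def z₂ (a₂ ξ₁ ξ₂ s : ℂ) : ℂ := a₂ - (M.b 1 0 s * ξ₁ + M.b 1 1 s * ξ₂)

/-- The leaf `s ↦ (b + K(ξ, a - B(s) ξ), a - B(s) ξ, s)`. -/
def pt (b a₁ a₂ ξ₁ ξ₂ s : ℂ) : C4 :=
  ![b + M.K ξ₁ ξ₂ (M.z₁ a₁ ξ₁ ξ₂ s) (M.z₂ a₂ ξ₁ ξ₂ s), M.z₁ a₁ ξ₁ ξ₂ s, M.z₂ a₂ ξ₁ ξ₂ s, s]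

/-- The quadratic form `K(ξ, B'(s) ξ)`. -/
def tau (ξ₁ ξ₂ s : ℂ) : ℂ :=
  M.K ξ₁ ξ₂ (deriv (M.b 0 0) s * ξ₁ + deriv (M.b 0 1) s * ξ₂)
    (deriv (M.b 1 0) s * ξ₁ + deriv (M.b 1 1) s * ξ₂)

/-- The contact form `dw - 2 K(ξ, dz) - K(ξ, B'(s) ξ) ds`. -/
def theta (ξ₁ ξ₂ s : ℂ) (v : C4) : ℂ := v 0 - 2 * M.K ξ₁ ξ₂ (v 1) (v 2) - M.tau ξ₁ ξ₂ s * v 3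

/-- The entries of `B B̄`. -/
def e (i j : Fin 2) (s : ℂ) : ℂ := M.b i 0 s * conj (M.b 0 j s) + M.b i 1 s * conj (M.b 1 j s)

/-- The determinant of `1 - B B̄`. -/
def D (s : ℂ) : ℂ := (1 - M.e 0 0 s) * (1 - M.e 1 1 s) - M.e 0 1 s * M.e 1 0 s

/-- First entry of the solution `a` of `z = a - B ā`. -/
def A₁ (p : C4) : ℂ :=
  ((1 - M.e 1 1 (p 3)) * (p 1 + (M.b 0 0 (p 3) * conj (p 1) + M.b 0 1 (p 3) * conj (p 2)))
    + M.e 0 1 (p 3) * (p 2 + (M.b 1 0 (p 3) * conj (p 1) + M.b 1 1 (p 3) * conj (p 2)))) / M.D (p 3)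

/-- Second entry of the solution `a` of `z = a - B ā`. -/
def A₂ (p : C4) : ℂ :=
  (M.e 1 0 (p 3) * (p 1 + (M.b 0 0 (p 3) * conj (p 1) + M.b 0 1 (p 3) * conj (p 2)))
    + (1 - M.e 0 0 (p 3)) * (p 2 + (M.b 1 0 (p 3) * conj (p 1) + M.b 1 1 (p 3) * conj (p 2))))
    / M.D (p 3)

theorem conj_K (u₁ u₂ v₁ v₂ : ℂ) :
    conj (M.K u₁ u₂ v₁ v₂) = M.K (conj u₁) (conj u₂) (conj v₁) (conj v₂) := by
  simp [K]

/-- The conjugate of det(1 - B B̄) is det(1 - B̄ B), which is the same number. -/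
theorem conj_D (s : ℂ) : conj (M.D s) = M.D s := by
  simp only [D, e, map_sub, map_mul, map_add, map_one, Complex.conj_conj]
  ring

/-- Substituting the conjugate equation z̄ = ā - B̄a into z = a - Bā gives (1 - B B̄)a = z + B z̄.
The functions `A₁`, `A₂` are Cramer's rule for this system. -/
theorem z₁_A (p : C4) (h : M.D (p 3) ≠ 0) :
    M.z₁ (M.A₁ p) (conj (M.A₁ p)) (conj (M.A₂ p)) (p 3) = p 1 := by
  simp only [z₁, A₁, A₂, map_div₀, conj_D]
  field_simp
  simp only [D, e, map_sub, map_mul, map_add, map_one, Complex.conj_conj]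
  ring

theorem z₂_A (p : C4) (h : M.D (p 3) ≠ 0) :
    M.z₂ (M.A₂ p) (conj (M.A₁ p)) (conj (M.A₂ p)) (p 3) = p 2 := by
  simp only [z₂, A₁, A₂, map_div₀, conj_D]
  field_simp
  simp only [D, e, map_sub, map_mul, map_add, map_one, Complex.conj_conj]
  ring

theorem A₁_pt (b a₁ a₂ s : ℂ) (h : M.D s ≠ 0) :
    M.A₁ (M.pt b a₁ a₂ (conj a₁) (conj a₂) s) = a₁ := by
  simp only [A₁, pt, Matrix.cons_val]
  rw [div_eq_iff h]
  simp only [z₁, z₂, D, e, map_sub, map_mul, map_add, Complex.conj_conj]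
  ring

theorem A₂_pt (b a₁ a₂ s : ℂ) (h : M.D s ≠ 0) :
    M.A₂ (M.pt b a₁ a₂ (conj a₁) (conj a₂) s) = a₂ := by
  simp only [A₂, pt, Matrix.cons_val]
  rw [div_eq_iff h]
  simp only [z₁, z₂, D, e, map_sub, map_mul, map_add, Complex.conj_conj]
  ring

theorem contDiffAt_apply (i : Fin 4) (p : C4) : ContDiffAt ℝ 2 (fun p : C4 => p i) p :=
  (ContinuousLinearMap.proj (R := ℝ) (φ := fun _ : Fin 4 => ℂ) i).contDiff.contDiffAt

theorem _root_.ContDiffAt.conj_comp {E : Type*} [NormedAddCommGroup E] [NormedSpace ℝ E] {n : ℕ∞}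
    {f : E → ℂ} {x : E} (h : ContDiffAt ℝ n f x) : ContDiffAt ℝ n (fun x => conj (f x)) x :=
  (Complex.conjCLE.contDiff.contDiffAt (n := n)).comp x h

theorem contDiffAt_b (i j : Fin 2) : ContDiffAt ℝ 2 (fun p : C4 => M.b i j (p 3)) 0 :=
  (((M.an i j).contDiffAt (n := 2)).restrict_scalars ℝ).comp (0 : C4) (contDiffAt_apply 3 0)

theorem contDiffAt_e (i j : Fin 2) : ContDiffAt ℝ 2 (fun p : C4 => M.e i j (p 3)) 0 :=
  ((M.contDiffAt_b i 0).mul (M.contDiffAt_b 0 j).conj_comp).add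
    ((M.contDiffAt_b i 1).mul (M.contDiffAt_b 1 j).conj_comp)

theorem contDiffAt_D : ContDiffAt ℝ 2 (fun p : C4 => M.D (p 3)) 0 :=
  ((contDiffAt_const.sub (M.contDiffAt_e 0 0)).mul (contDiffAt_const.sub (M.contDiffAt_e 1 1))).sub
    ((M.contDiffAt_e 0 1).mul (M.contDiffAt_e 1 0))

theorem D_zero : M.D 0 = 1 := by simp [D, e, M.zero]

theorem contDiffAt_A₁ : ContDiffAt ℝ 2 M.A₁ 0 := by
  have hb := M.contDiffAt_b
  have h1 := contDiffAt_apply 1 0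
  have h2 := contDiffAt_apply 2 0
  have hD : M.D ((0 : C4) 3) ≠ 0 := by
    change M.D 0 ≠ 0
    simp [D_zero]
  unfold A₁
  simp only [div_eq_mul_inv]
  refine ContDiffAt.mul ?_ (M.contDiffAt_D.inv hD)
  exact ((contDiffAt_const.sub (M.contDiffAt_e 1 1)).mul (h1.add (((hb 0 0).mul h1.conj_comp).add
    ((hb 0 1).mul h2.conj_comp)))).add ((M.contDiffAt_e 0 1).mul (h2.add
    (((hb 1 0).mul h1.conj_comp).add ((hb 1 1).mul h2.conj_comp))))

theorem contDiffAt_A₂ : ContDiffAt ℝ 2 M.A₂ 0 := by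
  have hb := M.contDiffAt_b
  have h1 := contDiffAt_apply 1 0
  have h2 := contDiffAt_apply 2 0
  have hD : M.D ((0 : C4) 3) ≠ 0 := by
    change M.D 0 ≠ 0
    simp [D_zero]
  unfold A₂
  simp only [div_eq_mul_inv]
  refine ContDiffAt.mul ?_ (M.contDiffAt_D.inv hD)
  exact ((M.contDiffAt_e 1 0).mul (h1.add (((hb 0 0).mul h1.conj_comp).add
    ((hb 0 1).mul h2.conj_comp)))).add ((contDiffAt_const.sub (M.contDiffAt_e 0 0)).mul (h2.add
    (((hb 1 0).mul h1.conj_comp).add ((hb 1 1).mul h2.conj_comp))))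

theorem A₁_zero : M.A₁ 0 = 0 := by simp [A₁, M.zero]
theorem A₂_zero : M.A₂ 0 = 0 := by simp [A₂, M.zero]

theorem tendsto_three : Tendsto (fun p : C4 => p 3) (𝓝 0) (𝓝 0) :=
  (continuous_apply (3 : Fin 4)).tendsto' _ _ rfl

theorem eventually_D : ∀ᶠ s in 𝓝 (0 : ℂ), M.D s ≠ 0 := by
  have h1 : ContinuousAt (fun s : ℂ => M.D ((fun _ => s : C4) 3)) 0 :=
    ContinuousAt.comp (f := fun s : ℂ => (fun _ => s : C4)) (x := 0)
      (g := fun p : C4 => M.D (p 3)) M.contDiffAt_D.continuousAt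
      (continuous_pi fun _ => continuous_id).continuousAt
  exact h1.eventually_ne (by
    change M.D 0 ≠ 0
    simp [D_zero])

/-- `Q` is the function of which the model is the graph. -/
def IsGraph (Q : ℂ → ℂ → ℂ → ℝ) : Prop :=
  ∀ᶠ s in 𝓝 (0 : ℂ), ∀ a₁ a₂ : ℂ,
    Q (M.z₁ a₁ (conj a₁) (conj a₂) s) (M.z₂ a₂ (conj a₁) (conj a₂) s) s =
      (M.K (conj a₁) (conj a₂) (M.z₁ a₁ (conj a₁) (conj a₂) s) (M.z₂ a₂ (conj a₁) (conj a₂) s)).re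

variable {M} {Q : ℂ → ℂ → ℂ → ℝ}

theorem IsGraph.graphFun_eq (hQ : M.IsGraph Q) : ∀ᶠ p in 𝓝 (0 : C4), graphFun Q p =
    (p 0 - M.K (conj (M.A₁ p)) (conj (M.A₂ p)) (p 1) (p 2)).re := by
  filter_upwards [tendsto_three.eventually hQ, tendsto_three.eventually M.eventually_D] with p h1 h2
  have h3 := h1 (M.A₁ p) (M.A₂ p)
  rw [M.z₁_A p h2, M.z₂_A p h2] at h3
  simp [graphFun, h3]

theorem contDiffAt_aux : ContDiffAt ℝ 2
    (fun p : C4 => (p 0 - M.K (conj (M.A₁ p)) (conj (M.A₂ p)) (p 1) (p 2)).re) 0 := by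
  have h0 := contDiffAt_apply 0 0
  have h1 := contDiffAt_apply 1 0
  have h2 := contDiffAt_apply 2 0
  have g1 := M.contDiffAt_A₁.conj_comp
  have g2 := M.contDiffAt_A₂.conj_comp
  refine (Complex.reCLM.contDiff.contDiffAt (n := 2)).comp (0 : C4) (h0.sub ?_)
  exact (((contDiffAt_const.mul g1).mul h1).add (contDiffAt_const.mul
    ((g1.mul h2).add (g2.mul h1)))).add ((contDiffAt_const.mul g2).mul h2)

theorem IsGraph.contDiffAt (hQ : M.IsGraph Q) : ContDiffAt ℝ 2 (graphFun Q) 0 :=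
  contDiffAt_aux.congr_of_eventuallyEq hQ.graphFun_eq

/-- The differential of the defining function is the real part of the contact form. -/
theorem IsGraph.fderiv_graphFun (hQ : M.IsGraph Q) : ∀ᶠ p in 𝓝 (0 : C4), ∀ v : C4, fderiv ℝ (graphFun Q) p v =
    (M.theta (conj (M.A₁ p)) (conj (M.A₂ p)) (p 3) v).re := by
  have hb : ∀ i j, ∀ᶠ p in 𝓝 (0 : C4), AnalyticAt ℂ (M.b i j) (p 3) := fun i j =>
    tendsto_three.eventually (M.an i j).eventually_analyticAt
  filter_upwards [hQ.graphFun_eq.eventually_nhds, hb 0 0, hb 0 1, hb 1 0, hb 1 1,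
    (tendsto_three.eventually M.eventually_D).eventually_nhds,
    M.contDiffAt_A₁.eventually (by simp), M.contDiffAt_A₂.eventually (by simp),
    hQ.contDiffAt.eventually (by simp)]
    with p h1 h00 h01 h10 h11 h2 h3 h4 h5 v
  have hline : Tendsto (fun t : ℝ => p + t • v) (𝓝 0) (𝓝 p) :=
    (by fun_prop : Continuous fun t : ℝ => p + t • v).tendsto' _ _ (by simp)
  have hl : HasDerivAt (fun t : ℝ => p + t • v) v 0 := by
    simpa using ((hasDerivAt_id (0 : ℝ)).smul_const v).const_add p
  have hlp : ∀ i, HasDerivAt (fun t : ℝ => (p + t • v) i) (v i) 0 := hasDerivAt_pi.1 hl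
  have lin : ∀ {F : Type} [NormedAddCommGroup F] [NormedSpace ℝ F] {f : C4 → F},
      DifferentiableAt ℝ f p → HasDerivAt (fun t : ℝ => f (p + t • v)) (fderiv ℝ f p v) 0 := by
    intro F _ _ f hf
    have hf' : HasFDerivAt f (fderiv ℝ f p) (p + (0 : ℝ) • v) := by simpa using hf.hasFDerivAt
    exact hf'.comp_hasDerivAt (0 : ℝ) hl
  have a1 := lin (h3.differentiableAt (by simp))
  have a2 := lin (h4.differentiableAt (by simp))
  set α₁ := fderiv ℝ M.A₁ p v
  set α₂ := fderiv ℝ M.A₂ p v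
  have c1 : HasDerivAt (fun t : ℝ => conj (M.A₁ (p + t • v))) (conj α₁) 0 := a1.star
  have c2 : HasDerivAt (fun t : ℝ => conj (M.A₂ (p + t • v))) (conj α₂) 0 := a2.star
  have bb : ∀ {i j}, AnalyticAt ℂ (M.b i j) (p 3) →
      HasDerivAt (fun t : ℝ => M.b i j ((p + t • v) 3)) (deriv (M.b i j) (p 3) * v 3) 0 := by
    intro i j h
    have h' : HasDerivAt (M.b i j) (deriv (M.b i j) (p 3)) ((p + (0 : ℝ) • v) 3) := by
      simpa using h.differentiableAt.hasDerivAt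
    exact h'.comp (0 : ℝ) (hlp 3)
  -- Differentiation of z = a - B(ζ)ā in the direction v, with α the derivative of a: v_z = α - B'ā
  -- v_ζ - Bᾱ.
  have e1 : v 1 = α₁ - ((deriv (M.b 0 0) (p 3) * v 3 * conj (M.A₁ p) + M.b 0 0 (p 3) * conj α₁)
      + (deriv (M.b 0 1) (p 3) * v 3 * conj (M.A₂ p) + M.b 0 1 (p 3) * conj α₂)) := by
    have t1 := a1.sub (((bb h00).mul c1).add ((bb h01).mul c2))
    simp only [zero_smul, add_zero] at t1
    refine (hlp 1).unique (t1.congr_of_eventuallyEq ?_)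
    filter_upwards [hline.eventually h2] with t ht
    exact (M.z₁_A _ ht).symm
  have e2 : v 2 = α₂ - ((deriv (M.b 1 0) (p 3) * v 3 * conj (M.A₁ p) + M.b 1 0 (p 3) * conj α₁)
      + (deriv (M.b 1 1) (p 3) * v 3 * conj (M.A₂ p) + M.b 1 1 (p 3) * conj α₂)) := by
    have t1 := a2.sub (((bb h10).mul c1).add ((bb h11).mul c2))
    simp only [zero_smul, add_zero] at t1
    refine (hlp 2).unique (t1.congr_of_eventuallyEq ?_)
    filter_upwards [hline.eventually h2] with t ht
    exact (M.z₂_A _ ht).symm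
  have e3 : fderiv ℝ (graphFun Q) p v = (v 0 - (M.K (conj α₁) (conj α₂) (p 1) (p 2)
      + M.K (conj (M.A₁ p)) (conj (M.A₂ p)) (v 1) (v 2))).re := by
    have t1 := lin (h5.differentiableAt (by simp))
    have t2 := (hlp 0).sub ((((c1.const_mul (M.k₁ : ℂ)).mul (hlp 1)).add
      (((c1.mul (hlp 2)).add (c2.mul (hlp 1))).const_mul (M.k₂ : ℂ))).add
      ((c2.const_mul (M.k₃ : ℂ)).mul (hlp 2)))
    have t3 := Complex.reCLM.hasFDerivAt.comp_hasDerivAt (0 : ℝ) t2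
    simp only [zero_smul, add_zero] at t3
    refine t1.unique ((t3.congr_of_eventuallyEq ?_).congr_deriv ?_)
    · filter_upwards [hline.eventually h1] with t ht
      exact ht
    · simp only [Complex.reCLM_apply, K]
      congr 1
      ring
  have z1 := M.z₁_A p h2.self_of_nhds
  have z2 := M.z₂_A p h2.self_of_nhds
  rw [e3]
  set x := v 0 - (M.K (conj α₁) (conj α₂) (p 1) (p 2)
      + M.K (conj (M.A₁ p)) (conj (M.A₂ p)) (v 1) (v 2)) with hx
  set y := M.theta (conj (M.A₁ p)) (conj (M.A₂ p)) (p 3) v with hy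
  -- The B'-terms cancel against τ, and K(ᾱ, Bā) = K(ā, Bᾱ) by the symmetry of KB. What remains is a
  -- number minus its conjugate, which does not contribute to the real part.
  have key : x - y = M.K α₁ α₂ (conj (M.A₁ p)) (conj (M.A₂ p))
      - conj (M.K α₁ α₂ (conj (M.A₁ p)) (conj (M.A₂ p))) := by
    have s1 := M.symm (p 3)
    rw [hx, hy, ← z1, ← z2, conj_K]
    simp only [theta, tau, z₁, z₂, K, Complex.conj_conj, e1, e2]
    linear_combination (conj (M.A₂ p) * conj α₁ - conj (M.A₁ p) * conj α₂) * s1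
  have h6 := congrArg Complex.re key
  simp only [Complex.sub_re, Complex.conj_re, sub_self] at h6
  linarith
end CRModel

end

section

/-! ### The infinitesimal symmetries of a graph form a Lie algebra -/

/-- Consequently q ↦ q - ρ(q)∂_w is a retraction onto the hypersurface, which turns identities valid
on it into identities on open sets. -/
theorem graphFun_sub_smul (Q : ℂ → ℂ → ℂ → ℝ) (q : C4) (t : ℝ) :
    graphFun Q (q - t • (Pi.single 0 1 : C4)) = graphFun Q q - t := by
  simp [graphFun]
  ring

theorem mem_infSym_of {ρ : C4 → ℝ} {V : C4 → C4} {hV : AnalyticAt ℂ V 0} :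
    HolGerm.of V hV ∈ infSym ρ ↔ ∀ᶠ p in 𝓝 (0 : C4), ρ p = 0 → fderiv ℝ ρ p (V p) = 0 := by
  constructor
  · rintro ⟨W, hW, h⟩
    have hW' : V =ᶠ[𝓝 0] W := Germ.coe_eq.1 hW
    filter_upwards [hW', h] with p h1 h2
    rwa [h1]
  · exact fun h => ⟨V, rfl, h⟩

/-- The derivative of a tangential vector field along another one. -/
theorem eventually_fderiv_tangent {Q : ℂ → ℂ → ℂ → ℝ} (hQ : ContDiffAt ℝ 2 (graphFun Q) 0)
    {V W : C4 → C4} (hW : AnalyticAt ℂ W 0)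
    (h1 : ∀ᶠ p in 𝓝 (0 : C4), graphFun Q p = 0 → fderiv ℝ (graphFun Q) p (V p) = 0)
    (h2 : ∀ᶠ p in 𝓝 (0 : C4), graphFun Q p = 0 → fderiv ℝ (graphFun Q) p (W p) = 0) :
    ∀ᶠ p in 𝓝 (0 : C4), graphFun Q p = 0 →
      fderiv ℝ (fderiv ℝ (graphFun Q)) p (V p) (W p) +
        fderiv ℝ (graphFun Q) p (fderiv ℂ W p (V p)) = 0 := by
  set ρ := graphFun Q with hρ
  filter_upwards [h1, h2.eventually_nhds, hW.eventually_analyticAt, hQ.eventually (by simp)]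
    with p e1 e2 e3 e4 hp
  have d1 : DifferentiableAt ℝ (fderiv ℝ ρ) p :=
    (e4.fderiv_right (m := 1) (by norm_num)).differentiableAt (by simp)
  have d2 : HasFDerivAt W ((fderiv ℂ W p).restrictScalars ℝ) p :=
    e3.differentiableAt.hasFDerivAt.restrictScalars ℝ
  have d3 := d1.hasFDerivAt.clm_apply d2
  have d4 : HasFDerivAt ρ (fderiv ℝ ρ p) p := (e4.differentiableAt (by simp)).hasFDerivAt
  -- The tangency condition for W, composed with the retraction, vanishes near p and can be
  -- differentiated freely. The differential of the retraction fixes V p, because V is tangent at p.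
  have d5 : HasFDerivAt (fun q => q - ρ q • (Pi.single 0 1 : C4))
      (ContinuousLinearMap.id ℝ C4 - (fderiv ℝ ρ p).smulRight (Pi.single 0 1 : C4)) p :=
    (hasFDerivAt_id p).sub (d4.smul_const _)
  have hR : p - ρ p • (Pi.single 0 1 : C4) = p := by simp [hp]
  have d6 := (hR.symm ▸ d3 : HasFDerivAt (fun q => fderiv ℝ ρ q (W q)) _
    (p - ρ p • (Pi.single 0 1 : C4))).comp p d5
  have d7 : HasFDerivAt (fun _ : C4 => (0 : ℝ)) (0 : C4 →L[ℝ] ℝ) p := hasFDerivAt_const _ _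
  have hc : Tendsto (fun q => q - ρ q • (Pi.single 0 1 : C4)) (𝓝 p) (𝓝 p) := by
    have := d5.continuousAt
    rw [ContinuousAt, hR] at this
    exact this
  have d8 := d6.unique (d7.congr_of_eventuallyEq ((hc.eventually e2).mono fun q hq => by
    refine hq ?_
    rw [hρ, graphFun_sub_smul, sub_self]))
  have d9 := DFunLike.congr_fun d8 (V p)
  simp only [ContinuousLinearMap.comp_apply, sub_apply,
    ContinuousLinearMap.id_apply, ContinuousLinearMap.smulRight_apply, e1 hp, zero_smul, sub_zero,
    add_apply, ContinuousLinearMap.flip_apply,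
    zero_apply, hR] at d9
  rw [add_comm] at d9
  exact d9

theorem lie_mem_infSym {Q : ℂ → ℂ → ℂ → ℝ} (hQ : ContDiffAt ℝ 2 (graphFun Q) 0) {X Y : HolGerm}
    (hX : X ∈ infSym (graphFun Q)) (hY : Y ∈ infSym (graphFun Q)) :
    ⁅X, Y⁆ ∈ infSym (graphFun Q) := by
  obtain ⟨V, hV, rfl⟩ := X.exists_rep
  obtain ⟨W, hW, rfl⟩ := Y.exists_rep
  rw [mem_infSym_of] at hX hY
  rw [HolGerm.of_lie_of, mem_infSym_of]
  filter_upwards [eventually_fderiv_tangent hQ hW hX hY, eventually_fderiv_tangent hQ hV hY hX,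
    hQ.eventually (by simp)] with p h1 h2 h3 hp
  -- The second derivative of the defining function is symmetric, so it drops out of the difference
  -- of the two identities; the bracket remains.
  have h4 := (h3.isSymmSndFDerivAt (by simp)).eq (V p) (W p)
  rw [VectorField.lieBracket, map_sub]
  linarith [h1 hp, h2 hp]

/-! ### The polarized parametrization and the tangency condition in parameters -/

namespace CRModel

variable (M : CRModel)

/-- The polarized parametrization of the model. -/
def lift (x : C4 × C4) : C4 :=
  M.pt ((x.1 0 - x.2 0) / 2) (x.1 1) (x.1 2) (x.2 1) (x.2 2) (x.1 3)

theorem analyticAt_fst (i : Fin 4) : AnalyticAt ℂ (fun x : C4 × C4 => x.1 i) 0 :=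
  ((ContinuousLinearMap.proj (R := ℂ) (φ := fun _ : Fin 4 => ℂ) i).comp
    (ContinuousLinearMap.fst ℂ C4 C4)).analyticAt _

theorem analyticAt_snd (i : Fin 4) : AnalyticAt ℂ (fun x : C4 × C4 => x.2 i) 0 :=
  ((ContinuousLinearMap.proj (R := ℂ) (φ := fun _ : Fin 4 => ℂ) i).comp
    (ContinuousLinearMap.snd ℂ C4 C4)).analyticAt _

theorem _root_.AnalyticAt.comp_fst_three {u : ℂ → ℂ} (hu : AnalyticAt ℂ u 0) :
    AnalyticAt ℂ (fun x : C4 × C4 => u (x.1 3)) 0 :=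
  AnalyticAt.comp (g := u) (f := fun x : C4 × C4 => x.1 3) hu (analyticAt_fst 3)

theorem analyticAt_lift : AnalyticAt ℂ M.lift 0 := by
  have h1 := analyticAt_fst
  have h2 := analyticAt_snd
  have hb : ∀ i j, AnalyticAt ℂ (fun x : C4 × C4 => M.b i j (x.1 3)) 0 := fun i j =>
    (M.an i j).comp_fst_three
  have hz1 : AnalyticAt ℂ (fun x : C4 × C4 => M.z₁ (x.1 1) (x.2 1) (x.2 2) (x.1 3)) 0 :=
    (h1 1).sub (((hb 0 0).mul (h2 1)).add ((hb 0 1).mul (h2 2)))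
  have hz2 : AnalyticAt ℂ (fun x : C4 × C4 => M.z₂ (x.1 2) (x.2 1) (x.2 2) (x.1 3)) 0 :=
    (h1 2).sub (((hb 1 0).mul (h2 1)).add ((hb 1 1).mul (h2 2)))
  rw [analyticAt_pi_iff]
  intro i
  fin_cases i
  · have h3 : AnalyticAt ℂ (fun x : C4 × C4 => (x.1 0 - x.2 0) / 2) 0 :=
      ((h1 0).sub (h2 0)).div analyticAt_const (by norm_num)
    exact h3.add ((((analyticAt_const.mul (h2 1)).mul hz1).add
      (analyticAt_const.mul (((h2 1).mul hz2).add ((h2 2).mul hz1)))).add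
      ((analyticAt_const.mul (h2 2)).mul hz2))
  · exact hz1
  · exact hz2
  · exact h1 3

theorem lift_zero : M.lift 0 = 0 := by
  funext i
  fin_cases i <;> simp [lift, pt, z₁, z₂, K]

theorem tendsto_lift : Tendsto M.lift (𝓝 0) (𝓝 0) := by
  have := M.analyticAt_lift.continuousAt
  rwa [ContinuousAt, lift_zero] at this

theorem tendsto_diag : Tendsto (fun q : C4 => (q, star q)) (𝓝 0) (𝓝 0) := by
  refine Continuous.tendsto' ?_ _ _ ?_
  · fun_prop
  · ext <;> simp

theorem lift_diag (q : C4) : M.lift (q, star q) =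
    M.pt (I * (q 0).im) (q 1) (q 2) (conj (q 1)) (conj (q 2)) (q 3) := by
  have h : (q 0 - conj (q 0)) / 2 = I * (q 0).im := by
    rw [Complex.sub_conj]
    push_cast
    ring
  simp only [lift, Pi.star_apply, Complex.star_def, h]

variable {M} {Q : ℂ → ℂ → ℂ → ℝ}

/-- The infinitesimal symmetries in terms of the parametrization. -/
theorem IsGraph.mem_infSym_iff (hQ : M.IsGraph Q) {V : C4 → C4} {hV : AnalyticAt ℂ V 0} :
    HolGerm.of V hV ∈ infSym (graphFun Q) ↔ ∀ᶠ q in 𝓝 (0 : C4),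
      (M.theta (conj (q 1)) (conj (q 2)) (q 3) (V (M.lift (q, star q)))).re = 0 := by
  have hl : Tendsto (fun q : C4 => M.lift (q, star q)) (𝓝 0) (𝓝 0) :=
    M.tendsto_lift.comp tendsto_diag
  rw [mem_infSym_of]
  constructor
  · intro h
    filter_upwards [hl.eventually h, hl.eventually hQ.fderiv_graphFun, tendsto_three.eventually hQ,
      tendsto_three.eventually M.eventually_D] with q h1 h2 h3 h4
    rw [lift_diag] at h1 h2 ⊢
    rw [h2, A₁_pt _ _ _ _ _ h4, A₂_pt _ _ _ _ _ h4] at h1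
    refine h1 ?_
    simp only [graphFun, pt, Matrix.cons_val]
    rw [h3]
    simp
  · intro h
    have hA : Tendsto (fun p : C4 => (![p 0, M.A₁ p, M.A₂ p, p 3] : C4)) (𝓝 0) (𝓝 0) := by
      rw [tendsto_pi_nhds]
      have c1 := M.contDiffAt_A₁.continuousAt
      have c2 := M.contDiffAt_A₂.continuousAt
      rw [ContinuousAt, A₁_zero] at c1
      rw [ContinuousAt, A₂_zero] at c2
      intro i
      fin_cases i
      · exact (continuous_apply (0 : Fin 4)).tendsto' _ _ rfl
      · exact c1
      · exact c2
      · exact tendsto_three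
    -- These are the parameters (w - K(ā, z), a, ζ) of the point p. On the hypersurface the first
    -- one is imaginary, so the parametrization returns p.
    have hA2 : Tendsto (fun p : C4 =>
        (![p 0 - M.K (conj (M.A₁ p)) (conj (M.A₂ p)) (p 1) (p 2), M.A₁ p, M.A₂ p, p 3] : C4))
        (𝓝 0) (𝓝 0) := by
      rw [tendsto_pi_nhds] at hA ⊢
      have c1 : Tendsto M.A₁ (𝓝 0) (𝓝 0) := hA 1
      have c2 : Tendsto M.A₂ (𝓝 0) (𝓝 0) := hA 2
      have c3 : Tendsto (fun p : C4 => conj (M.A₁ p)) (𝓝 0) (𝓝 0) := by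
        simpa [Function.comp_def] using (Complex.continuous_conj.tendsto 0).comp c1
      have c4 : Tendsto (fun p : C4 => conj (M.A₂ p)) (𝓝 0) (𝓝 0) := by
        simpa [Function.comp_def] using (Complex.continuous_conj.tendsto 0).comp c2
      have p1 : Tendsto (fun p : C4 => p 1) (𝓝 0) (𝓝 0) :=
        (continuous_apply (1 : Fin 4)).tendsto' _ _ rfl
      have p2 : Tendsto (fun p : C4 => p 2) (𝓝 0) (𝓝 0) :=
        (continuous_apply (2 : Fin 4)).tendsto' _ _ rfl
      intro i
      fin_cases i
      · have h0 : Tendsto (fun p : C4 => p 0) (𝓝 0) (𝓝 0) := hA 0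
        have h3 := h0.sub ((((c3.const_mul (M.k₁ : ℂ)).mul p1).add
          (((c3.mul p2).add (c4.mul p1)).const_mul (M.k₂ : ℂ))).add
          ((c4.const_mul (M.k₃ : ℂ)).mul p2))
        simpa [K] using h3
      · exact hA 1
      · exact hA 2
      · exact hA 3
    filter_upwards [hA2.eventually h, hQ.fderiv_graphFun, hQ.graphFun_eq,
      tendsto_three.eventually M.eventually_D] with p h1 h2 h3 h4 hp
    rw [h3] at hp
    have h5 : p 0 - M.K (conj (M.A₁ p)) (conj (M.A₂ p)) (p 1) (p 2) =
        I * (p 0 - M.K (conj (M.A₁ p)) (conj (M.A₂ p)) (p 1) (p 2)).im := by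
      apply Complex.ext
      · simpa using hp
      · simp
    rw [lift_diag] at h1
    simp only [Matrix.cons_val, pt, M.z₁_A p h4, M.z₂_A p h4, ← h5, sub_add_cancel] at h1
    have h6 : (![p 0, p 1, p 2, p 3] : C4) = p := by
      funext i
      fin_cases i <;> rfl
    rw [h6] at h1
    rw [h2, h1]

theorem IsGraph.lie_mem (hQ : M.IsGraph Q) {X Y : HolGerm}
    (hX : X ∈ infSym (graphFun Q)) (hY : Y ∈ infSym (graphFun Q)) :
    ⁅X, Y⁆ ∈ infSym (graphFun Q) := lie_mem_infSym hQ.contDiffAt hX hY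

end CRModel

end

/-! ### Differentiation of the contact form along the complex curves, and the reflection formula -/

section

/-- The real differential of Re g sends the direction conj g' to |g'|². -/
theorem HasDerivAt.eq_zero_of_re_eq_zero {g : ℂ → ℂ} {g' s : ℂ} (hg : HasDerivAt g g' s)
    (h : ∀ᶠ t in 𝓝 s, (g t).re = 0) : g' = 0 := by
  have h1 := Complex.reCLM.hasFDerivAt.comp s (hg.hasFDerivAt.restrictScalars ℝ)
  have h2 : HasFDerivAt (fun _ : ℂ => (0 : ℝ)) (0 : ℂ →L[ℝ] ℝ) s := hasFDerivAt_const _ _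
  have h3 := DFunLike.congr_fun (h1.unique (h2.congr_of_eventuallyEq h)) (conj g')
  simp [Complex.mul_re] at h3
  have h4 : Complex.normSq g' = 0 := by
    rw [Complex.normSq_apply]
    linarith
  exact Complex.normSq_eq_zero.1 h4

theorem coeff_eq_zero_of_eventually {c : Fin 5 → ℂ}
    (h : ∀ᶠ t in 𝓝 (0 : ℂ), ∑ i, c i * t ^ (i : ℕ) = 0) (i : Fin 5) : c i = 0 := by
  let P : Polynomial ℂ := ∑ i : Fin 5, Polynomial.C (c i) * Polynomial.X ^ (i : ℕ)
  have hP : P = 0 := by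
    refine Polynomial.eq_zero_of_infinite_isRoot P ((infinite_of_mem_nhds (0 : ℂ) h).mono ?_)
    intro t ht
    simpa [P, Polynomial.IsRoot, Polynomial.eval_finsetSum] using ht
  have h1 : P.coeff i = c i := by
    simp [P, Polynomial.coeff_X_pow, Fin.val_inj]
  rw [← h1, hP, Polynomial.coeff_zero]

namespace HolFun

/-- A function of `ζ` alone. -/
def ofζ (u : ℂ → ℂ) (hu : AnalyticAt ℂ u 0) : HolFun :=
  of (fun p => u (p 3)) (AnalyticAt.comp (g := u) (f := fun p : C4 => p 3) hu (analyticAt_coord 3 0))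

/-- A function of `w` alone. -/
def ofw (u : ℂ → ℂ) (hu : AnalyticAt ℂ u 0) : HolFun :=
  of (fun p => u (p 0)) (AnalyticAt.comp (g := u) (f := fun p : C4 => p 0) hu (analyticAt_coord 0 0))

theorem fderiv_comp_coord {u : ℂ → ℂ} {p : C4} (j : Fin 4) (hu : AnalyticAt ℂ u (p j))
    (i : Fin 4) : fderiv ℂ (fun p : C4 => u (p j)) p (Pi.single i 1) =
      if i = j then deriv u (p j) else 0 := by
  have h1 : HasFDerivAt (fun p : C4 => p j)
      (ContinuousLinearMap.proj (R := ℂ) (φ := fun _ : Fin 4 => ℂ) j) p :=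
    (ContinuousLinearMap.proj (R := ℂ) (φ := fun _ : Fin 4 => ℂ) j).hasFDerivAt
  have h2 := hu.differentiableAt.hasDerivAt.comp_hasFDerivAt p h1
  have h3 : fderiv ℂ (fun p : C4 => u (p j)) p = _ := h2.fderiv
  rw [h3]
  simp only [FunLike.coe_smul, Pi.smul_apply, ContinuousLinearMap.proj_apply, Pi.single_apply,
    smul_eq_mul, eq_comm (a := j)]
  split_ifs <;> simp

theorem tendsto_coord (j : Fin 4) : Tendsto (fun p : C4 => p j) (𝓝 0) (𝓝 0) :=
  (continuous_apply j).tendsto' _ _ rfl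

theorem d_ofζ {u : ℂ → ℂ} (hu : AnalyticAt ℂ u 0) (i : Fin 4) :
    d i (ofζ u hu) = if i = 3 then ofζ (deriv u) hu.deriv else 0 := by
  have h : d i (ofζ u hu) = of (fun p : C4 => if i = 3 then deriv u (p 3) else 0) (by
      split_ifs
      · exact (ofζ (deriv u) hu.deriv).exists_rep.elim fun _ _ =>
          AnalyticAt.comp (g := deriv u) (f := fun p : C4 => p 3) hu.deriv (analyticAt_coord 3 0)
      · exact analyticAt_const) := by
    rw [ofζ, d_of, of_eq_of]
    filter_upwards [(tendsto_coord 3).eventually hu.eventually_analyticAt] with p hp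
    exact fderiv_comp_coord 3 hp i
  rw [h]
  split_ifs with hi
  · rfl
  · rfl

theorem d_ofw {u : ℂ → ℂ} (hu : AnalyticAt ℂ u 0) (i : Fin 4) :
    d i (ofw u hu) = if i = 0 then ofw (deriv u) hu.deriv else 0 := by
  have h : d i (ofw u hu) = of (fun p : C4 => if i = 0 then deriv u (p 0) else 0) (by
      split_ifs
      · exact AnalyticAt.comp (g := deriv u) (f := fun p : C4 => p 0) hu.deriv (analyticAt_coord 0 0)
      · exact analyticAt_const) := by
    rw [ofw, d_of, of_eq_of]
    filter_upwards [(tendsto_coord 0).eventually hu.eventually_analyticAt] with p hp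
    exact fderiv_comp_coord 0 hp i
  rw [h]
  split_ifs with hi
  · rfl
  · rfl

/-- The function `w ↦ conj x(-w̄, 0, 0, 0)`. -/
theorem exists_reflection {F : C4 → ℂ} (hF : AnalyticAt ℂ F 0) :
    ∃ (u : ℂ → ℂ) (hu : AnalyticAt ℂ u 0), (u = fun w => conj (F ![-conj w, 0, 0, 0])) ∧
      ev (d 0 (ofw u hu)) = -conj (ev (d 0 (of F hF))) := by
  set φ : ℂ → ℂ := fun t => F ![-t, 0, 0, 0] with hφ
  have hl : HasDerivAt (fun t : ℂ => (![-t, 0, 0, 0] : C4)) (-Pi.single 0 1) 0 := by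
    rw [hasDerivAt_pi]
    intro i
    fin_cases i
    · exact (hasDerivAt_neg (0 : ℂ)).congr_deriv (by simp)
    · simpa using hasDerivAt_const (0 : ℂ) (0 : ℂ)
    · simpa using hasDerivAt_const (0 : ℂ) (0 : ℂ)
    · simpa using hasDerivAt_const (0 : ℂ) (0 : ℂ)
  have h0 : (![-(0 : ℂ), 0, 0, 0] : C4) = 0 := by
    funext i
    fin_cases i <;> simp
  have hla : AnalyticAt ℂ (fun t : ℂ => (![-t, 0, 0, 0] : C4)) 0 := by
    rw [analyticAt_pi_iff]
    intro i
    fin_cases i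
    · exact analyticAt_id.neg
    · exact analyticAt_const
    · exact analyticAt_const
    · exact analyticAt_const
  have hφa : AnalyticAt ℂ φ 0 :=
    AnalyticAt.comp (g := F) (f := fun t : ℂ => (![-t, 0, 0, 0] : C4)) (by rwa [h0]) hla
  have hφd : HasDerivAt φ (-ev (d 0 (of F hF))) 0 := by
    have h1 : HasFDerivAt F (fderiv ℂ F 0) (![-(0 : ℂ), 0, 0, 0] : C4) := by
      rw [h0]
      exact hF.differentiableAt.hasFDerivAt
    have h2 := h1.comp_hasDerivAt (0 : ℂ) hl
    rw [map_neg] at h2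
    exact h2
  -- Conjugating both argument and value keeps φ(t) = F(-t, 0, 0, 0) holomorphic. The sign inside φ
  -- produces the minus sign in the derivative.
  set u : ℂ → ℂ := conj ∘ φ ∘ conj with hu
  have hua : AnalyticAt ℂ u 0 := by
    obtain ⟨r, hr, hb⟩ := Metric.eventually_nhds_iff_ball.1 hφa.eventually_analyticAt
    have h1 : DifferentiableOn ℂ u (Metric.ball 0 r) := by
      intro z hz
      have hz' : conj z ∈ Metric.ball (0 : ℂ) r := by simpa using hz
      have h2 := ((hb _ hz').differentiableAt).conj_conj
      rw [Complex.conj_conj] at h2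
      exact h2.differentiableWithinAt
    exact h1.analyticAt (Metric.ball_mem_nhds _ hr)
  refine ⟨u, hua, rfl, ?_⟩
  rw [d_ofw, if_pos rfl]
  have h3 : HasDerivAt u (conj (-ev (d 0 (of F hF)))) 0 := by
    have := hφd.conj_conj
    rwa [map_zero] at this
  change deriv u 0 = _
  rw [h3.deriv, map_neg]

end HolFun

namespace CRModel

variable (M : CRModel)

/-- The derivative of `theta` along the leaf through `p` in direction `(ξ₁, ξ₂)`. -/
def leafDeriv (V : C4 → C4) (ξ₁ ξ₂ : ℂ) (p : C4) : ℂ :=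
  M.theta ξ₁ ξ₂ (p 3) (fun i => fderiv ℂ V p (Pi.single 3 1) i
    - (deriv (M.b 0 0) (p 3) * ξ₁ + deriv (M.b 0 1) (p 3) * ξ₂) * fderiv ℂ V p (Pi.single 1 1) i
    - (deriv (M.b 1 0) (p 3) * ξ₁ + deriv (M.b 1 1) (p 3) * ξ₂) * fderiv ℂ V p (Pi.single 2 1) i
    - M.tau ξ₁ ξ₂ (p 3) * fderiv ℂ V p (Pi.single 0 1) i)
  - M.K ξ₁ ξ₂ (deriv (deriv (M.b 0 0)) (p 3) * ξ₁ + deriv (deriv (M.b 0 1)) (p 3) * ξ₂)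
    (deriv (deriv (M.b 1 0)) (p 3) * ξ₁ + deriv (deriv (M.b 1 1)) (p 3) * ξ₂) * V p 3

/-- Along a curve b, a and ξ are constant, so θ depends on ζ only through τ = K(ξ, B'ξ), whose
derivative is K(ξ, B''ξ), and through the field. -/
theorem hasDerivAt_theta {V : C4 → C4} {b a₁ a₂ ξ₁ ξ₂ s : ℂ}
    (hV : DifferentiableAt ℂ V (M.pt b a₁ a₂ ξ₁ ξ₂ s)) (hb : ∀ i j, AnalyticAt ℂ (M.b i j) s) :
    HasDerivAt (fun s => M.theta ξ₁ ξ₂ s (V (M.pt b a₁ a₂ ξ₁ ξ₂ s)))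
      (M.leafDeriv V ξ₁ ξ₂ (M.pt b a₁ a₂ ξ₁ ξ₂ s)) s := by
  have hb1 : ∀ i j, HasDerivAt (M.b i j) (deriv (M.b i j) s) s := fun i j =>
    (hb i j).differentiableAt.hasDerivAt
  have hb2 : ∀ i j, HasDerivAt (deriv (M.b i j)) (deriv (deriv (M.b i j)) s) s := fun i j =>
    (hb i j).deriv.differentiableAt.hasDerivAt
  have hz1 : HasDerivAt (fun s => M.z₁ a₁ ξ₁ ξ₂ s)
      (-(deriv (M.b 0 0) s * ξ₁ + deriv (M.b 0 1) s * ξ₂)) s :=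
    (((hb1 0 0).mul_const ξ₁).add ((hb1 0 1).mul_const ξ₂)).const_sub a₁
  have hz2 : HasDerivAt (fun s => M.z₂ a₂ ξ₁ ξ₂ s)
      (-(deriv (M.b 1 0) s * ξ₁ + deriv (M.b 1 1) s * ξ₂)) s :=
    (((hb1 1 0).mul_const ξ₁).add ((hb1 1 1).mul_const ξ₂)).const_sub a₂
  have hK : ∀ {u v : ℂ → ℂ} {u' v' : ℂ}, HasDerivAt u u' s → HasDerivAt v v' s →
      HasDerivAt (fun s => M.K ξ₁ ξ₂ (u s) (v s)) (M.K ξ₁ ξ₂ u' v') s := by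
    intro u v u' v' hu hv
    exact ((hu.const_mul _).add (((hv.const_mul _).add (hu.const_mul _)).const_mul _)).add
      (hv.const_mul _)
  have htau : HasDerivAt (fun s => M.tau ξ₁ ξ₂ s) (M.K ξ₁ ξ₂
      (deriv (deriv (M.b 0 0)) s * ξ₁ + deriv (deriv (M.b 0 1)) s * ξ₂)
      (deriv (deriv (M.b 1 0)) s * ξ₁ + deriv (deriv (M.b 1 1)) s * ξ₂)) s :=
    hK (((hb2 0 0).mul_const ξ₁).add ((hb2 0 1).mul_const ξ₂))
      (((hb2 1 0).mul_const ξ₁).add ((hb2 1 1).mul_const ξ₂))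
  -- The tangent vector of the curve, ∂_ζ - (B'ξ)∂_z - τ∂_w.
  set Z : C4 := Pi.single 3 1
    - (deriv (M.b 0 0) s * ξ₁ + deriv (M.b 0 1) s * ξ₂) • Pi.single 1 1
    - (deriv (M.b 1 0) s * ξ₁ + deriv (M.b 1 1) s * ξ₂) • Pi.single 2 1
    - M.tau ξ₁ ξ₂ s • Pi.single 0 1 with hZ
  have hpt : HasDerivAt (fun s => M.pt b a₁ a₂ ξ₁ ξ₂ s) Z s := by
    rw [hasDerivAt_pi]
    intro i
    fin_cases i
    · refine ((hK hz1 hz2).const_add b).congr_deriv ?_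
      simp [hZ, tau, K]
      ring
    · exact hz1.congr_deriv (by simp [hZ])
    · exact hz2.congr_deriv (by simp [hZ])
    · exact (hasDerivAt_id s).congr_deriv (by simp [hZ])
  have hVp := hV.hasFDerivAt.comp_hasDerivAt s hpt
  have hVi := hasDerivAt_pi.1 hVp
  have h1 := ((hVi 0).sub ((hK (hVi 1) (hVi 2)).const_mul 2)).sub (htau.mul (hVi 3))
  refine h1.congr_deriv ?_
  have h3 : M.pt b a₁ a₂ ξ₁ ξ₂ s 3 = s := rfl
  simp only [leafDeriv, theta, h3, hZ, map_sub, map_smul, Pi.sub_apply, Pi.smul_apply, smul_eq_mul,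
    Function.comp_apply]
  ring

/-- For ξ = ā and imaginary b, varying ζ alone stays in the hypersurface. There θ(V) is holomorphic
in ζ with vanishing real part, hence it has zero derivative. -/
theorem eventually_leafDeriv_diag {V : C4 → C4} (hV : AnalyticAt ℂ V 0)
    (h : ∀ᶠ q in 𝓝 (0 : C4),
      (M.theta (conj (q 1)) (conj (q 2)) (q 3) (V (M.lift (q, star q)))).re = 0) :
    ∀ᶠ q in 𝓝 (0 : C4), M.leafDeriv V (conj (q 1)) (conj (q 2)) (M.lift (q, star q)) = 0 := by
  have hl : Tendsto (fun q : C4 => M.lift (q, star q)) (𝓝 0) (𝓝 0) :=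
    M.tendsto_lift.comp tendsto_diag
  have hb : ∀ᶠ s in 𝓝 (0 : ℂ), ∀ i j, AnalyticAt ℂ (M.b i j) s :=
    eventually_all.2 fun i => eventually_all.2 fun j => (M.an i j).eventually_analyticAt
  filter_upwards [h.eventually_nhds, tendsto_three.eventually hb,
    hl.eventually hV.eventually_analyticAt] with q h1 h2 h3
  rw [lift_diag] at h3 ⊢
  refine (M.hasDerivAt_theta h3.differentiableAt h2).eq_zero_of_re_eq_zero ?_
  have hu : Tendsto (fun s : ℂ => Function.update q 3 s) (𝓝 (q 3)) (𝓝 q) :=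
    ((continuous_const.update 3 continuous_id).tendsto' _ _ (by simp))
  filter_upwards [hu.eventually h1] with s hs
  rw [lift_diag] at hs
  simpa using hs

theorem analyticAt_K {E : Type*} [NormedAddCommGroup E] [NormedSpace ℂ E] {u₁ u₂ v₁ v₂ : E → ℂ}
    {x : E} (h1 : AnalyticAt ℂ u₁ x) (h2 : AnalyticAt ℂ u₂ x) (h3 : AnalyticAt ℂ v₁ x)
    (h4 : AnalyticAt ℂ v₂ x) : AnalyticAt ℂ (fun x => M.K (u₁ x) (u₂ x) (v₁ x) (v₂ x)) x :=
  (((analyticAt_const.mul h1).mul h3).add (analyticAt_const.mul ((h1.mul h4).add (h2.mul h3)))).add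
    ((analyticAt_const.mul h2).mul h4)

theorem analyticAt_b_mul {c : Fin 2 → Fin 2 → ℂ → ℂ} (hc : ∀ i j, AnalyticAt ℂ (c i j) 0)
    (i : Fin 2) :
    AnalyticAt ℂ (fun x : C4 × C4 => c i 0 (x.1 3) * x.2 1 + c i 1 (x.1 3) * x.2 2) 0 :=
  (((hc i 0).comp_fst_three).mul (analyticAt_snd 1)).add
    (((hc i 1).comp_fst_three).mul (analyticAt_snd 2))

theorem analyticAt_theta {v : C4 × C4 → C4} (hv : ∀ i, AnalyticAt ℂ (fun x => v x i) 0) :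
    AnalyticAt ℂ (fun x : C4 × C4 => M.theta (x.2 1) (x.2 2) (x.1 3) (v x)) 0 := by
  have hd : ∀ i j, AnalyticAt ℂ (deriv (M.b i j)) 0 := fun i j => (M.an i j).deriv
  exact ((hv 0).sub (analyticAt_const.mul
    (M.analyticAt_K (analyticAt_snd 1) (analyticAt_snd 2) (hv 1) (hv 2)))).sub
    ((M.analyticAt_K (analyticAt_snd 1) (analyticAt_snd 2) (analyticAt_b_mul hd 0)
      (analyticAt_b_mul hd 1)).mul (hv 3))

theorem analyticAt_comp_lift {F : C4 → ℂ} (hF : AnalyticAt ℂ F 0) :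
    AnalyticAt ℂ (fun x => F (M.lift x)) 0 :=
  AnalyticAt.comp (g := F) (f := M.lift) (by rwa [lift_zero]) M.analyticAt_lift

/-- The identity on ξ = ā polarizes to all (point, ξ) near 0. Since the base point may be held fixed
while ξ varies, the coefficients with respect to ξ can be compared. -/
theorem eventually_leafDeriv {V : C4 → C4} (hV : AnalyticAt ℂ V 0)
    (h : ∀ᶠ q in 𝓝 (0 : C4),
      (M.theta (conj (q 1)) (conj (q 2)) (q 3) (V (M.lift (q, star q)))).re = 0) :
    ∀ᶠ p in 𝓝 (0 : C4), ∀ᶠ ξ in 𝓝 (0 : ℂ × ℂ), M.leafDeriv V ξ.1 ξ.2 p = 0 := by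
  have hd : ∀ i j, AnalyticAt ℂ (deriv (M.b i j)) 0 := fun i j => (M.an i j).deriv
  have hdd : ∀ i j, AnalyticAt ℂ (deriv (deriv (M.b i j))) 0 := fun i j => (M.an i j).deriv.deriv
  have hp : ∀ i j, AnalyticAt ℂ (fun p => fderiv ℂ V p (Pi.single j 1) i) 0 := by
    intro i j
    have h1 : AnalyticAt ℂ (fun p => fderiv ℂ V p (Pi.single j 1)) 0 :=
      ((ContinuousLinearMap.apply ℂ C4 (Pi.single j 1 : C4)).analyticAt _).comp hV.fderiv
    exact analyticAt_pi_iff.1 h1 i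
  have hK : AnalyticAt ℂ
      (fun x : C4 × C4 => M.leafDeriv V (x.2 1) (x.2 2) (M.lift x)) 0 := by
    refine AnalyticAt.sub ?_ ?_
    · refine M.analyticAt_theta (v := fun x i => _) fun i => ?_
      refine (((M.analyticAt_comp_lift (hp i 3)).sub ?_).sub ?_).sub ?_
      · exact (analyticAt_b_mul hd 0).mul (M.analyticAt_comp_lift (hp i 1))
      · exact (analyticAt_b_mul hd 1).mul (M.analyticAt_comp_lift (hp i 2))
      · exact (M.analyticAt_K (analyticAt_snd 1) (analyticAt_snd 2) (analyticAt_b_mul hd 0)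
          (analyticAt_b_mul hd 1)).mul (M.analyticAt_comp_lift (hp i 0))
    · exact (M.analyticAt_K (analyticAt_snd 1) (analyticAt_snd 2) (analyticAt_b_mul hdd 0)
        (analyticAt_b_mul hdd 1)).mul (M.analyticAt_comp_lift (HolGerm.analyticAt_apply hV 3))
  have h1 := hK.eventually_eq_zero_of_conj (M.eventually_leafDeriv_diag hV h)
  -- A preimage of (p, ξ): parameters whose curve passes through p with the prescribed ξ, found from
  -- a = z + Bξ and b = w - K(ξ, z). The factor 2 compensates for the halving in `lift`, the second
  -- w-slot being 0.
  set G : C4 × (ℂ × ℂ) → C4 × C4 := fun y =>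
    (![2 * (y.1 0 - M.K y.2.1 y.2.2 (y.1 1) (y.1 2)),
      y.1 1 + (M.b 0 0 (y.1 3) * y.2.1 + M.b 0 1 (y.1 3) * y.2.2),
      y.1 2 + (M.b 1 0 (y.1 3) * y.2.1 + M.b 1 1 (y.1 3) * y.2.2), y.1 3],
      ![0, y.2.1, y.2.2, 0]) with hG
  have hG0 : ContinuousAt G 0 := by
    have hb : ∀ i j, ContinuousAt (fun y : C4 × (ℂ × ℂ) => M.b i j (y.1 3)) 0 := fun i j =>
      ContinuousAt.comp (g := M.b i j) (f := fun y : C4 × (ℂ × ℂ) => y.1 3)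
        (M.an i j).continuousAt (by fun_prop)
    have c1 : ContinuousAt (fun y : C4 × (ℂ × ℂ) => y.2.1) 0 := by fun_prop
    have c2 : ContinuousAt (fun y : C4 × (ℂ × ℂ) => y.2.2) 0 := by fun_prop
    have c3 : ∀ i, ContinuousAt (fun y : C4 × (ℂ × ℂ) => y.1 i) 0 := fun i => by fun_prop
    refine ContinuousAt.prodMk (continuousAt_pi.2 fun i => ?_) (continuousAt_pi.2 fun i => ?_)
    · fin_cases i
      · have : ContinuousAt (fun y : C4 × (ℂ × ℂ) => M.K y.2.1 y.2.2 (y.1 1) (y.1 2)) 0 := by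
          unfold K
          fun_prop
        exact continuousAt_const.mul ((c3 0).sub this)
      · exact (c3 1).add (((hb 0 0).mul c1).add ((hb 0 1).mul c2))
      · exact (c3 2).add (((hb 1 0).mul c1).add ((hb 1 1).mul c2))
      · exact c3 3
    · fin_cases i
      · exact continuousAt_const
      · exact c1
      · exact c2
      · exact continuousAt_const
  have hG00 : G 0 = 0 := by
    ext i
    · fin_cases i <;> simp [hG, K]
    · fin_cases i <;> simp [hG]
  rw [ContinuousAt, hG00] at hG0
  have h2 := hG0.eventually h1
  rw [← Prod.mk_zero_zero, nhds_prod_eq] at h2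
  refine h2.curry.mono fun p hp => hp.mono fun ξ hξ => ?_
  have h3 : M.lift (G (p, ξ)) = p := by
    funext i
    fin_cases i <;> simp [hG, lift, pt, z₁, z₂]
  rw [h3] at hξ
  simpa [hG] using hξ

/-- The reflection formula for the first coefficient of an infinitesimal symmetry. -/
theorem eventually_apply_zero {V : C4 → C4} (hV : AnalyticAt ℂ V 0)
    (h : ∀ᶠ q in 𝓝 (0 : C4),
      (M.theta (conj (q 1)) (conj (q 2)) (q 3) (V (M.lift (q, star q)))).re = 0) :
    ∀ᶠ p in 𝓝 (0 : C4), V p 0 =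
      -conj (M.theta (conj (p 1)) (conj (p 2)) 0 (V ![-conj (p 0), 0, 0, 0])) := by
  have h1 : AnalyticAt ℂ
      (fun x : C4 × C4 => M.theta (x.2 1) (x.2 2) (x.1 3) (V (M.lift x))) 0 :=
    M.analyticAt_theta fun i => M.analyticAt_comp_lift (HolGerm.analyticAt_apply hV i)
  have h2 := h1.eq_neg_conj_swap h
  -- With second argument 0 one has ξ = 0, so θ(V) reduces to the ∂_w-coefficient at p. The mirror
  -- parameters have a = 0 and ζ = 0, where B vanishes; hence the mirror point is (-w̄, 0, 0, 0).
  have ht : Tendsto (fun p : C4 => ((![2 * p 0, p 1, p 2, p 3], 0) : C4 × C4)) (𝓝 0) (𝓝 0) := by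
    refine Continuous.tendsto' ?_ _ _ ?_
    · refine Continuous.prodMk (continuous_pi fun i => ?_) continuous_const
      fin_cases i
      · exact continuous_const.mul (continuous_apply (0 : Fin 4))
      · exact continuous_apply (1 : Fin 4)
      · exact continuous_apply (2 : Fin 4)
      · exact continuous_apply (3 : Fin 4)
    · ext i
      · fin_cases i <;> simp
      · rfl
  filter_upwards [ht.eventually h2] with p hp
  have e1 : M.lift ((![2 * p 0, p 1, p 2, p 3], 0) : C4 × C4) = p := by
    funext i
    fin_cases i <;> simp [lift, pt, z₁, z₂, K]
  have e2 : M.lift ((star (0 : C4), star (![2 * p 0, p 1, p 2, p 3] : C4))) =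
      ![-conj (p 0), 0, 0, 0] := by
    funext i
    fin_cases i
    · simp [lift, pt, z₁, z₂, K, M.zero]
      ring
    · simp [lift, pt, z₁, M.zero]
    · simp [lift, pt, z₂, M.zero]
    · simp [lift, pt]
  simp only [e1, e2] at hp
  simpa [theta, tau, K] using hp

end CRModel

end

/-! ### Determining equations and reality conditions -/

section

theorem HolGerm.d_comp_of {V : C4 → C4} (hV : AnalyticAt ℂ V 0) (i j : Fin 4) :
    ∃ h, HolFun.d j (comp i (of V hV)) =
      HolFun.of (fun p => fderiv ℂ V p (Pi.single j 1) i) h := by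
  have h1 : AnalyticAt ℂ (fun p => fderiv ℂ V p (Pi.single j 1)) 0 :=
    ((ContinuousLinearMap.apply ℂ C4 (Pi.single j 1 : C4)).analyticAt _).comp hV.fderiv
  refine ⟨analyticAt_pi_iff.1 h1 i, ?_⟩
  rw [comp_of, HolFun.d_of, HolFun.of_eq_of]
  filter_upwards [hV.eventually_analyticAt] with p hp
  rw [fderiv_apply hp.differentiableAt]
  rfl

theorem HolFun.two_eq : (2 : HolFun) = of (fun _ => 2) analyticAt_const := (map_ofNat C 2).symm

@[simp] theorem HolFun.d_two (i : Fin 4) : d i (2 : HolFun) = 0 := by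
  rw [← map_ofNat C 2, d_C]

theorem HolFun.zero_eq : (0 : HolFun) = of (fun _ => 0) analyticAt_const := (map_zero C).symm

namespace CRModel

variable (M : CRModel)

/-- The entries of `B` as germs. -/
def bf (i j : Fin 2) : HolFun := HolFun.ofζ (M.b i j) (M.an i j)

/-- The entries of `B'(ζ) ξ` as germs. -/
def bx (i : Fin 2) (x y : ℂ) : HolFun :=
  HolFun.d 3 (M.bf i 0) * HolFun.C x + HolFun.d 3 (M.bf i 1) * HolFun.C y

/-- The form `K(ξ, ·)` with constant `ξ` as germs. -/
def kx (x y : ℂ) (u v : HolFun) : HolFun :=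
  HolFun.C (M.k₁ * x + M.k₂ * y) * u + HolFun.C (M.k₂ * x + M.k₃ * y) * v

/-- The form `K(ξ, B'(ζ) ξ)` with constant `ξ` as germs. -/
def taux (x y : ℂ) : HolFun := M.kx x y (M.bx 0 x y) (M.bx 1 x y)

variable {M} {Q : ℂ → ℂ → ℂ → ℝ}

open HolFun HolGerm

/-- On the ray ξ = t(x, y) the expressions K(ξ, ·) and B'ξ have degree 1 in t, while τ and K(ξ,
B''ξ) have degree 2. The five coefficients in t become the five determining equations. -/
theorem leafDeriv_expand (V : C4 → C4) (x y : ℂ) (p : C4) (t : ℂ)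
    (β₁ β₂ γ₁ γ₂ τ σ : ℂ) (hβ₁ : β₁ = deriv (M.b 0 0) (p 3) * x + deriv (M.b 0 1) (p 3) * y)
    (hβ₂ : β₂ = deriv (M.b 1 0) (p 3) * x + deriv (M.b 1 1) (p 3) * y)
    (hγ₁ : γ₁ = M.k₁ * x + M.k₂ * y) (hγ₂ : γ₂ = M.k₂ * x + M.k₃ * y)
    (hτ : τ = γ₁ * β₁ + γ₂ * β₂)
    (hσ : σ = γ₁ * (deriv (deriv (M.b 0 0)) (p 3) * x + deriv (deriv (M.b 0 1)) (p 3) * y) +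
      γ₂ * (deriv (deriv (M.b 1 0)) (p 3) * x + deriv (deriv (M.b 1 1)) (p 3) * y))
    (D : Fin 4 → Fin 4 → ℂ) (hD : ∀ i j, D j i = fderiv ℂ V p (Pi.single j 1) i) :
    M.leafDeriv V (t * x) (t * y) p = ∑ i : Fin 5, ![D 3 0,
      -(β₁ * D 1 0 + β₂ * D 2 0) - 2 * (γ₁ * D 3 1 + γ₂ * D 3 2),
      2 * (β₁ * (γ₁ * D 1 1 + γ₂ * D 1 2) + β₂ * (γ₁ * D 2 1 + γ₂ * D 2 2)) - τ * D 0 0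
        - τ * D 3 3 - σ * V p 3,
      τ * (2 * (γ₁ * D 0 1 + γ₂ * D 0 2) + (β₁ * D 1 3 + β₂ * D 2 3)),
      τ ^ 2 * D 0 3] i * t ^ (i : ℕ) := by
  have h1 : deriv (M.b 0 0) (p 3) * (t * x) + deriv (M.b 0 1) (p 3) * (t * y) = t * β₁ := by
    rw [hβ₁]; ring
  have h2 : deriv (M.b 1 0) (p 3) * (t * x) + deriv (M.b 1 1) (p 3) * (t * y) = t * β₂ := by
    rw [hβ₂]; ring
  have h3 : M.tau (t * x) (t * y) (p 3) = t ^ 2 * τ := by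
    rw [tau, h1, h2, hτ, hγ₁, hγ₂, K]; ring
  have h4 : M.K (t * x) (t * y)
      (deriv (deriv (M.b 0 0)) (p 3) * (t * x) + deriv (deriv (M.b 0 1)) (p 3) * (t * y))
      (deriv (deriv (M.b 1 0)) (p 3) * (t * x) + deriv (deriv (M.b 1 1)) (p 3) * (t * y)) =
      t ^ 2 * σ := by
    rw [hσ, hγ₁, hγ₂, K]; ring
  have h5 : ∀ u v, M.K (t * x) (t * y) u v = t * (γ₁ * u + γ₂ * v) := by
    intro u v
    rw [K, hγ₁, hγ₂]; ring
  rw [leafDeriv, h4]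
  simp only [theta, h1, h2, h3, h5, ← hD, Fin.sum_univ_five, Matrix.cons_val,
    Fin.coe_ofNat_eq_mod]
  norm_num
  ring

/-- The determining equations of the infinitesimal symmetries. -/
theorem IsGraph.determining (hQ : M.IsGraph Q) {Y : HolGerm} (hY : Y ∈ infSym (graphFun Q))
    (x y : ℂ) :
    d 3 (comp 0 Y) = 0 ∧
    M.bx 0 x y * d 1 (comp 0 Y) + M.bx 1 x y * d 2 (comp 0 Y)
      + 2 * M.kx x y (d 3 (comp 1 Y)) (d 3 (comp 2 Y)) = 0 ∧
    2 * (M.bx 0 x y * M.kx x y (d 1 (comp 1 Y)) (d 1 (comp 2 Y))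
      + M.bx 1 x y * M.kx x y (d 2 (comp 1 Y)) (d 2 (comp 2 Y)))
      - M.taux x y * (d 0 (comp 0 Y) + d 3 (comp 3 Y)) - d 3 (M.taux x y) * comp 3 Y = 0 ∧
    M.taux x y * (2 * M.kx x y (d 0 (comp 1 Y)) (d 0 (comp 2 Y))
      + (M.bx 0 x y * d 1 (comp 3 Y) + M.bx 1 x y * d 2 (comp 3 Y))) = 0 ∧
    M.taux x y ^ 2 * d 0 (comp 3 Y) = 0 := by
  obtain ⟨V, hV, rfl⟩ := Y.exists_rep
  have h1 := M.eventually_leafDeriv hV (hQ.mem_infSym_iff.1 hY)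
  have ht : Tendsto (fun t : ℂ => (t * x, t * y)) (𝓝 0) (𝓝 (0 : ℂ × ℂ)) :=
    (by fun_prop : Continuous fun t : ℂ => (t * x, t * y)).tendsto' _ _ (by simp)
  have h2 : ∀ᶠ p in 𝓝 (0 : C4), ∀ i, _ := h1.mono fun p hp =>
    coeff_eq_zero_of_eventually ((ht.eventually hp).mono fun t ht => by
      rw [leafDeriv_expand V x y p t _ _ _ _ _ _ rfl rfl rfl rfl rfl rfl
        (fun j i => fderiv ℂ V p (Pi.single j 1) i) (fun _ _ => rfl)] at ht
      exact ht)
  have hσ : d 3 (M.taux x y) = M.kx x y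
      (ofζ (deriv (deriv (M.b 0 0))) (M.an 0 0).deriv.deriv * C x
        + ofζ (deriv (deriv (M.b 0 1))) (M.an 0 1).deriv.deriv * C y)
      (ofζ (deriv (deriv (M.b 1 0))) (M.an 1 0).deriv.deriv * C x
        + ofζ (deriv (deriv (M.b 1 1))) (M.an 1 1).deriv.deriv * C y) := by
    simp only [taux, kx, bx, bf, d_add, d_mul, d_C, d_ofζ, if_true]
    ring
  rw [hσ]
  simp only [taux, kx, bx, bf, d_ofζ, if_true]
  choose hD eD using fun i j => d_comp_of hV i j
  simp only [eD]
  simp only [comp_of, C_def, ofζ, two_eq, of_add, of_mul, of_sub, pow_two, zero_eq]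
  refine ⟨?_, ?_, ?_, ?_, ?_⟩
  · rw [HolFun.of_eq_of]
    filter_upwards [h2] with p hp
    simpa using hp 0
  · rw [HolFun.of_eq_of]
    filter_upwards [h2] with p hp
    have := hp 1
    simp only [Pi.add_apply, Pi.mul_apply, Matrix.cons_val] at this ⊢
    linear_combination -this
  · rw [HolFun.of_eq_of]
    filter_upwards [h2] with p hp
    have := hp 2
    simp only [Pi.add_apply, Pi.mul_apply, Pi.sub_apply, Matrix.cons_val] at this ⊢
    linear_combination this
  · rw [HolFun.of_eq_of]
    filter_upwards [h2] with p hp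
    have := hp 3
    simp only [Pi.add_apply, Pi.mul_apply, Matrix.cons_val] at this ⊢
    linear_combination this
  · rw [HolFun.of_eq_of]
    filter_upwards [h2] with p hp
    have := hp 4
    simp only [Pi.add_apply, Pi.mul_apply, Matrix.cons_val] at this ⊢
    linear_combination this

/-- The reality condition on the coefficient of `∂/∂w` of an infinitesimal symmetry. -/
theorem IsGraph.comp_zero_eq (hQ : M.IsGraph Q) {Y : HolGerm} (hY : Y ∈ infSym (graphFun Q)) :
    ∃ u : Fin 4 → HolFun, (∀ i j, i ≠ 0 → d i (u j) = 0) ∧ (∀ j, ev (u j) = conj (ev (comp j Y))) ∧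
      (∀ j, ev (d 0 (u j)) = -conj (ev (d 0 (comp j Y)))) ∧
      comp 0 Y = -u 0 + X 1 * (C 2 * (C M.k₁ * u 1 + C M.k₂ * u 2))
        + X 2 * (C 2 * (C M.k₂ * u 1 + C M.k₃ * u 2))
        + (X 1 * X 1 * C (conj (M.k₁ * deriv (M.b 0 0) 0 + M.k₂ * deriv (M.b 1 0) 0))
          + X 1 * X 2 * C (conj (M.k₁ * deriv (M.b 0 1) 0 + M.k₂ * deriv (M.b 1 1) 0
            + M.k₂ * deriv (M.b 0 0) 0 + M.k₃ * deriv (M.b 1 0) 0))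
          + X 2 * X 2 * C (conj (M.k₂ * deriv (M.b 0 1) 0 + M.k₃ * deriv (M.b 1 1) 0))) * u 3 := by
  obtain ⟨V, hV, rfl⟩ := Y.exists_rep
  have h1 := M.eventually_apply_zero hV (hQ.mem_infSym_iff.1 hY)
  choose u hu e1 e2 using fun i => exists_reflection (analyticAt_apply hV i)
  have h0 : (![-conj (0 : ℂ), 0, 0, 0] : C4) = 0 := by
    funext i
    fin_cases i <;> simp
  refine ⟨fun j => ofw (u j) (hu j), fun i j hi => by rw [d_ofw, if_neg hi], fun j => ?_, e2, ?_⟩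
  · change u j 0 = conj (V 0 j)
    rw [e1]
    simp only [h0]
  · simp only [comp_of, C_def, ofw, HolFun.X, of_add, of_mul, of_neg]
    rw [HolFun.of_eq_of]
    filter_upwards [h1] with p hp
    rw [hp]
    simp only [e1, Pi.add_apply, Pi.mul_apply, Pi.neg_apply, theta, tau, K, map_sub, map_mul, map_add,
      Complex.conj_conj, Complex.conj_ofReal, Complex.conj_ofNat]
    ring

theorem d_X_ite (i j k : Fin 4) : d i (if j = k then (1 : HolFun) else 0) = 0 := by
  split_ifs <;> simp

/-- The coefficient of `∂/∂w` of an infinitesimal symmetry is a quadratic polynomial in `z`. -/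
theorem IsGraph.cubic (hQ : M.IsGraph Q) {Y : HolGerm} (hY : Y ∈ infSym (graphFun Q))
    (i j k : Fin 4) (hi : i ≠ 0) (hj : j ≠ 0) (hk : k ≠ 0) : d i (d j (d k (comp 0 Y))) = 0 := by
  obtain ⟨u, hu, -, -, key⟩ := hQ.comp_zero_eq hY
  rw [key]
  simp only [d_add, d_mul, d_neg, d_C, d_X, hu, d_X_ite, hi, hj, hk, ne_eq, not_false_eq_true,
    mul_zero, zero_mul, add_zero, zero_add, neg_zero]

variable (M) in
/-- First order consequences of the reality condition. -/
structure Reality (Y : HolGerm) : Prop where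
  f : ev (comp 0 Y) = -conj (ev (comp 0 Y))
  fw : ev (d 0 (comp 0 Y)) = conj (ev (d 0 (comp 0 Y)))
  f1 : ev (d 1 (comp 0 Y)) = 2 * conj (M.k₁ * ev (comp 1 Y) + M.k₂ * ev (comp 2 Y))
  f2 : ev (d 2 (comp 0 Y)) = 2 * conj (M.k₂ * ev (comp 1 Y) + M.k₃ * ev (comp 2 Y))
  fw1 : ev (d 0 (d 1 (comp 0 Y))) =
    -2 * conj (M.k₁ * ev (d 0 (comp 1 Y)) + M.k₂ * ev (d 0 (comp 2 Y)))
  fw2 : ev (d 0 (d 2 (comp 0 Y))) =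
    -2 * conj (M.k₂ * ev (d 0 (comp 1 Y)) + M.k₃ * ev (d 0 (comp 2 Y)))
  f11 : ev (d 1 (d 1 (comp 0 Y))) = 2 * conj ((M.k₁ * deriv (M.b 0 0) 0
    + M.k₂ * deriv (M.b 1 0) 0) * ev (comp 3 Y))
  f12 : ev (d 1 (d 2 (comp 0 Y))) = conj ((M.k₁ * deriv (M.b 0 1) 0 + M.k₂ * deriv (M.b 1 1) 0
    + M.k₂ * deriv (M.b 0 0) 0 + M.k₃ * deriv (M.b 1 0) 0) * ev (comp 3 Y))
  f22 : ev (d 2 (d 2 (comp 0 Y))) = 2 * conj ((M.k₂ * deriv (M.b 0 1) 0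
    + M.k₃ * deriv (M.b 1 1) 0) * ev (comp 3 Y))

/-- All identities come from differentiating the reflection formula at the origin. Every derivative
in w brings a minus sign from w ↦ -w̄. -/
theorem IsGraph.reality (hQ : M.IsGraph Q) {Y : HolGerm} (hY : Y ∈ infSym (graphFun Q)) :
    M.Reality Y := by
  obtain ⟨u, hu, hv, hw, key⟩ := hQ.comp_zero_eq hY
  constructor
  · conv_lhs => rw [key]
    simp [hv]
  · conv_lhs => rw [key]
    simp [d_add, d_mul, d_neg, d_X, hw]
  · rw [key]
    simp [d_add, d_mul, d_neg, d_X, hv, hu]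
  · rw [key]
    simp [d_add, d_mul, d_neg, d_X, hv, hu]
  · rw [key]
    simp [d_add, d_mul, d_neg, d_X, hw, hu]
    ring
  · rw [key]
    simp [d_add, d_mul, d_neg, d_X, hw, hu]
    ring
  · rw [key]
    simp [d_add, d_mul, d_neg, d_X, hv, hu]
    ring
  · rw [key]
    simp [d_add, d_mul, d_neg, d_X, hv, hu]
  · rw [key]
    simp [d_add, d_mul, d_neg, d_X, hv, hu]
    ring

end CRModel

end

/-! ### The symmetries of degree -1 and the linear reality condition -/

section

namespace CRModel

variable {M : CRModel} {Q : ℂ → ℂ → ℂ → ℝ}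

open HolFun HolGerm

theorem IsGraph.mem_infSym (hQ : M.IsGraph Q) {V : C4 → C4} (hV : AnalyticAt ℂ V 0)
    (h : ∀ᶠ s in 𝓝 (0 : ℂ), ∀ (β : ℝ) (a₁ a₂ : ℂ), (M.theta (conj a₁) (conj a₂) s
      (V (M.pt (I * β) a₁ a₂ (conj a₁) (conj a₂) s))).re = 0) :
    HolGerm.of V hV ∈ infSym (graphFun Q) := by
  rw [hQ.mem_infSym_iff]
  filter_upwards [tendsto_three.eventually h] with q hq
  rw [lift_diag]
  exact hq _ _ _

variable (M)

/-- The symmetry of weight `-1` with value `(0, a₁, a₂, 0)` at the origin. -/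
def translation (a₁ a₂ : ℂ) : C4 → C4 := fun p =>
  ![2 * M.K (conj a₁) (conj a₂) (p 1) (p 2), M.z₁ a₁ (conj a₁) (conj a₂) (p 3),
    M.z₂ a₂ (conj a₁) (conj a₂) (p 3), 0]

theorem analyticAt_translation (a₁ a₂ : ℂ) : AnalyticAt ℂ (M.translation a₁ a₂) 0 := by
  have h1 : ∀ i j, AnalyticAt ℂ (fun p : C4 => M.b i j (p 3)) 0 := fun i j =>
    AnalyticAt.comp (g := M.b i j) (f := fun p : C4 => p 3) (M.an i j) (analyticAt_coord 3 0)
  rw [analyticAt_pi_iff]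
  intro i
  fin_cases i
  · exact analyticAt_const.mul (M.analyticAt_K analyticAt_const analyticAt_const
      (analyticAt_coord 1 0) (analyticAt_coord 2 0))
  · exact analyticAt_const.sub (((h1 0 0).mul analyticAt_const).add ((h1 0 1).mul analyticAt_const))
  · exact analyticAt_const.sub (((h1 1 0).mul analyticAt_const).add ((h1 1 1).mul analyticAt_const))
  · exact analyticAt_const

variable {M}

/-- The field shifts the parameter a by a constant. The symmetry of KB removes B from θ, leaving
2K(ā₁, a) minus its conjugate, with a₁ standing for the shift. -/
theorem IsGraph.translation_mem (hQ : M.IsGraph Q) (a₁ a₂ : ℂ) :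
    of (M.translation a₁ a₂) (M.analyticAt_translation a₁ a₂) ∈ infSym (graphFun Q) := by
  refine hQ.mem_infSym _ (Eventually.of_forall fun s β x y => ?_)
  have h : M.theta (conj x) (conj y) s (M.translation a₁ a₂
      (M.pt (I * β) x y (conj x) (conj y) s)) = 2 * M.K (conj a₁) (conj a₂) x y -
        conj (2 * M.K (conj a₁) (conj a₂) x y) := by
    simp only [theta, translation, pt, Matrix.cons_val, K, z₁, z₂, map_mul, map_add,
      Complex.conj_conj, Complex.conj_ofReal, Complex.conj_ofNat]
    linear_combination (2 * conj a₂ * conj x - 2 * conj a₁ * conj y) * M.symm s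
  rw [h]
  simp

variable (M) in
theorem comp_translation (a₁ a₂ : ℂ) :
    comp 0 (of _ (M.analyticAt_translation a₁ a₂)) =
      C (2 * (M.k₁ * conj a₁ + M.k₂ * conj a₂)) * X 1
        + C (2 * (M.k₂ * conj a₁ + M.k₃ * conj a₂)) * X 2 ∧
    comp 1 (of _ (M.analyticAt_translation a₁ a₂)) =
      C a₁ - (M.bf 0 0 * C (conj a₁) + M.bf 0 1 * C (conj a₂)) ∧
    comp 2 (of _ (M.analyticAt_translation a₁ a₂)) =
      C a₂ - (M.bf 1 0 * C (conj a₁) + M.bf 1 1 * C (conj a₂)) ∧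
    comp 3 (of _ (M.analyticAt_translation a₁ a₂)) = 0 := by
  simp only [comp_of, C_def, bf, ofζ, HolFun.X, of_add, of_mul, of_sub, zero_eq]
  refine ⟨?_, rfl, rfl, rfl⟩
  rw [HolFun.of_eq_of]
  refine Eventually.of_forall fun p => ?_
  simp [translation, K]
  ring

theorem d_bf (i j : Fin 2) (k : Fin 4) : d k (M.bf i j) =
    if k = 3 then ofζ (deriv (M.b i j)) (M.an i j).deriv else 0 := by
  rw [bf, d_ofζ]

@[simp] theorem ev_bf (i j : Fin 2) : ev (M.bf i j) = 0 := M.zero i j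

theorem ev_ofζ {u : ℂ → ℂ} (hu : AnalyticAt ℂ u 0) : ev (ofζ u hu) = u 0 := rfl

theorem deriv_symm (M : CRModel) : M.k₁ * deriv (M.b 0 1) 0 + M.k₂ * deriv (M.b 1 1) 0 =
    M.k₂ * deriv (M.b 0 0) 0 + M.k₃ * deriv (M.b 1 0) 0 := by
  have h := fun i j => (M.an i j).differentiableAt.hasDerivAt
  have h1 := ((h 0 1).const_mul (M.k₁ : ℂ)).add ((h 1 1).const_mul (M.k₂ : ℂ))
  have h2 := ((h 0 0).const_mul (M.k₂ : ℂ)).add ((h 1 0).const_mul (M.k₃ : ℂ))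
  refine h1.unique (h2.congr_of_eventuallyEq (Eventually.of_forall fun s => ?_))
  exact M.symm s

/-- The reality condition on the linear part of an infinitesimal symmetry. -/
theorem IsGraph.reality_linear (hQ : M.IsGraph Q) {Y : HolGerm} (hY : Y ∈ infSym (graphFun Q)) :
    M.k₁ * ev (d 1 (comp 1 Y)) + M.k₂ * ev (d 1 (comp 2 Y))
      + conj (M.k₁ * ev (d 1 (comp 1 Y)) + M.k₂ * ev (d 1 (comp 2 Y))) =
      M.k₁ * ev (d 0 (comp 0 Y)) ∧
    M.k₁ * ev (d 2 (comp 1 Y)) + M.k₂ * ev (d 2 (comp 2 Y))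
      + conj (M.k₂ * ev (d 1 (comp 1 Y)) + M.k₃ * ev (d 1 (comp 2 Y))) =
      M.k₂ * ev (d 0 (comp 0 Y)) := by
  -- The reality conditions concern values at 0. Applied to the bracket with a translation they
  -- yield conditions on the linear part of the field itself; the quadratic part of f that appears
  -- is eliminated by `f11` and `f12`.
  have h1 := (hQ.reality (hQ.lie_mem hY (hQ.translation_mem 1 0))).f1
  have h2 := (hQ.reality (hQ.lie_mem hY (hQ.translation_mem 1 0))).f2
  have e := hQ.reality hY
  obtain ⟨t0, t1, t2, t3⟩ := M.comp_translation 1 0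
  have e11 := e.f11
  have e12 := e.f12
  have hs := congrArg conj M.deriv_symm
  simp only [comp_lie, Fin.sum_univ_four, t0, t1, t2, t3, map_add, map_sub, map_mul, d_add, d_sub,
    d_mul, d_X, d_C, d_bf, ev_C, ev_X, ev_bf] at h1 h2
  simp [ev_ofζ] at h1 h2 e11 e12 hs ⊢
  rw [d_comm 2 1] at h2
  constructor
  · linear_combination h1 / 2 + e11 / 2
  · linear_combination h2 / 2 + e12 / 2 + conj (ev (comp 3 Y)) * hs / 2

/-- Two germs with equal values at the origin and equal derivatives are equal. -/
theorem _root_.HolFun.eq_zero_of_d {x : HolFun} (h : ∀ i, d i x = 0) (h0 : ev x = 0) : x = 0 := by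
  rw [eq_C_of_d_eq_zero h, h0, map_zero]

end CRModel

end

/-! ### Type III: a symmetry is determined by its jet -/

section

namespace HolFun

theorem two_mul_eq_zero {x : HolFun} (h : 2 * x = 0) : x = 0 := eq_zero_of_ofNat_mul h

theorem eq_zero_of_partials {x : HolFun} (h0 : d 0 x = 0) (h1 : d 1 x = 0) (h2 : d 2 x = 0)
    (h3 : d 3 x = 0) (h : ev x = 0) : x = 0 :=
  eq_zero_of_d (fun i => by fin_cases i <;> assumption) h

end HolFun

open HolFun HolGerm

theorem analyticAt_b_entry {u : Fin 2 → Fin 2 → ℂ → ℂ} (h00 : AnalyticAt ℂ (u 0 0) 0)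
    (h01 : AnalyticAt ℂ (u 0 1) 0) (h10 : AnalyticAt ℂ (u 1 0) 0) (h11 : AnalyticAt ℂ (u 1 1) 0)
    (i j : Fin 2) : AnalyticAt ℂ (u i j) 0 := by
  fin_cases i <;> fin_cases j <;> assumption

/-- The data of the type III model. -/
def modelIII : CRModel where
  k₁ := 1
  k₂ := 0
  k₃ := -1
  b := ![![fun s => 2 * s, fun s => -(√3 * s ^ 2)], ![fun s => √3 * s ^ 2, fun s => -(2 * s ^ 3)]]
  an := by
    refine analyticAt_b_entry ?_ ?_ ?_ ?_ <;> simp only [Matrix.cons_val] <;> fun_prop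
  zero i j := by fin_cases i <;> fin_cases j <;> simp
  symm s := by simp

theorem modelIII_bf : modelIII.bf 0 0 = 2 * X 3 ∧ modelIII.bf 0 1 = -(C √3 * X 3 ^ 2) ∧
    modelIII.bf 1 0 = C √3 * X 3 ^ 2 ∧ modelIII.bf 1 1 = -(2 * X 3 ^ 3) := by
  simp only [pow_succ, pow_zero, one_mul, two_eq, HolFun.X, C_def, of_mul, of_neg, CRModel.bf, ofζ]
  refine ⟨?_, ?_, ?_, ?_⟩ <;> rw [HolFun.of_eq_of] <;>
    refine Eventually.of_forall fun p => ?_ <;> simp [modelIII] <;> ring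

/-- The matrix B' has rank one: B'ξ is a multiple of (1, √3ζ), and τ = 2(x - √3ζy)² is the square of
a linear form. -/
theorem modelIII_bx (x y : ℂ) : modelIII.bx 0 x y = 2 * (C x - C √3 * X 3 * C y) ∧
    modelIII.bx 1 x y = 2 * C √3 * X 3 * (C x - C √3 * X 3 * C y) := by
  obtain ⟨h1, h2, h3, h4⟩ := modelIII_bf
  have hR : C (√3 : ℝ) * C (√3 : ℝ) = 3 := by
    rw [← map_mul, ← ofReal_mul, Real.mul_self_sqrt (by norm_num)]
    exact map_ofNat C 3
  simp only [CRModel.bx, h1, h2, h3, h4, d_mul, d_neg, d_C, d_two, pow_succ, pow_zero, d_one, d_X,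
    if_true]
  constructor
  · ring
  · linear_combination 2 * X 3 * X 3 * C y * hR

theorem modelIII_k : modelIII.k₁ = 1 ∧ modelIII.k₂ = 0 ∧ modelIII.k₃ = -1 := ⟨rfl, rfl, rfl⟩

/-- Because B' has rank one, the equations control z-derivatives only along ∂₁ + √3ζ∂₂. As this
direction turns with ζ while f does not depend on ζ, repeated ζ-differentiation separates the two
components. In this way f_w is seen to be constant, f_12 and f_22 vanish, and h depends on ζ alone.
The reality conditions then kill f, next h, and finally g₁ and g₂. -/
theorem modelIII_eq_zero {Q : ℂ → ℂ → ℂ → ℝ} (hQ : modelIII.IsGraph Q) {Y : HolGerm}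
    (hY : Y ∈ infSym (graphFun Q)) (h0 : ∀ i, ev (comp i Y) = 0) (hw : ev (d 0 (comp 0 Y)) = 0)
    (hs : (ev (d 3 (comp 3 Y))).im = 0) : Y = 0 := by
  have e := hQ.determining hY
  have cub := hQ.cubic hY
  have re := hQ.reality hY
  have lin := (hQ.reality_linear hY).1
  set f := comp 0 Y
  set g₁ := comp 1 Y
  set g₂ := comp 2 Y
  set h := comp 3 Y
  have hR : C (√3 : ℝ) * C (√3 : ℝ) = 3 := by
    rw [← map_mul, ← ofReal_mul, Real.mul_self_sqrt (by norm_num)]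
    exact map_ofNat C 3
  have hRu : ∀ {x}, C (√3 : ℝ) * x = 0 → x = 0 := fun hx => eq_zero_of_C_mul (by simp) hx
  -- Enough directions ξ are taken to separate the coefficients of the determining equations as
  -- polynomials in (x, y).
  obtain ⟨fs, a1, b1, c1, d1⟩ := e 1 0
  obtain ⟨-, a2, b2, c2, -⟩ := e 1 1
  obtain ⟨-, -, b3, c3, -⟩ := e 1 (-1)
  obtain ⟨-, -, -, c4, -⟩ := e 0 1
  clear e
  simp only [modelIII_bx, CRModel.taux, CRModel.kx, map_one, map_zero, map_neg, modelIII_k, ofReal_one,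
    ofReal_zero, ofReal_neg, one_mul, mul_one, mul_zero, zero_mul, add_zero, zero_add, sub_zero, neg_zero,
    mul_neg, neg_mul, sub_neg_eq_add, d_mul, d_add, d_sub, d_neg, d_C, d_two, d_X, d_one, if_true,
    d_zero] at a1 b1 c1 d1 a2 b2 c2 b3 c3 c4
  set R := C (√3 : ℝ)
  have dR : ∀ i, d i R = 0 := fun i => d_C i _
  set S := X 3
  have dS : d 3 S = 1 := by rw [d_X, if_pos rfl]
  have dS0 : d 0 S = 0 := by rw [d_X, if_neg (by decide)]
  have dS1 : d 1 S = 0 := by rw [d_X, if_neg (by decide)]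
  have dS2 : d 2 S = 0 := by rw [d_X, if_neg (by decide)]
  have A1 : d 3 g₁ = -(d 1 f + R * S * d 2 f) := by
    rw [← sub_eq_zero]; refine two_mul_eq_zero ?_; linear_combination a1
  have A2 : d 3 g₂ = -(R * S * (d 1 f + R * S * d 2 f)) := by
    rw [← sub_eq_zero]; refine two_mul_eq_zero ?_; linear_combination a1 - a2
  have G1 : 2 * (d 1 g₁ + R * S * d 2 g₁) = d 0 f + d 3 h := by
    rw [← sub_eq_zero]; refine two_mul_eq_zero ?_; linear_combination b1
  have G2 : 2 * (d 1 g₂ + R * S * d 2 g₂) = R * S * (d 0 f + d 3 h) + 2 * R * h := by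
    rw [← sub_eq_zero]; refine eq_zero_of_ofNat_mul (n := 4) ?_
    linear_combination b3 - b2 - 4 * R * S * G1
  have W1 : d 0 g₁ = -(d 1 h + R * S * d 2 h) := by
    rw [← sub_eq_zero]; refine eq_zero_of_ofNat_mul (n := 4) ?_; linear_combination c1
  have W2 : d 0 g₂ = -(R * S * (d 1 h + R * S * d 2 h)) := by
    rw [← sub_eq_zero]; refine eq_zero_of_ofNat_mul (n := 8) ?_
    linear_combination c3 - c2 + 2 * c4 - 8 * (2 * R * S) * W1
  have W0 : d 0 h = 0 := eq_zero_of_ofNat_mul (n := 4) (by linear_combination d1)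
  have f3 : ∀ i, d i (d 3 f) = 0 := fun i => by rw [fs, d_zero]
  have h0' : ∀ i, d 0 (d i h) = 0 := fun i => by rw [d_comm, W0, d_zero]
  clear a1 b1 c1 d1 a2 b2 c2 b3 c3 c4
  have k1 := congrArg (d 0) A1
  have k2 := congrArg (d 3) W1
  have k3 := congrArg (d 0) A2
  have k4 := congrArg (d 3) W2
  simp only [d_mul, d_add, d_sub, d_neg, dR, dS, dS0, dS1, dS2, d_two, d_zero, d_one, zero_mul, mul_zero, zero_add,
    add_zero, one_mul, mul_one, neg_zero, d_comm 3 0, d_comm 3 1, d_comm 3 2, d_comm 2 0, d_comm 1 0, d_comm 2 1] at k1 k2 k3 k4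
  -- The mixed derivatives ∂_w∂_ζ of g₁ and g₂ are each computed in two ways. The g₂-identity minus
  -- √3ζ times the g₁-identity leaves √3 times this expression.
  have H : d 1 h + R * S * d 2 h = 0 := hRu (by linear_combination k4 - k3 + R * S * (k1 - k2))
  rw [H] at W1 W2
  rw [mul_zero, neg_zero] at W2
  rw [neg_zero] at W1
  have H3 := congrArg (d 3) H
  simp only [d_mul, d_add, d_sub, d_neg, dR, dS, dS0, dS1, dS2, d_two, d_zero, d_one, zero_mul, mul_zero, zero_add,
    add_zero, one_mul, mul_one, neg_zero, d_comm 3 0, d_comm 3 1, d_comm 3 2, d_comm 2 0, d_comm 1 0, d_comm 2 1] at H3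
  have k5 : d 0 (d 1 f) + R * S * d 0 (d 2 f) = 0 := by linear_combination k1 - k2 + H3
  have k6 := congrArg (d 3) k5
  simp only [d_mul, d_add, d_sub, d_neg, dR, dS, dS0, dS1, dS2, d_two, d_zero, d_one, zero_mul, mul_zero, zero_add,
    add_zero, one_mul, mul_one, neg_zero, d_comm 3 0, d_comm 3 1, d_comm 3 2, d_comm 2 0, d_comm 1 0, d_comm 2 1, fs] at k6
  have f02 : d 0 (d 2 f) = 0 := hRu (by linear_combination k6)
  have f01 : d 0 (d 1 f) = 0 := by linear_combination k5 - R * S * f02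
  have f00 : d 0 (d 0 f) = 0 := by
    have k := congrArg (d 0) G1
    simp only [d_mul, d_add, d_sub, d_neg, dR, dS, dS0, dS1, dS2, d_two, d_zero, d_one, zero_mul, mul_zero, zero_add,
    add_zero, one_mul, mul_one, neg_zero, d_comm 3 0, d_comm 3 1, d_comm 3 2, d_comm 2 0, d_comm 1 0, d_comm 2 1, W1, h0'] at k
    rw [d_comm 0 1, d_comm 0 2, W1] at k
    simpa using k.symm
  clear k1 k2 k3 k4 k5 k6
  have P1 := congrArg (d 3) G1
  have P2 := congrArg (d 3) G2
  have a11 := congrArg (d 1) A1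
  have a12 := congrArg (d 2) A1
  have a21 := congrArg (d 1) A2
  have a22 := congrArg (d 2) A2
  simp only [d_mul, d_add, d_sub, d_neg, dR, dS, dS0, dS1, dS2, d_two, d_zero, d_one, zero_mul, mul_zero, zero_add,
    add_zero, one_mul, mul_one, neg_zero, d_comm 3 0, d_comm 3 1, d_comm 3 2, d_comm 2 0, d_comm 1 0, d_comm 2 1, fs] at P1 P2 a11 a12 a21 a22
  have Q1 : 2 * R * d 2 g₁ = 2 * (d 1 (d 1 f) + 2 * R * S * d 1 (d 2 f) + R * R * S * S * d 2 (d 2 f))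
      + d 3 (d 3 h) := by
    linear_combination P1 - 2 * a11 - 2 * R * S * a12
  have Q2 : 2 * d 2 g₂ = 2 * S * (d 1 (d 1 f) + 2 * R * S * d 1 (d 2 f)
      + R * R * S * S * d 2 (d 2 f)) + d 0 f + 3 * d 3 h + S * d 3 (d 3 h) := by
    rw [← sub_eq_zero]
    refine hRu ?_
    linear_combination P2 - 2 * a21 - 2 * R * S * a22
  have b1 := congrArg (d 3) Q1
  have b2 := congrArg (d 3) Q2
  have d3 : d 3 (3 : HolFun) = 0 := d_ofNat 3 3
  simp only [d_mul, d_add, d_sub, d_neg, dR, dS, dS0, dS1, dS2, d_two, d_zero, d_one, zero_mul, mul_zero, zero_add,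
    add_zero, one_mul, mul_one, neg_zero, d_comm 3 0, d_comm 3 1, d_comm 3 2, d_comm 2 0, d_comm 1 0, d_comm 2 1, fs, d3] at b1 b2
  -- Once `Q1` and `Q2` give g₁ and g₂ along z₂ in terms of f and h, their ζ-derivatives must agree
  -- with `a12` and `a22`. This is the resulting integrability condition.
  have c1 : 2 * (d 1 (d 1 f) + 2 * R * S * d 1 (d 2 f) + R * R * S * S * d 2 (d 2 f))
      + 4 * d 3 (d 3 h) = 0 := by
    linear_combination -b2 + 2 * a22 + S * (b1 - 2 * R * a12)
  have c2 := congrArg (d 3) c1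
  have d4 : d 3 (4 : HolFun) = 0 := d_ofNat 3 4
  simp only [d_mul, d_add, d_sub, d_neg, dR, dS, dS0, dS1, dS2, d_two, d_zero, d_one, zero_mul, mul_zero, zero_add,
    add_zero, one_mul, mul_one, neg_zero, d_comm 3 0, d_comm 3 1, d_comm 3 2, d_comm 2 0, d_comm 1 0, d_comm 2 1, fs, d4] at c2
  have c3 : R * (d 1 (d 2 f) + R * S * d 2 (d 2 f)) = 0 := by
    refine eq_zero_of_ofNat_mul (n := 20) ?_
    linear_combination -4 * b1 + 8 * R * a12 - c2
  have c4 := hRu c3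
  have c5 := congrArg (d 3) c4
  simp only [d_mul, d_add, d_sub, d_neg, dR, dS, dS0, dS1, dS2, d_two, d_zero, d_one, zero_mul, mul_zero, zero_add,
    add_zero, one_mul, mul_one, neg_zero, d_comm 3 0, d_comm 3 1, d_comm 3 2, d_comm 2 0, d_comm 1 0, d_comm 2 1, fs] at c5
  have f22 := hRu c5
  have f12 : d 1 (d 2 f) = 0 := by linear_combination c4 - R * S * f22
  rw [f22, f12] at c1 Q1 Q2
  have l1 := congrArg (d 1) c1
  have l2 := congrArg (d 2) c1
  have m1 := congrArg (d 1) Q1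
  have m2 := congrArg (d 2) Q1
  have n1 := congrArg (d 1) Q2
  have n2 := congrArg (d 2) Q2
  have o1 := congrArg (d 2) G1
  have o2 := congrArg (d 2) G2
  have d5 : ∀ i, d i (4 : HolFun) = 0 := fun i => d_ofNat i 4
  have d6 : ∀ i, d i (3 : HolFun) = 0 := fun i => d_ofNat i 3
  have cub1 : d 1 (d 1 (d 1 f)) = 0 := cub _ _ _ (by decide) (by decide) (by decide)
  have cub2 : d 1 (d 1 (d 2 f)) = 0 := cub _ _ _ (by decide) (by decide) (by decide)
  simp only [d_mul, d_add, d_sub, d_neg, dR, dS, dS0, dS1, dS2, d_two, d_zero, d_one, zero_mul, mul_zero, zero_add,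
    add_zero, one_mul, mul_one, neg_zero, d_comm 3 0, d_comm 3 1, d_comm 3 2, d_comm 2 0, d_comm 1 0, d_comm 2 1, fs, d5, d6, cub1, cub2, f02] at l1 l2 m1 m2 n1 n2 o1 o2
  have l1' := eq_zero_of_ofNat_mul l1
  have l2' := eq_zero_of_ofNat_mul l2
  rw [l1'] at m1 n1
  rw [l2'] at m2 n2
  have m1' : d 1 (d 2 g₁) = 0 := hRu (two_mul_eq_zero (by linear_combination m1))
  have m2' : d 2 (d 2 g₁) = 0 := hRu (two_mul_eq_zero (by linear_combination m2))
  have h23 : d 2 (d 3 h) = 0 := by linear_combination -o1 + 2 * m1' + 2 * R * S * m2'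
  have h2 : d 2 h = 0 := hRu (eq_zero_of_ofNat_mul (n := 5) (by
    linear_combination -o2 + n1 + R * S * n2 - (R * S) * h23 + 3 * H3 + f01))
  have h1 : d 1 h = 0 := by linear_combination H - R * S * h2
  have f11 : d 1 (d 1 f) = 0 := eq_zero_of_partials (by rw [d_comm 0 1, f01, d_zero]) cub1
    (cub _ _ _ (by decide) (by decide) (by decide)) (cub _ _ _ (by decide) (by decide) (by decide))
    (by rw [re.f11, h0 3]; simp)
  have f1 : d 1 f = 0 := eq_zero_of_partials f01 f11 ((d_comm _ _ _).trans f12)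
    ((d_comm _ _ _).trans (f3 1)) (by rw [re.f1, h0 1, h0 2]; simp)
  have f2 : d 2 f = 0 := eq_zero_of_partials f02 f12 f22 ((d_comm _ _ _).trans (f3 2))
    (by rw [re.f2, h0 1, h0 2]; simp)
  have f0 : d 0 f = 0 := eq_zero_of_partials f00 ((d_comm _ _ _).trans f01)
    ((d_comm _ _ _).trans f02) ((d_comm _ _ _).trans (f3 0)) hw
  have hf : f = 0 := eq_zero_of_partials f0 f1 f2 fs (h0 0)
  rw [f11] at c1 Q1 Q2
  have h33 : d 3 (d 3 h) = 0 := eq_zero_of_ofNat_mul (n := 4) (by linear_combination c1)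
  -- Now h_ζ is constant. At 0 it equals 2∂₁g₁ by `G1`, whose real part vanishes by the linear
  -- reality condition; the imaginary part of h_ζ(0) is zero by hypothesis.
  have h3 : d 3 h = 0 := by
    refine eq_zero_of_partials (h0' 3) (by rw [d_comm, h1, d_zero]) h23 h33 ?_
    have k := congrArg ev G1
    have hS : ev S = 0 := ev_X 3
    rw [f0] at k lin
    simp only [modelIII_k, ofReal_one, ofReal_zero, one_mul, zero_mul, add_zero, map_zero] at lin
    simp only [map_mul, map_add, hS, mul_zero, zero_mul, add_zero, map_zero, zero_add,
      map_ofNat] at k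
    apply Complex.ext
    · have := congrArg Complex.re lin
      simp at this
      rw [← k]
      simp
      linarith
    · exact hs
  have hh : h = 0 := eq_zero_of_partials W0 h1 h2 h3 (h0 3)
  rw [h33] at Q1 Q2
  rw [h3, f0] at G1 G2 Q2
  rw [hh] at G2
  rw [f1, f2] at A1 A2
  have g12 : d 2 g₁ = 0 := hRu (two_mul_eq_zero (by linear_combination Q1))
  have g22 : d 2 g₂ = 0 := two_mul_eq_zero (by linear_combination Q2)
  rw [g12] at G1
  rw [g22] at G2
  have hg1 : g₁ = 0 := eq_zero_of_partials W1 (two_mul_eq_zero (by linear_combination G1)) g12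
    (by linear_combination A1) (h0 1)
  have hg2 : g₂ = 0 := eq_zero_of_partials W2 (two_mul_eq_zero (by linear_combination G2)) g22
    (by linear_combination A2) (h0 2)
  exact ext_comp fun i => by rw [comp_zero]; fin_cases i <;> assumption

end

/-! ### Type II: a symmetry is determined by its jet -/

section

open HolFun HolGerm

/-- The data of the type II model. -/
def modelII : CRModel where
  k₁ := 0
  k₂ := 1
  k₃ := 0
  b := ![![fun s => s, fun s => s + s ^ 2], ![fun _ => 0, fun s => s]]
  an := by
    refine analyticAt_b_entry ?_ ?_ ?_ ?_ <;> simp only [Matrix.cons_val] <;> fun_prop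
  zero i j := by fin_cases i <;> fin_cases j <;> simp
  symm s := by simp

theorem modelII_bf : modelII.bf 0 0 = X 3 ∧ modelII.bf 0 1 = X 3 + X 3 ^ 2 ∧
    modelII.bf 1 0 = 0 ∧ modelII.bf 1 1 = X 3 := by
  simp only [pow_succ, pow_zero, one_mul, zero_eq, HolFun.X, of_mul, of_add, CRModel.bf, ofζ]
  refine ⟨?_, ?_, ?_, ?_⟩ <;> rw [HolFun.of_eq_of] <;>
    exact Eventually.of_forall fun p => by simp [modelII, sq]

theorem modelII_bx (x y : ℂ) : modelII.bx 0 x y = C x + (1 + 2 * X 3) * C y ∧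
    modelII.bx 1 x y = C y := by
  obtain ⟨h1, h2, h3, h4⟩ := modelII_bf
  simp only [CRModel.bx, h1, h2, h3, h4, d_mul, d_add, pow_succ, pow_zero, d_one, d_X, if_true,
    d_zero]
  constructor
  · ring
  · ring

theorem HolFun.ev_two : ev (2 : HolFun) = 2 := map_ofNat ev 2

theorem modelII_k : modelII.k₁ = 0 ∧ modelII.k₂ = 1 ∧ modelII.k₃ = 0 := ⟨rfl, rfl, rfl⟩

/-- Here τ = 2xy + (1 + 2ζ)y². The determining equations express the first derivatives of g₁, g₂
partly through f and h. Equality of mixed partials makes first f_11, f_w1 and h_11, then h_12 and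
f_ww vanish. The reality conditions at the origin dispose of the constants that remain. -/
theorem modelII_eq_zero {Q : ℂ → ℂ → ℂ → ℝ} (hQ : modelII.IsGraph Q) {Y : HolGerm}
    (hY : Y ∈ infSym (graphFun Q)) (h0 : ∀ i, ev (comp i Y) = 0) (hw : ev (d 0 (comp 0 Y)) = 0) :
    Y = 0 := by
  have e := hQ.determining hY
  have cub := hQ.cubic hY
  have re := hQ.reality hY
  have lin := (hQ.reality_linear hY).2
  set f := comp 0 Y
  set g₁ := comp 1 Y
  set g₂ := comp 2 Y
  set h := comp 3 Y
  -- In the direction (1, 0) one has τ = 0, so the last two determining equations carry no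
  -- information.
  obtain ⟨fs, a1, b1, -, -⟩ := e 1 0
  obtain ⟨-, a2, b2, c2, d2⟩ := e 0 1
  obtain ⟨-, -, b3, c3, d3⟩ := e 1 1
  obtain ⟨-, -, -, c4, d4⟩ := e 1 (-1)
  clear e
  simp only [modelII_bx, CRModel.taux, CRModel.kx, map_one, map_zero, map_neg, modelII_k, ofReal_one,
    ofReal_zero, one_mul, mul_one, mul_zero, zero_mul, add_zero, zero_add, neg_zero, sub_zero,
    mul_neg, neg_mul, d_mul, d_add, d_neg, d_C, d_two, d_X, d_one, if_true,
    d_zero] at a1 b1 a2 b2 c2 d2 b3 c3 d3 c4 d4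
  set S := X 3
  have dS : d 3 S = 1 := by rw [d_X, if_pos rfl]
  have dS0 : d 0 S = 0 := by rw [d_X, if_neg (by decide)]
  have dS1 : d 1 S = 0 := by rw [d_X, if_neg (by decide)]
  have dS2 : d 2 S = 0 := by rw [d_X, if_neg (by decide)]
  have G0 : d 1 g₂ = 0 := two_mul_eq_zero b1
  have G1 : d 1 g₁ + d 2 g₂ = d 0 f + d 3 h := by
    rw [← sub_eq_zero]
    refine two_mul_eq_zero ?_
    linear_combination b3 - b2 - (4 + 4 * S) * G0
  have G2 : 2 * d 2 g₁ = (1 + 2 * S) * (d 2 g₂ - d 1 g₁) + 2 * h := by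
    linear_combination b2 - (1 + 2 * S) * G1
  have W0 : d 0 h = 0 := eq_zero_of_ofNat_mul (n := 8) (by
    linear_combination d3 + d4 - 2 * d2)
  have W2 : 2 * d 0 g₂ = -d 1 h := by
    rw [← sub_eq_zero]
    refine eq_zero_of_ofNat_mul (n := 4) ?_
    linear_combination c3 - c4 - 2 * c2
  have W1 : 2 * d 0 g₁ = -((1 + 2 * S) * d 1 h + d 2 h) := by
    rw [← sub_eq_zero]
    refine eq_zero_of_ofNat_mul (n := 4) ?_
    linear_combination c3 + c4 - (2 + 4 * S) * W2
  clear b1 b2 c2 d2 b3 c3 d3 c4 d4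
  have hi : ∀ i, d 0 (d i h) = 0 := fun i => by rw [d_comm, W0, d_zero]
  have cub1 : ∀ i j k : Fin 3, d i.succ (d j.succ (d k.succ f)) = 0 := fun i j k =>
    cub _ _ _ (Fin.succ_ne_zero _) (Fin.succ_ne_zero _) (Fin.succ_ne_zero _)
  have f111 : d 1 (d 1 (d 1 f)) = 0 := cub1 0 0 0
  have f112 : d 1 (d 1 (d 2 f)) = 0 := cub1 0 0 1
  have f122 : d 1 (d 2 (d 2 f)) = 0 := cub1 0 1 1
  have f222 : d 2 (d 2 (d 2 f)) = 0 := cub1 1 1 1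
  have k1 := congrArg (d 1) a1
  have k2 := congrArg (d 2) a1
  have k3 := congrArg (d 1) a2
  have k4 := congrArg (d 2) a2
  have k5 := congrArg (d 3) G0
  simp only [d_mul, d_add, d_sub, d_neg, dS, dS0, dS1, dS2, d_two, d_zero, d_one, zero_mul, mul_zero, zero_add,
    add_zero, one_mul, mul_one, neg_zero, d_comm 3 0, d_comm 3 1, d_comm 3 2, d_comm 2 0, d_comm 1 0, d_comm 2 1, fs] at k1 k2 k3 k4 k5
  have f11 : d 1 (d 1 f) = 0 := by linear_combination k1 - 2 * k5
  have G1s := congrArg (d 3) G1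
  have G2s := congrArg (d 3) G2
  simp only [d_mul, d_add, d_sub, d_neg, dS, dS0, dS1, dS2, d_two, d_zero, d_one, zero_mul, mul_zero, zero_add,
    add_zero, one_mul, mul_one, neg_zero, d_comm 3 0, d_comm 3 1, d_comm 3 2, d_comm 2 0, d_comm 1 0, d_comm 2 1, fs] at G1s G2s
  have L : 4 * d 2 g₂ = 2 * d 0 f - (1 + 2 * S) * d 1 (d 2 f) - d 2 (d 2 f) := by
    rw [← sub_eq_zero]
    refine two_mul_eq_zero ?_
    linear_combination 4 * G1 - 2 * G2s + 2 * k4 - (1 + 2 * S) * (k2 - k3 + (1 + 2 * S) * f11)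
  have h33 : 2 * d 3 (d 3 h) = -2 * d 1 (d 2 f) := by
    linear_combination -2 * G1s + k2 + k3 - (1 + 2 * S) * f11
  have d4 : ∀ i, d i (4 : HolFun) = 0 := fun i => d_ofNat i 4
  have l1 := congrArg (d 1) L
  have G02 := congrArg (d 2) G0
  simp only [d_mul, d_add, d_sub, d_neg, dS, dS0, dS1, dS2, d_two, d_zero, d_one, zero_mul, mul_zero, zero_add,
    add_zero, one_mul, mul_one, neg_zero, d_comm 3 0, d_comm 3 1, d_comm 3 2, d_comm 2 0, d_comm 1 0, d_comm 2 1, fs, d4, f112, f122] at l1 G02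
  have f01 : d 0 (d 1 f) = 0 := two_mul_eq_zero (by linear_combination 4 * G02 - l1)
  have f012 : d 0 (d 1 (d 2 f)) = 0 := by
    rw [d_comm 1 2, d_comm 0 2, f01, d_zero]
  have G00 := congrArg (d 0) G0
  have w21 := congrArg (d 1) W2
  simp only [d_mul, d_add, d_sub, d_neg, dS, dS0, dS1, dS2, d_two, d_zero, d_one, zero_mul, mul_zero, zero_add,
    add_zero, one_mul, mul_one, neg_zero, d_comm 3 0, d_comm 3 1, d_comm 3 2, d_comm 2 0, d_comm 1 0, d_comm 2 1, fs] at G00 w21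
  have h11 : d 1 (d 1 h) = 0 := by linear_combination w21 - 2 * G00
  have G10 := congrArg (d 0) G1
  have w11 := congrArg (d 1) W1
  have w22 := congrArg (d 2) W2
  have w12 := congrArg (d 2) W1
  have l0 := congrArg (d 0) L
  have G20 := congrArg (d 0) G2
  simp only [d_mul, d_add, d_sub, d_neg, dS, dS0, dS1, dS2, d_two, d_zero, d_one, zero_mul, mul_zero, zero_add,
    add_zero, one_mul, mul_one, neg_zero, d_comm 3 0, d_comm 3 1, d_comm 3 2, d_comm 2 0, d_comm 1 0, d_comm 2 1, fs, hi, W0, d4, f012] at G10 w11 w22 w12 l0 G20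
  have f00 : d 0 (d 0 f) = -d 1 (d 2 h) := by
    rw [← sub_eq_zero]
    refine two_mul_eq_zero ?_
    linear_combination -2 * G10 + w11 + w22 - (1 + 2 * S) * h11
  have f022 : d 0 (d 2 (d 2 f)) = 0 := by linear_combination l0 - 2 * w22 + 2 * f00
  have h22 : (1 + 2 * S) * d 1 (d 2 h) + d 2 (d 2 h) = 0 := by
    refine two_mul_eq_zero ?_
    linear_combination -2 * G20 + 2 * w12 - (1 + 2 * S) * (w22 - w11 + (1 + 2 * S) * h11)
  have h221 := congrArg (d 1) h22
  have h112 := congrArg (d 2) h11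
  simp only [d_mul, d_add, d_sub, d_neg, dS, dS0, dS1, dS2, d_two, d_zero, d_one, zero_mul, mul_zero, zero_add,
    add_zero, one_mul, mul_one, neg_zero, d_comm 3 0, d_comm 3 1, d_comm 3 2, d_comm 2 0, d_comm 1 0, d_comm 2 1, fs] at h221 h112
  have A1 := congrArg (d 0) a1
  have A2 := congrArg (d 0) a2
  have w23 := congrArg (d 3) W2
  have w13 := congrArg (d 3) W1
  simp only [d_mul, d_add, d_sub, d_neg, dS, dS0, dS1, dS2, d_two, d_zero, d_one, zero_mul, mul_zero, zero_add,
    add_zero, one_mul, mul_one, neg_zero, d_comm 3 0, d_comm 3 1, d_comm 3 2, d_comm 2 0, d_comm 1 0, d_comm 2 1, fs, f01] at A1 A2 w23 w13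
  have h13 : d 1 (d 3 h) = 0 := by linear_combination w23 - A1
  have f02 : d 0 (d 2 f) = 2 * d 1 h + d 2 (d 3 h) := by
    linear_combination A2 - w13 + (1 + 2 * S) * h13
  have G21 := congrArg (d 1) G2
  have G11 := congrArg (d 1) G1
  have G12 := congrArg (d 2) G1
  have L2 := congrArg (d 2) L
  simp only [d_mul, d_add, d_sub, d_neg, dS, dS0, dS1, dS2, d_two, d_zero, d_one, zero_mul, mul_zero, zero_add,
    add_zero, one_mul, mul_one, neg_zero, d_comm 3 0, d_comm 3 1, d_comm 3 2, d_comm 2 0, d_comm 1 0, d_comm 2 1, fs, d4, f122, f222, f01, h13, G02] at G21 G11 G12 L2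
  -- A second formula for f_w2. Comparison with `f02` will kill h_2ζ, and its z₂-derivative kills
  -- h_12 because f_w22 = 0.
  have e1 : d 0 (d 2 f) = 2 * d 1 h := by
    rw [← sub_eq_zero]
    refine eq_zero_of_ofNat_mul (n := 6) ?_
    linear_combination 2 * G21 - 4 * G12 + L2 - 2 * (1 + 2 * S) * G11 + 4 * f02
  have e2 := congrArg (d 2) e1
  simp only [d_mul, d_add, d_sub, d_neg, dS, dS0, dS1, dS2, d_two, d_zero, d_one, zero_mul, mul_zero, zero_add,
    add_zero, one_mul, mul_one, neg_zero, d_comm 3 0, d_comm 3 1, d_comm 3 2, d_comm 2 0, d_comm 1 0, d_comm 2 1, fs, f022] at e2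
  have h12 : d 1 (d 2 h) = 0 := two_mul_eq_zero e2.symm
  rw [h12] at f00 h22
  -- All derivatives of h_1 vanish. Its value at 0 is -2∂_w g₂(0), which is zero because the reality
  -- condition ties it to f_w1 = 0.
  have h1 : d 1 h = 0 := by
    refine eq_zero_of_partials (hi 1) h11 ((d_comm _ _ _).trans h12) ((d_comm _ _ _).trans h13) ?_
    have r : ev (d 0 (d 1 f)) =
        -2 * conj (modelII.k₁ * ev (d 0 g₁) + modelII.k₂ * ev (d 0 g₂)) := re.fw1
    have k := congrArg ev W2
    rw [f01] at r
    simp [modelII_k] at r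
    simpa [ev_two, r] using k.symm
  have h23 : d 2 (d 3 h) = 0 := by linear_combination e1 - f02
  rw [h1] at e1
  have h2 : d 2 h = 0 := by
    refine eq_zero_of_partials (hi 2) h12 (by simpa using h22) ((d_comm _ _ _).trans h23) ?_
    have r : ev (d 0 (d 2 f)) =
        -2 * conj (modelII.k₂ * ev (d 0 g₁) + modelII.k₃ * ev (d 0 g₂)) := re.fw2
    have k := congrArg ev W1
    rw [e1] at r
    simp [modelII_k] at r
    simpa [ev_two, r, h1] using k.symm
  have f12 : d 1 (d 2 f) = 0 := eq_zero_of_partials f012 f112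
    (cub _ _ _ (by decide) (by decide) (by decide)) (cub _ _ _ (by decide) (by decide) (by decide))
    (by rw [re.f12, h0 3]; simp)
  have f22 : d 2 (d 2 f) = 0 := eq_zero_of_partials f022 f122 f222
    (cub _ _ _ (by decide) (by decide) (by decide)) (by rw [re.f22, h0 3]; simp)
  have fi : ∀ i, d 3 (d i f) = 0 := fun i => by rw [d_comm, fs, d_zero]
  have f1 : d 1 f = 0 := eq_zero_of_partials f01 f11 ((d_comm _ _ _).trans f12) (fi 1)
    (by rw [re.f1, h0 1, h0 2]; simp)
  have f2 : d 2 f = 0 := eq_zero_of_partials (by simpa using e1) f12 f22 (fi 2)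
    (by rw [re.f2, h0 1, h0 2]; simp)
  have f0 : d 0 f = 0 := eq_zero_of_partials (by simpa using f00) ((d_comm _ _ _).trans f01)
    ((d_comm _ _ _).trans (by simpa using e1)) (fi 0) hw
  have hf : f = 0 := eq_zero_of_partials f0 f1 f2 fs (h0 0)
  have g22 : d 2 g₂ = 0 := eq_zero_of_ofNat_mul (n := 4) (by rw [L, f0, f12, f22]; ring)
  rw [f0, g22] at G1
  -- At the origin h_ζ equals ∂₁g₁ by `G1`, and the linear reality condition ties ∂₁g₁ to ∂₂g₂ and
  -- f_w, both zero.
  have h3 : d 3 h = 0 := by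
    refine eq_zero_of_partials (hi 3) h13 h23 (two_mul_eq_zero (by rw [h33, f12]; ring)) ?_
    have k := congrArg ev G1
    rw [g22, f0] at lin
    simp [modelII_k] at lin k
    rw [← k, lin]
  have hh : h = 0 := eq_zero_of_partials W0 h1 h2 h3 (h0 3)
  have g11 : d 1 g₁ = 0 := by linear_combination G1 + h3
  have hg1 : g₁ = 0 := eq_zero_of_partials (two_mul_eq_zero (by rw [W1, h1, h2]; ring)) g11
    (two_mul_eq_zero (by rw [G2, g22, g11, hh]; ring))
    (two_mul_eq_zero (by rw [f1, f2] at a2; linear_combination a2)) (h0 1)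
  have hg2 : g₂ = 0 := eq_zero_of_partials (two_mul_eq_zero (by rw [W2, h1]; ring)) G0 g22
    (two_mul_eq_zero (by rw [f1] at a1; linear_combination a1)) (h0 2)
  exact ext_comp fun i => by rw [comp_zero]; fin_cases i <;> assumption

end

/-! ### Type I: a symmetry is determined by its jet -/

section

open HolFun HolGerm

/-- The data of the type I model. -/
def modelI : CRModel where
  k₁ := 0
  k₂ := 1
  k₃ := 0
  b := ![![fun s => √2 * I * s ^ 2 / (2 * s + 1), fun s => (1 + I) * (s + 1) * s / (2 * s + 1)],
    ![fun s => (I - 1) * (s + 1) * s / (2 * s + 1), fun s => √2 * I * s ^ 2 / (2 * s + 1)]]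
  an := by
    refine analyticAt_b_entry ?_ ?_ ?_ ?_ <;> simp only [Matrix.cons_val] <;>
      refine AnalyticAt.div ?_ ?_ ?_ <;> first | fun_prop | simp
  zero i j := by fin_cases i <;> fin_cases j <;> simp
  symm s := by simp

theorem modelI_k : modelI.k₁ = 0 ∧ modelI.k₂ = 1 ∧ modelI.k₃ = 0 := ⟨rfl, rfl, rfl⟩

theorem analyticAt_inv_two_mul_add_one : AnalyticAt ℂ (fun s : ℂ => (2 * s + 1)⁻¹) 0 := by
  refine AnalyticAt.inv ?_ ?_
  · fun_prop
  · simp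

/-- The germ of `1 / (2 ζ + 1)`. -/
def rζ : HolFun := ofζ _ analyticAt_inv_two_mul_add_one

theorem rζ_mul : (2 * X 3 + 1) * rζ = 1 := by
  have h1 : (1 : HolFun) = HolFun.of (fun _ => 1) analyticAt_const := (map_one C).symm
  rw [h1, two_eq]
  simp only [HolFun.X, rζ, ofζ, of_mul, of_add]
  rw [HolFun.of_eq_of]
  have h2 : ∀ᶠ s : ℂ in 𝓝 0, 2 * s + 1 ≠ 0 :=
    ContinuousAt.eventually_ne (by fun_prop) (by simp)
  filter_upwards [tendsto_coord 3 |>.eventually h2] with p hp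
  simp [mul_inv_cancel₀ hp]

theorem d_rζ (i : Fin 4) : d i rζ = if i = 3 then -2 * rζ * rζ else 0 := by
  have h := congrArg (d i) rζ_mul
  simp only [d_mul, d_add, d_two, d_X, d_one, zero_mul, zero_add, add_zero] at h
  split_ifs at h ⊢
  · linear_combination rζ * h - d i rζ * rζ_mul
  · linear_combination rζ * h - d i rζ * rζ_mul

/-- A square root of `i`. -/
def sqrtI : ℂ := (1 + I) / √2

theorem sqrt_two_mul_self : (√2 : ℂ) * √2 = 2 := by
  rw [← ofReal_mul, Real.mul_self_sqrt (by norm_num), ofReal_ofNat]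

theorem sqrt_two_ne_zero : (√2 : ℂ) ≠ 0 := by simp

theorem sqrtI_mul_self : sqrtI * sqrtI = I := by
  rw [sqrtI, div_mul_div_comm, sqrt_two_mul_self]
  linear_combination (1 / 2 : ℂ) * I_mul_I

theorem sqrtI_ne_zero : sqrtI ≠ 0 := fun h => I_ne_zero (by rw [← sqrtI_mul_self, h, zero_mul])

theorem sqrt_two_mul_sqrtI : (√2 : ℂ) * sqrtI = 1 + I := by
  rw [sqrtI, mul_div_cancel₀ _ sqrt_two_ne_zero]

theorem modelI_bf : modelI.bf 0 0 = C (√2 * I) * X 3 ^ 2 * rζ ∧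
    modelI.bf 0 1 = C (1 + I) * (X 3 + 1) * X 3 * rζ ∧
    modelI.bf 1 0 = C (I - 1) * (X 3 + 1) * X 3 * rζ ∧
    modelI.bf 1 1 = C (√2 * I) * X 3 ^ 2 * rζ := by
  have h1 : (1 : HolFun) = HolFun.of (fun _ => 1) analyticAt_const := (map_one C).symm
  rw [h1]
  simp only [sq, HolFun.X, C_def, rζ, ofζ, of_mul, of_add, CRModel.bf]
  refine ⟨?_, ?_, ?_, ?_⟩ <;> rw [HolFun.of_eq_of] <;>
    exact Eventually.of_forall fun p => by simp [modelI, sq, div_eq_mul_inv]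

/-- With W = e^{iπ/4}, P = Wx + y and N = y - Wx, these formulas give τ = ((1 + i)/2)(P² + N²/(2ζ +
1)²). Thus B' is diagonalized by constant vectors, for all ζ at once. -/
theorem modelI_bx (x y : ℂ) :
    modelI.bx 0 x y = C ((1 + I) / 2) *
      ((C sqrtI * C x + C y) + rζ * rζ * (C y - C sqrtI * C x)) ∧
    modelI.bx 1 x y = C ((1 + I) / 2) * C sqrtI *
      ((C sqrtI * C x + C y) - rζ * rζ * (C y - C sqrtI * C x)) := by
  obtain ⟨h1, h2, h3, h4⟩ := modelI_bf
  have e1 : C (√2 * I) = 2 * C ((1 + I) / 2) * C sqrtI := by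
    rw [← map_ofNat C 2, ← map_mul, ← map_mul]
    congr 1
    linear_combination (-√2) * sqrtI_mul_self + sqrtI * sqrt_two_mul_sqrtI
  have e2 : C (1 + I) = 2 * C ((1 + I) / 2) := by
    rw [← map_ofNat C 2, ← map_mul]
    congr 1
    ring
  have e3 : C (I - 1) = 2 * C ((1 + I) / 2) * C sqrtI * C sqrtI := by
    rw [← map_ofNat C 2, ← map_mul, ← map_mul, ← map_mul]
    congr 1
    linear_combination (-(1 + I)) * sqrtI_mul_self - I_mul_I
  have d3 : d 3 (C (√2 * I)) = 0 := d_C _ _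
  have hr := rζ_mul
  simp only [CRModel.bx, h1, h2, h3, h4, d_mul, d_add, d_C, d_rζ, sq, d_one, d_X, if_true, zero_mul,
    zero_add, add_zero, mul_one, one_mul]
  rw [e1, e2, e3]
  generalize rζ = r at *
  generalize X 3 = S at *
  have q1 : 2 * ((S + S) * r + S * S * (-2 * r * r)) = 1 - r * r := by
    linear_combination (r + 1 - 2 * S * r) * hr
  have q2 : 2 * ((S + (S + 1)) * r + (S + 1) * S * (-2 * r * r)) = 1 + r * r := by
    linear_combination (1 - (2 * S + 1) * r) * hr
  constructor
  · linear_combination C ((1 + I) / 2) * (C sqrtI * C x * q1 + C y * q2)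
  · linear_combination C ((1 + I) / 2) * C sqrtI * (C sqrtI * C x * q2 + C y * q1)

/-- In the eigendirections of B' the equations decouple in terms of U = g₁ + W⁻¹g₂, V = g₁ - W⁻¹g₂
and the derivatives ∂₁ ± W∂₂. Integrability makes f_ww and all f_wjk with z-indices j, k vanish. The
remaining constants f_w1(0) and f_w2(0) are killed by a contraction argument combining the reality
conditions with the determining equations. -/
theorem modelI_eq_zero {Q : ℂ → ℂ → ℂ → ℝ} (hQ : modelI.IsGraph Q) {Y : HolGerm}
    (hY : Y ∈ infSym (graphFun Q)) (h0 : ∀ i, ev (comp i Y) = 0) (hw : ev (d 0 (comp 0 Y)) = 0) :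
    Y = 0 := by
  have e := hQ.determining hY
  have cub := hQ.cubic hY
  have re := hQ.reality hY
  set f := comp 0 Y
  set g₁ := comp 1 Y
  set g₂ := comp 2 Y
  set h := comp 3 Y
  -- The first two directions are the eigendirections, N = 0 and P = 0. The third, (0, 1), has P = N
  -- = 1 and supplies the mixed term `PV`.
  obtain ⟨fs, a1, b1, c1, d1⟩ := e sqrtI⁻¹ 1
  obtain ⟨-, a2, b2, c2, -⟩ := e (-sqrtI⁻¹) 1
  obtain ⟨-, -, b3, -, -⟩ := e 0 1
  clear e
  have hWJ : C sqrtI * C sqrtI⁻¹ = 1 := C_mul_inv_C sqrtI_ne_zero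
  have hκu : ∀ {x}, C ((1 + I) / 2) * x = 0 → x = 0 := fun hx => eq_zero_of_C_mul (fun h => by
    have := congrArg Complex.re h
    simp at this) hx
  have hr := rζ_mul
  have dr : d 3 rζ = -2 * rζ * rζ := by rw [d_rζ, if_pos rfl]
  have dr0 : d 0 rζ = 0 := by rw [d_rζ, if_neg (by decide)]
  have dr1 : d 1 rζ = 0 := by rw [d_rζ, if_neg (by decide)]
  have dr2 : d 2 rζ = 0 := by rw [d_rζ, if_neg (by decide)]
  simp only [modelI_bx, CRModel.taux, CRModel.kx, map_one, map_zero, map_neg, modelI_k, ofReal_one,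
    ofReal_zero, one_mul, mul_one, mul_zero, zero_mul, add_zero, zero_add, neg_zero, sub_zero,
    mul_neg, neg_mul, hWJ, sub_self, sub_neg_eq_add, neg_add_cancel] at a1 b1 c1 d1 a2 b2 c2 b3
  set W := C sqrtI
  set J := C sqrtI⁻¹
  set κ := C ((1 + I) / 2)
  set r := rζ
  set S := X 3
  have dW : ∀ i, d i W = 0 := fun i => d_C i _
  have dJ : ∀ i, d i J = 0 := fun i => d_C i _
  have dκ : ∀ i, d i κ = 0 := fun i => d_C i _
  have dS : d 3 S = 1 := by rw [d_X, if_pos rfl]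
  have dS0 : d 0 S = 0 := by rw [d_X, if_neg (by decide)]
  have dS1 : d 1 S = 0 := by rw [d_X, if_neg (by decide)]
  have dS2 : d 2 S = 0 := by rw [d_X, if_neg (by decide)]
  have hru : ∀ {x}, r * x = 0 → x = 0 := fun {x} hx => by
    linear_combination (2 * S + 1) * hx - x * hr
  obtain ⟨U, hU⟩ : ∃ U, U = g₁ + J * g₂ := ⟨_, rfl⟩
  obtain ⟨V, hV⟩ : ∃ V, V = g₁ - J * g₂ := ⟨_, rfl⟩
  have dU : ∀ i, d i U = d i g₁ + J * d i g₂ := fun i => by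
    rw [hU, d_add, d_mul, dJ]
    ring
  have dV : ∀ i, d i V = d i g₁ - J * d i g₂ := fun i => by
    rw [hV, d_sub, d_mul, dJ]
    ring
  have U3 : d 3 U = -κ * (d 1 f + W * d 2 f) := by
    rw [← sub_eq_zero]; refine two_mul_eq_zero ?_; rw [dU]; linear_combination a1
  have V3 : d 3 V = -κ * r * r * (d 1 f - W * d 2 f) := by
    rw [← sub_eq_zero]; refine two_mul_eq_zero ?_; rw [dV]; linear_combination a2
  have W0 : d 0 h = 0 := by
    refine hκu (hκu (eq_zero_of_ofNat_mul (n := 16) ?_))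
    linear_combination d1 - κ * κ * d 0 h * (8 + 4 * (W * J + 1)) * hWJ
  have U0 : d 0 U = -κ * (d 1 h + W * d 2 h) := by
    rw [← sub_eq_zero]
    refine hκu (eq_zero_of_ofNat_mul (n := 8) ?_)
    rw [dU]
    linear_combination c1 - κ * 4 * (d 0 g₁ + J * d 0 g₂ + κ * (d 1 h + W * d 2 h)) * hWJ
  have V0 : d 0 V = -κ * r * r * (d 1 h - W * d 2 h) := by
    rw [← sub_eq_zero]
    refine hκu (hru (hru (eq_zero_of_ofNat_mul (n := 8) ?_)))
    rw [dV]
    linear_combination c2 - κ * r * r * 4 *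
      (d 0 g₁ - J * d 0 g₂ + κ * r * r * (d 1 h - W * d 2 h)) * hWJ
  simp only [d_mul, d_add, d_sub, d_neg, dW, dJ, dκ, dr, d_one, d_zero, mul_zero, zero_mul,
    zero_add, add_zero, neg_zero] at b1 b2 b3
  have PU : d 1 U + W * d 2 U = d 0 f + d 3 h := by
    rw [← sub_eq_zero]
    refine hκu (eq_zero_of_ofNat_mul (n := 4) ?_)
    rw [dU, dU]
    linear_combination b1 + 2 * κ * (d 0 f + d 3 h) * hWJ
  have NV : d 1 V - W * d 2 V = d 0 f + d 3 h - 4 * r * h := by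
    rw [← sub_eq_zero]
    refine hκu (hru (hru (eq_zero_of_ofNat_mul (n := 4) ?_)))
    rw [dV, dV]
    linear_combination b2 + 2 * κ * r * r * (d 0 f + d 3 h - 4 * r * h) * hWJ
  have PV : d 1 V + W * d 2 V + r * r * (d 1 U - W * d 2 U) = 0 := by
    refine hκu ?_
    have e1 := PU
    have e2 := NV
    rw [dU, dU] at e1
    rw [dV, dV] at e2
    rw [dU, dU, dV, dV]
    linear_combination b3 - κ * e1 - κ * r * r * e2
  clear a1 b1 c1 d1 a2 b2 c2 b3
  have f111 : d 1 (d 1 (d 1 f)) = 0 := cub _ _ _ (by decide) (by decide) (by decide)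
  have f112 : d 1 (d 1 (d 2 f)) = 0 := cub _ _ _ (by decide) (by decide) (by decide)
  have f122 : d 1 (d 2 (d 2 f)) = 0 := cub _ _ _ (by decide) (by decide) (by decide)
  have f222 : d 2 (d 2 (d 2 f)) = 0 := cub _ _ _ (by decide) (by decide) (by decide)
  have hi : ∀ i, d 0 (d i h) = 0 := fun i => by rw [d_comm, W0, d_zero]
  have fi : ∀ i, d 3 (d i f) = 0 := fun i => by rw [d_comm, fs, d_zero]
  have d4 : ∀ i, d i (4 : HolFun) = 0 := fun i => d_ofNat i 4
  have U30 := congrArg (d 0) U3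
  have U31 := congrArg (d 1) U3
  have U32 := congrArg (d 2) U3
  have V30 := congrArg (d 0) V3
  have V31 := congrArg (d 1) V3
  have V32 := congrArg (d 2) V3
  have PU3 := congrArg (d 3) PU
  have PV3 := congrArg (d 3) PV
  have NV3 := congrArg (d 3) NV
  simp only [d_mul, d_add, d_sub, d_neg, dS, dS0, dS1, dS2, dW, dκ, dr, dr0, dr1, dr2, fs, d_two, d_one, d_zero, mul_zero,
    zero_mul, zero_add, add_zero, one_mul, mul_one, neg_zero, d_comm 3 0, d_comm 3 1, d_comm 3 2,
    d_comm 2 0, d_comm 1 0, d_comm 2 1, d4] at U30 U31 U32 V30 V31 V32 PU3 PV3 NV3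
  have h33 : d 3 (d 3 h) = -κ * (d 1 (d 1 f) + 2 * W * d 1 (d 2 f) + W * W * d 2 (d 2 f)) := by
    linear_combination -PU3 + U31 + W * U32
  have NU : 2 * (d 1 U - W * d 2 U) = -κ * (2 * S + 1) * (d 1 (d 1 f) - W * W * d 2 (d 2 f)) := by
    rw [← sub_eq_zero]
    refine hru (hru (hru (two_mul_eq_zero ?_)))
    linear_combination -PV3 + V31 + W * V32 + r * r * (U31 - W * U32)
      + 2 * κ * r * r * (d 1 (d 1 f) - W * W * d 2 (d 2 f)) * hr
  have NU1 := congrArg (d 1) NU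
  have NU2 := congrArg (d 2) NU
  have PU1 := congrArg (d 1) PU
  have PU2 := congrArg (d 2) PU
  have NV1 := congrArg (d 1) NV
  have NV2 := congrArg (d 2) NV
  have PV1 := congrArg (d 1) PV
  have PV2 := congrArg (d 2) PV
  simp only [d_mul, d_add, d_sub, d_neg, dS, dS0, dS1, dS2, dW, dκ, dr, dr0, dr1, dr2, fs, d_two, d_one, d_zero, mul_zero,
    zero_mul, zero_add, add_zero, one_mul, mul_one, neg_zero, d_comm 3 0, d_comm 3 1, d_comm 3 2,
    d_comm 2 0, d_comm 1 0, d_comm 2 1, d4, f111, f112, f122, f222] at NU1 NU2 PU1 PU2 NV1 NV2 PV1 PV2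
  have NF : d 0 (d 1 f) + d 1 (d 3 h) - W * (d 0 (d 2 f) + d 2 (d 3 h)) = 0 := by
    refine two_mul_eq_zero ?_
    linear_combination -2 * PU1 + 2 * W * PU2 + NU1 + W * NU2
  have PF : d 0 (d 1 f) + d 1 (d 3 h) + W * (d 0 (d 2 f) + d 2 (d 3 h)) =
      4 * r * (d 1 h + W * d 2 h) := by
    rw [← sub_eq_zero]
    refine two_mul_eq_zero ?_
    linear_combination -2 * (NV1 + W * NV2) + 2 * (PV1 - W * PV2) - r * r * (NU1 - W * NU2)
  have U01 := congrArg (d 1) U0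
  have U02 := congrArg (d 2) U0
  have U03 := congrArg (d 3) U0
  have V01 := congrArg (d 1) V0
  have V02 := congrArg (d 2) V0
  have V03 := congrArg (d 3) V0
  have PU0 := congrArg (d 0) PU
  have NV0 := congrArg (d 0) NV
  have PV0 := congrArg (d 0) PV
  have NU0 := congrArg (d 0) NU
  simp only [d_mul, d_add, d_sub, d_neg, dS, dS0, dS1, dS2, dW, dκ, dr, dr0, dr1, dr2, fs, d_two, d_one, d_zero, mul_zero,
    zero_mul, zero_add, add_zero, one_mul, mul_one, neg_zero, d_comm 3 0, d_comm 3 1, d_comm 3 2,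
    d_comm 2 0, d_comm 1 0, d_comm 2 1, d4, W0, hi] at U01 U02 U03 V01 V02 V03 PU0 NV0 PV0 NU0
  have Ph3 : d 1 (d 3 h) + W * d 2 (d 3 h) = d 0 (d 1 f) + W * d 0 (d 2 f) := by
    rw [← sub_eq_zero]
    refine hκu ?_
    linear_combination U03 - U30
  have Nh3 : d 0 (d 1 f) - W * d 0 (d 2 f) =
      d 1 (d 3 h) - W * d 2 (d 3 h) - 4 * r * (d 1 h - W * d 2 h) := by
    rw [← sub_eq_zero]
    refine hκu (hru (hru ?_))
    linear_combination V30 - V03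
  have Pf0 : d 0 (d 1 f) + W * d 0 (d 2 f) = 2 * r * (d 1 h + W * d 2 h) := by
    rw [← sub_eq_zero]
    refine two_mul_eq_zero ?_
    linear_combination PF - Ph3
  have Nf0 : d 0 (d 1 f) - W * d 0 (d 2 f) = -2 * r * (d 1 h - W * d 2 h) := by
    rw [← sub_eq_zero]
    refine two_mul_eq_zero ?_
    linear_combination NF + Nh3
  have PPh : d 0 (d 0 f) = -κ * (d 1 (d 1 h) + 2 * W * d 1 (d 2 h) + W * W * d 2 (d 2 h)) := by
    linear_combination -PU0 + U01 + W * U02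
  have NNh : d 0 (d 0 f) =
      -κ * r * r * (d 1 (d 1 h) - 2 * W * d 1 (d 2 h) + W * W * d 2 (d 2 h)) := by
    linear_combination -NV0 + V01 - W * V02
  have PNh : d 1 (d 1 h) - W * W * d 2 (d 2 h) = 0 := by
    refine hκu (hru (hru (two_mul_eq_zero ?_)))
    linear_combination -PV0 + V01 + W * V02 + r * r * (U01 - W * U02)
  have PNf : d 0 (d 1 (d 1 f)) - W * W * d 0 (d 2 (d 2 f)) = 0 := by
    refine hκu ?_
    linear_combination r * (NU0 - 2 * U01 + 2 * W * U02 + 2 * κ * PNh)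
      - κ * (d 0 (d 1 (d 1 f)) - W * W * d 0 (d 2 (d 2 f))) * hr
  have Pf1 := congrArg (d 1) Pf0
  have Pf2 := congrArg (d 2) Pf0
  have Nf1 := congrArg (d 1) Nf0
  have Nf2 := congrArg (d 2) Nf0
  simp only [d_mul, d_add, d_sub, d_neg, dS, dS0, dS1, dS2, dW, dκ, dr, dr0, dr1, dr2, fs, d_two, d_one, d_zero, mul_zero,
    zero_mul, zero_add, add_zero, one_mul, mul_one, neg_zero, d_comm 3 0, d_comm 3 1, d_comm 3 2,
    d_comm 2 0, d_comm 1 0, d_comm 2 1] at Pf1 Pf2 Nf1 Nf2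
  have PPf : κ * (2 * S + 1) * (d 0 (d 1 (d 1 f)) + 2 * W * d 0 (d 1 (d 2 f))
      + W * W * d 0 (d 2 (d 2 f))) = -2 * d 0 (d 0 f) := by
    linear_combination κ * (2 * S + 1) * (Pf1 + W * Pf2) + 2 * PPh
      + 2 * κ * (d 1 (d 1 h) + 2 * W * d 1 (d 2 h) + W * W * d 2 (d 2 h)) * hr
  have PPf3 := congrArg (d 3) PPf
  simp only [d_mul, d_add, d_sub, d_neg, dS, dS0, dS1, dS2, dW, dκ, dr, dr0, dr1, dr2, fs, d_two, d_one, d_zero, mul_zero,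
    zero_mul, zero_add, add_zero, one_mul, mul_one, neg_zero, d_comm 3 0, d_comm 3 1, d_comm 3 2,
    d_comm 2 0, d_comm 1 0, d_comm 2 1] at PPf3
  -- In `PPf` the factor 2ζ + 1 multiplies a ζ-independent germ, and the right-hand side is also
  -- ζ-independent; hence both vanish.
  have PPf0 : d 0 (d 1 (d 1 f)) + 2 * W * d 0 (d 1 (d 2 f)) + W * W * d 0 (d 2 (d 2 f)) = 0 :=
    hκu (two_mul_eq_zero (by linear_combination PPf3))
  have f00 : d 0 (d 0 f) = 0 :=
    two_mul_eq_zero (by linear_combination PPf - κ * (2 * S + 1) * PPf0)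
  have NNf0 : d 0 (d 1 (d 1 f)) - 2 * W * d 0 (d 1 (d 2 f)) + W * W * d 0 (d 2 (d 2 f)) = 0 := by
    refine hκu (hru ?_)
    linear_combination κ * r * (Nf1 - W * Nf2) - 2 * NNh + 2 * f00
  have hWu : ∀ {x}, W * x = 0 → x = 0 := fun {x} hx => by linear_combination J * hx - x * hWJ
  have f012 : d 0 (d 1 (d 2 f)) = 0 :=
    hWu (eq_zero_of_ofNat_mul (n := 4) (by linear_combination PPf0 - NNf0))
  have f011 : d 0 (d 1 (d 1 f)) = 0 :=
    eq_zero_of_ofNat_mul (n := 4) (by linear_combination PPf0 + NNf0 + 2 * PNf)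
  have f022 : d 0 (d 2 (d 2 f)) = 0 :=
    hWu (hWu (eq_zero_of_ofNat_mul (n := 4) (by linear_combination PPf0 + NNf0 - 2 * PNf)))
  have evS : ev S = 0 := ev_X 3
  have evr : ev r = 1 := by
    have := congrArg ev hr
    simpa [evS] using this
  have evW : ev W = sqrtI := ev_C _
  have evκ : ev κ = (1 + I) / 2 := ev_C _
  have evJ : ev J = sqrtI⁻¹ := ev_C _
  have re1 : ev (d 0 (d 1 f)) = -2 * conj (modelI.k₁ * ev (d 0 g₁) + modelI.k₂ * ev (d 0 g₂)) :=
    re.fw1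
  have re2 : ev (d 0 (d 2 f)) = -2 * conj (modelI.k₂ * ev (d 0 g₁) + modelI.k₃ * ev (d 0 g₂)) :=
    re.fw2
  simp only [modelI_k, ofReal_zero, ofReal_one, zero_mul, one_mul, zero_add, add_zero] at re1 re2
  have u0 := congrArg ev U0
  have v0 := congrArg ev V0
  have p0 := congrArg ev Pf0
  have n0 := congrArg ev Nf0
  rw [dU] at u0
  rw [dV] at v0
  simp only [map_add, map_sub, map_mul, map_neg, evr, evW, evκ, evJ, ev_two, mul_one] at u0 v0 p0 n0
  have hκW : (1 + I) / 2 * sqrtI = I / √2 := by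
    rw [sqrtI, eq_div_iff sqrt_two_ne_zero, mul_assoc, div_mul_cancel₀ _ sqrt_two_ne_zero]
    linear_combination (1 / 2 : ℂ) * I_mul_I
  -- The reality conditions express f_w1(0), f_w2(0) through the conjugates of ∂_w g₂, ∂_w g₁, which
  -- the determining equations express back through f_w1, f_w2. The composite multiplies absolute
  -- values by 1/√2 < 1, so only 0 is possible.
  have key : ∀ x : ℂ, x = -(I / √2) * conj x → x = 0 := by
    intro x hx
    have h1 := congrArg norm hx
    rw [norm_mul, norm_neg, norm_div, norm_I, Complex.norm_conj, norm_real, Real.norm_eq_abs,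
      abs_of_nonneg (Real.sqrt_nonneg 2)] at h1
    by_contra h2
    have h3 : 0 < ‖x‖ := norm_pos_iff.2 h2
    have h4 : (1 : ℝ) / √2 < 1 := by
      rw [div_lt_one (by positivity)]
      exact Real.lt_sqrt_of_sq_lt (by norm_num)
    nlinarith
  have hg1 : 2 * ev (d 0 g₁) = -(I / √2) * ev (d 0 (d 2 f)) := by
    rw [← hκW]
    linear_combination u0 + v0 - (1 + I) / 4 * (n0 - p0)
  have hg2 : 2 * ev (d 0 g₂) = -(I / √2) * ev (d 0 (d 1 f)) := by
    rw [← hκW]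
    have := mul_inv_cancel₀ sqrtI_ne_zero
    linear_combination sqrtI * (u0 - v0 + (1 + I) / 4 * (n0 + p0)) - 2 * ev (d 0 g₂) * this
  have conj_two : conj ((√2 : ℝ) : ℂ) = √2 := conj_ofReal _
  have e01 : ev (d 0 (d 1 f)) = 0 := key _ (by
    have := congrArg conj hg2
    simp only [map_mul, map_neg, map_div₀, conj_I, conj_two, Complex.conj_ofNat] at this
    linear_combination re1 - this)
  have e02 : ev (d 0 (d 2 f)) = 0 := key _ (by
    have := congrArg conj hg1
    simp only [map_mul, map_neg, map_div₀, conj_I, conj_two, Complex.conj_ofNat] at this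
    linear_combination re2 - this)
  have f01 : d 0 (d 1 f) = 0 := eq_zero_of_partials
    (by rw [d_comm 0 1, d_comm 0 1, f00, d_zero]) ((d_comm _ _ _).trans f011)
    (by rw [d_comm 2 0, d_comm 2 1, f012]) (by rw [d_comm 3 0, fi, d_zero]) e01
  have f02 : d 0 (d 2 f) = 0 := eq_zero_of_partials
    (by rw [d_comm 0 2, d_comm 0 2, f00, d_zero]) ((d_comm _ _ _).trans f012)
    ((d_comm _ _ _).trans f022) (by rw [d_comm 3 0, fi, d_zero]) e02
  rw [f01, f02] at Pf0 Nf0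
  have Ph : d 1 h + W * d 2 h = 0 := hru (two_mul_eq_zero (by linear_combination -Pf0))
  have Nh : d 1 h - W * d 2 h = 0 := hru (two_mul_eq_zero (by linear_combination Nf0))
  have h1 : d 1 h = 0 := two_mul_eq_zero (by linear_combination Ph + Nh)
  have h2 : d 2 h = 0 := hWu (two_mul_eq_zero (by linear_combination Ph - Nh))
  have f11 : d 1 (d 1 f) = 0 := eq_zero_of_partials f011 f111
    ((d_comm _ _ _).trans (by rw [d_comm 2 1, f112])) (by rw [d_comm 3 1, fi, d_zero])
    (by rw [re.f11, h0 3]; simp)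
  have f12 : d 1 (d 2 f) = 0 := eq_zero_of_partials f012 f112
    ((d_comm _ _ _).trans f122) (by rw [d_comm 3 1, fi, d_zero])
    (by rw [re.f12, h0 3]; simp)
  have f22 : d 2 (d 2 f) = 0 := eq_zero_of_partials f022 f122 f222 (by rw [d_comm 3 2, fi, d_zero])
    (by rw [re.f22, h0 3]; simp)
  have f1 : d 1 f = 0 := eq_zero_of_partials f01 f11 ((d_comm _ _ _).trans f12) (fi 1)
    (by rw [re.f1, h0 1, h0 2]; simp)
  have f2 : d 2 f = 0 := eq_zero_of_partials f02 f12 f22 (fi 2)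
    (by rw [re.f2, h0 1, h0 2]; simp)
  have f0 : d 0 f = 0 := eq_zero_of_partials f00 ((d_comm _ _ _).trans f01)
    ((d_comm _ _ _).trans f02) (fi 0) hw
  have hf : f = 0 := eq_zero_of_partials f0 f1 f2 fs (h0 0)
  rw [f11, f12, f22] at h33
  rw [f11, f22] at NU
  rw [f11, f12] at V31
  rw [f12, f22] at V32
  -- Together with h_ζζ = 0 and h(0) = 0 this equation gives h = 0; no further reality condition is
  -- needed.
  have h3r : d 3 h = 2 * r * h := by
    rw [← sub_eq_zero]
    refine hru (eq_zero_of_ofNat_mul (n := 4) ?_)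
    linear_combination NV3 - V31 + W * V32 + h33
  have h3 : d 3 h = 0 := eq_zero_of_partials (hi 3) (by rw [d_comm, h1, d_zero])
    (by rw [d_comm, h2, d_zero]) (by rw [h33]; ring) (by rw [h3r, map_mul, h0 3, mul_zero])
  have hh : h = 0 := eq_zero_of_partials W0 h1 h2 h3 (h0 3)
  rw [f0, h3] at PU
  rw [f0, h3, hh] at NV
  have NU' : d 1 U - W * d 2 U = 0 := two_mul_eq_zero (by rw [NU]; ring)
  have PV' : d 1 V + W * d 2 V = 0 := by linear_combination PV - r * r * NU'
  have hU0 : U = 0 := eq_zero_of_partials (by rw [U0, h1, h2]; ring)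
    (two_mul_eq_zero (by linear_combination PU + NU'))
    (hWu (two_mul_eq_zero (by linear_combination PU - NU'))) (by rw [U3, f1, f2]; ring)
    (by rw [hU, map_add, map_mul, h0 1, h0 2]; ring)
  have hV0 : V = 0 := eq_zero_of_partials (by rw [V0, h1, h2]; ring)
    (two_mul_eq_zero (by linear_combination PV' + NV))
    (hWu (two_mul_eq_zero (by linear_combination PV' - NV))) (by rw [V3, f1, f2]; ring)
    (by rw [hV, map_sub, map_mul, h0 1, h0 2]; ring)
  rw [hU] at hU0
  rw [hV] at hV0
  have hg₁ : g₁ = 0 := two_mul_eq_zero (by linear_combination hU0 + hV0)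
  have hg₂ : g₂ = 0 := two_mul_eq_zero
    (by linear_combination W * (hU0 - hV0) - 2 * g₂ * hWJ)
  exact ext_comp fun i => by rw [comp_zero]; fin_cases i <;> assumption

end

/-! ### The given equations of types II and III describe these models -/

section

open HolFun HolGerm

/-- For fixed ζ the function Q is the real part of zᵀ(Pz + Hz̄). If Pz + Hz̄ = Kā on the
parametrization, then Q = Re K(ā, z). The hypotheses are linear in a and ā, hence easier to verify
than the quadratic identity. -/
theorem CRModel.IsGraph.of_coeff {M : CRModel} {Q : ℂ → ℂ → ℂ → ℝ} {U : ℂ → Prop}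
    (hU : ∀ᶠ s in 𝓝 (0 : ℂ), U s) (P₁₁ P₁₂ P₂₂ H₁₁ H₁₂ H₂₂ : ℂ → ℂ)
    (hQ : ∀ s, U s → ∀ z₁ z₂, Q z₁ z₂ s =
      (z₁ * (P₁₁ s * z₁ + P₁₂ s * z₂ + H₁₁ s * conj z₁ + H₁₂ s * conj z₂)
        + z₂ * (P₁₂ s * z₁ + P₂₂ s * z₂ + conj (H₁₂ s) * conj z₁ + H₂₂ s * conj z₂)).re)
    (h₁ : ∀ s, U s → ∀ a₁ a₂, P₁₁ s * M.z₁ a₁ (conj a₁) (conj a₂) s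
      + P₁₂ s * M.z₂ a₂ (conj a₁) (conj a₂) s + H₁₁ s * conj (M.z₁ a₁ (conj a₁) (conj a₂) s)
      + H₁₂ s * conj (M.z₂ a₂ (conj a₁) (conj a₂) s) = M.k₁ * conj a₁ + M.k₂ * conj a₂)
    (h₂ : ∀ s, U s → ∀ a₁ a₂, P₁₂ s * M.z₁ a₁ (conj a₁) (conj a₂) s
      + P₂₂ s * M.z₂ a₂ (conj a₁) (conj a₂) s + conj (H₁₂ s) * conj (M.z₁ a₁ (conj a₁) (conj a₂) s)
      + H₂₂ s * conj (M.z₂ a₂ (conj a₁) (conj a₂) s) = M.k₂ * conj a₁ + M.k₃ * conj a₂) :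
    M.IsGraph Q := by
  filter_upwards [hU] with s hs a₁ a₂
  rw [hQ s hs, h₁ s hs, h₂ s hs, CRModel.K]
  congr 1
  ring

theorem eventually_one_sub_ne_zero : ∀ᶠ s in 𝓝 (0 : ℂ), 1 - s * conj s ≠ 0 := by
  refine ContinuousAt.eventually_ne ?_ (by simp)
  exact (continuous_const.sub (continuous_id.mul continuous_conj)).continuousAt

theorem isGraph_modelII : modelII.IsGraph QII := by
  refine CRModel.IsGraph.of_coeff eventually_one_sub_ne_zero
    (fun _ => 0) (fun s => conj s / (1 - s * conj s))
    (fun s => (conj s ^ 2 + conj s) / (1 - s * conj s) +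
      s * conj s * (s * conj s + conj s ^ 2 + 2 * conj s) / (1 - s * conj s) ^ 2)
    (fun _ => 0) (fun s => 1 / (1 - s * conj s))
    (fun s => s * conj s * (2 + s + conj s) / (1 - s * conj s) ^ 2) ?_ ?_ ?_
  · intro s hs z₁ z₂
    apply ofReal_injective
    rw [QII]
    simp only [ofReal_add, ofReal_mul, ofReal_div, ofReal_sub, ofReal_pow, ofReal_one, ofReal_ofNat,
      re_eq_add_conj, ← mul_conj', map_add, map_mul, map_div₀, map_sub, map_pow, map_one, map_ofNat,
      Complex.conj_conj, map_zero, Complex.conj_ofNat]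
    generalize conj s = S at *
    have hs' : 1 - S * s ≠ 0 := by rwa [mul_comm]
    rw [show S * s = s * S from mul_comm _ _]
    field_simp
    ring
  · intro s hs a₁ a₂
    simp only [modelII, CRModel.z₁, CRModel.z₂, Matrix.cons_val, map_add, map_sub, map_mul, map_pow,
      Complex.conj_conj, map_zero]
    generalize conj s = S at *
    push_cast
    obtain ⟨n, hn⟩ : ∃ n, n = 1 - s * S := ⟨_, rfl⟩
    rw [← hn] at hs ⊢
    field_simp
    rw [hn]
    ring
  · intro s hs a₁ a₂
    simp only [modelII, CRModel.z₁, CRModel.z₂, Matrix.cons_val, map_add, map_sub, map_mul, map_pow,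
      Complex.conj_conj, map_zero, map_div₀, map_one]
    generalize conj s = S at *
    rw [show S * s = s * S from mul_comm _ _]
    push_cast
    obtain ⟨n, hn⟩ : ∃ n, n = 1 - s * S := ⟨_, rfl⟩
    rw [← hn] at hs ⊢
    field_simp
    rw [hn]
    ring

theorem sqrt_three_sq : ((√3 : ℝ) : ℂ) ^ 2 = 3 := by
  rw [← ofReal_pow, Real.sq_sqrt (by norm_num), ofReal_ofNat]

theorem isGraph_modelIII : modelIII.IsGraph QIII := by
  refine CRModel.IsGraph.of_coeff eventually_one_sub_ne_zero
    (fun s => 2 * conj s / (1 - s * conj s) - 6 * conj s / (1 - s * conj s) ^ 2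
      + 6 * conj s / (1 - s * conj s) ^ 3)
    (fun s => √3 * conj s ^ 2 / (1 - s * conj s) ^ 2 - 2 * √3 * conj s ^ 2 / (1 - s * conj s) ^ 3)
    (fun s => 2 * conj s ^ 3 / (1 - s * conj s) ^ 3)
    (fun s => 4 / (1 - s * conj s) - 9 / (1 - s * conj s) ^ 2 + 6 / (1 - s * conj s) ^ 3)
    (fun s => 2 * √3 * s / (1 - s * conj s) ^ 2 - 2 * √3 * s / (1 - s * conj s) ^ 3)
    (fun s => -3 / (1 - s * conj s) ^ 2 + 2 / (1 - s * conj s) ^ 3) ?_ ?_ ?_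
  · intro s hs z₁ z₂
    apply ofReal_injective
    rw [QIII]
    simp only [ofReal_add, ofReal_mul, ofReal_div, ofReal_sub, ofReal_pow, ofReal_one, ofReal_ofNat,
      re_eq_add_conj, ← mul_conj', map_add, map_mul, map_div₀, map_sub, map_pow, map_one, map_ofNat,
      Complex.conj_conj, Complex.conj_ofReal, map_neg, Complex.conj_ofNat, ofReal_neg]
    generalize conj s = S at *
    rw [show S * s = s * S from mul_comm _ _]
    field_simp
    ring
  · intro s hs a₁ a₂
    simp only [modelIII, CRModel.z₁, CRModel.z₂, Matrix.cons_val, map_add, map_sub, map_mul, map_pow,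
      Complex.conj_conj, map_zero, map_neg, Complex.conj_ofReal, Complex.conj_ofNat]
    generalize conj s = S at *
    push_cast
    obtain ⟨n, hn⟩ : ∃ n, n = 1 - s * S := ⟨_, rfl⟩
    rw [← hn] at hs ⊢
    field_simp
    rw [hn]
    ring_nf
    simp only [sqrt_three_sq]
    ring
  · intro s hs a₁ a₂
    simp only [modelIII, CRModel.z₁, CRModel.z₂, Matrix.cons_val, map_add, map_sub, map_mul, map_pow,
      Complex.conj_conj, map_zero, map_neg, Complex.conj_ofReal, Complex.conj_ofNat, map_div₀, map_one]
    generalize conj s = S at *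
    rw [show S * s = s * S from mul_comm _ _]
    push_cast
    obtain ⟨n, hn⟩ : ∃ n, n = 1 - s * S := ⟨_, rfl⟩
    rw [← hn] at hs ⊢
    field_simp
    rw [hn]
    ring_nf
    simp only [sqrt_three_sq]
    ring

end

/-! ### The given equation of type I describes its model -/

section

open HolFun HolGerm

theorem sqrt_two_sq : ((√2 : ℝ) : ℂ) ^ 2 = 2 := by
  rw [← ofReal_pow, Real.sq_sqrt (by norm_num), ofReal_ofNat]

theorem norm_two_mul_add_one_sq (s : ℂ) :
    ((‖2 * s + 1‖ : ℝ) : ℂ) ^ 2 = (2 * s + 1) * (2 * conj s + 1) := by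
  rw [← mul_conj']
  simp [Complex.conj_ofNat]

theorem isGraph_modelI : modelI.IsGraph QI := by
  have hU : ∀ᶠ s : ℂ in 𝓝 0, 2 * s + 1 ≠ 0 :=
    ContinuousAt.eventually_ne (by fun_prop) (by simp)
  refine CRModel.IsGraph.of_coeff hU
    (fun s => (-(1 + I) * (conj s + conj s ^ 2) + 2 * (s * conj s) *
      ((I - 1) * (s * conj s) - 2 * conj s - 1 - I)) / ((2 * s + 1) * (2 * conj s + 1)))
    (fun s => (-√2 * I * conj s ^ 2 - 2 * (s * conj s) * √2 * I * (s * conj s + conj s)) /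
      ((2 * s + 1) * (2 * conj s + 1)))
    (fun s => ((1 - I) * (conj s + conj s ^ 2) + 2 * (s * conj s) *
      ((I + 1) * (s * conj s) + 2 * conj s + 1 - I)) / ((2 * s + 1) * (2 * conj s + 1)))
    (fun s => √2 * (s * conj s) * (2 * (s * conj s) + (1 - I) * s + (1 + I) * conj s) /
      ((2 * s + 1) * (2 * conj s + 1)))
    (fun s => 1 - 2 * (s * conj s) * ((1 + I) * (s * conj s) + I * (s + conj s) + I) /
      ((2 * s + 1) * (2 * conj s + 1)))
    (fun s => √2 * (s * conj s) * (2 * (s * conj s) + (1 + I) * s + (1 - I) * conj s) /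
      ((2 * s + 1) * (2 * conj s + 1))) ?_ ?_ ?_
  · intro s hs z₁ z₂
    have hs' : 2 * conj s + 1 ≠ 0 := fun h => hs (by
      simpa [Complex.conj_ofNat] using congrArg conj h)
    apply ofReal_injective
    rw [QI]
    simp only [ofReal_add, ofReal_mul, ofReal_div, ofReal_sub, ofReal_pow, ofReal_one, ofReal_ofNat,
      re_eq_add_conj, norm_two_mul_add_one_sq, map_add, map_mul, map_div₀, map_sub, map_pow, map_one,
      map_ofNat, Complex.conj_conj, map_neg, Complex.conj_ofNat, ofReal_neg, conj_I,
      Complex.conj_ofReal]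
    simp only [← mul_conj']
    generalize conj s = S at *
    generalize conj z₁ = Z₁
    generalize conj z₂ = Z₂
    obtain ⟨n, hn⟩ : ∃ n, n = 2 * s + 1 := ⟨_, rfl⟩
    obtain ⟨n', hn'⟩ : ∃ n, n = 2 * S + 1 := ⟨_, rfl⟩
    rw [← hn] at hs ⊢
    rw [← hn'] at hs' ⊢
    field_simp
    rw [hn, hn']
    ring
  · intro s hs a₁ a₂
    have hs' : 2 * conj s + 1 ≠ 0 := fun h => hs (by
      simpa [Complex.conj_ofNat] using congrArg conj h)
    simp only [modelI, CRModel.z₁, CRModel.z₂, Matrix.cons_val, map_add, map_sub, map_mul, map_pow,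
      Complex.conj_conj, map_zero, Complex.conj_ofReal, Complex.conj_ofNat, map_div₀, conj_I, map_one,
      ofReal_zero, ofReal_one, zero_mul, one_mul, zero_add]
    generalize conj s = S at *
    generalize conj a₁ = A₁
    generalize conj a₂ = A₂
    obtain ⟨n, hn⟩ : ∃ n, n = 2 * s + 1 := ⟨_, rfl⟩
    obtain ⟨n', hn'⟩ : ∃ n, n = 2 * S + 1 := ⟨_, rfl⟩
    rw [← hn] at hs ⊢
    rw [← hn'] at hs' ⊢
    field_simp
    rw [hn, hn']
    ring_nf
    simp only [sqrt_two_sq, I_sq, I_pow_three]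
    ring
  · intro s hs a₁ a₂
    have hs' : 2 * conj s + 1 ≠ 0 := fun h => hs (by
      simpa [Complex.conj_ofNat] using congrArg conj h)
    simp only [modelI, CRModel.z₁, CRModel.z₂, Matrix.cons_val, map_add, map_sub, map_mul, map_pow,
      Complex.conj_conj, map_zero, Complex.conj_ofReal, Complex.conj_ofNat, map_div₀, conj_I, map_one,
      ofReal_zero, ofReal_one, zero_mul, one_mul, add_zero]
    generalize conj s = S at *
    generalize conj a₁ = A₁
    generalize conj a₂ = A₂
    obtain ⟨n, hn⟩ : ∃ n, n = 2 * s + 1 := ⟨_, rfl⟩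
    obtain ⟨n', hn'⟩ : ∃ n, n = 2 * S + 1 := ⟨_, rfl⟩
    rw [← hn] at hs ⊢
    rw [← hn'] at hs' ⊢
    rw [mul_comm n' n]
    field_simp
    rw [hn, hn']
    ring_nf
    simp only [sqrt_two_sq, I_sq, I_pow_three]
    ring

end

/-! ### The symmetries of degree 0 -/

section

open HolFun HolGerm

theorem re_eq_zero_of_add_conj {z : ℂ} (h : z + conj z = 0) : z.re = 0 := by
  have := congrArg Complex.re h
  simp at this
  linarith

theorem modelIII_deriv (s : ℂ) : deriv (modelIII.b 0 0) s = 2 ∧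
    deriv (modelIII.b 0 1) s = -(2 * √3 * s) ∧ deriv (modelIII.b 1 0) s = 2 * √3 * s ∧
    deriv (modelIII.b 1 1) s = -(6 * s ^ 2) := by
  simp only [modelIII, Matrix.cons_val]
  refine ⟨?_, ?_, ?_, ?_⟩
  · exact ((hasDerivAt_id s).const_mul 2).deriv.trans (by ring)
  · exact (((hasDerivAt_pow 2 s).const_mul (√3 : ℂ)).neg).deriv.trans (by norm_num; ring)
  · exact ((hasDerivAt_pow 2 s).const_mul (√3 : ℂ)).deriv.trans (by norm_num; ring)
  · exact (((hasDerivAt_pow 3 s).const_mul (2 : ℂ)).neg).deriv.trans (by norm_num; ring)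

theorem analyticAt_fieldIIIZero (c₁ c₂ : ℂ) : AnalyticAt ℂ (fieldIIIZero c₁ c₂) 0 := by
  refine analyticAt_pi_iff.2 fun i => ?_
  fin_cases i <;> simp only [fieldIIIZero, Fin.zero_eta, Fin.mk_one, Fin.reduceFinMk, Matrix.cons_val] <;>
    repeat first
      | exact analyticAt_const
      | exact analyticAt_coord _ _
      | refine AnalyticAt.fun_add ?_ ?_
      | refine AnalyticAt.fun_sub ?_ ?_
      | refine AnalyticAt.fun_mul ?_ ?_
      | refine AnalyticAt.fun_pow ?_ _

/-- On the parametrization θ of the field does not depend on ζ: it keeps its value at ζ = 0, which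
is minus its own conjugate. The proofs for the other two types follow the same pattern. -/
theorem fieldIIIZero_mem (c₁ c₂ : ℂ) :
    of (fieldIIIZero c₁ c₂) (analyticAt_fieldIIIZero c₁ c₂) ∈ infSym (graphFun QIII) := by
  refine isGraph_modelIII.mem_infSym _ (Eventually.of_forall fun s β a₁ a₂ => ?_)
  obtain ⟨d1, d2, d3, d4⟩ := modelIII_deriv s
  have h : modelIII.theta (conj a₁) (conj a₂) s (fieldIIIZero c₁ c₂
      (modelIII.pt (I * β) a₁ a₂ (conj a₁) (conj a₂) s)) =
      2 * c₂.re * (I * β + a₁ * conj a₁ - a₂ * conj a₂) + 2 * conj c₁ * a₁ ^ 2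
      - 2 * conj a₁ * (c₂ * a₁ + √3 * conj c₁ * a₂)
      + 2 * conj a₂ * (√3 * c₁ * a₁ + (c₂ + 2 * I * c₂.im) * a₂) - 2 * conj a₁ ^ 2 * c₁ := by
    simp only [CRModel.theta, CRModel.tau, d1, d2, d3, d4]
    simp only [fieldIIIZero, CRModel.pt, CRModel.K,
      CRModel.z₁, CRModel.z₂, modelIII, Matrix.cons_val]
    generalize conj a₁ = A₁
    generalize conj a₂ = A₂
    obtain ⟨x, y⟩ := c₂
    simp only [Complex.mk_eq_add_mul_I]
    push_cast
    ring_nf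
    simp only [sqrt_three_sq]
    ring
  rw [h]
  apply re_eq_zero_of_add_conj
  obtain ⟨x, y⟩ := c₂
  simp only [Complex.mk_eq_add_mul_I, map_add, map_sub, map_mul, map_pow, Complex.conj_conj,
    Complex.conj_ofReal, Complex.conj_ofNat, conj_I]
  ring

theorem modelII_deriv (s : ℂ) : deriv (modelII.b 0 0) s = 1 ∧
    deriv (modelII.b 0 1) s = 1 + 2 * s ∧ deriv (modelII.b 1 0) s = 0 ∧
    deriv (modelII.b 1 1) s = 1 := by
  simp only [modelII, Matrix.cons_val]
  refine ⟨?_, ?_, ?_, ?_⟩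
  · exact (hasDerivAt_id s).deriv
  · exact ((hasDerivAt_id s).add (hasDerivAt_pow 2 s)).deriv.trans (by norm_num)
  · exact deriv_const _ _
  · exact (hasDerivAt_id s).deriv

theorem analyticAt_fieldIIZero (c : ℝ) (d : ℂ) : AnalyticAt ℂ (fieldIIZero c d) 0 := by
  refine analyticAt_pi_iff.2 fun i => ?_
  fin_cases i <;> simp only [fieldIIZero, Fin.zero_eta, Fin.mk_one, Fin.reduceFinMk, Matrix.cons_val] <;>
    repeat first
      | exact analyticAt_const
      | exact analyticAt_coord _ _
      | refine AnalyticAt.fun_add ?_ ?_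
      | refine AnalyticAt.fun_sub ?_ ?_
      | refine AnalyticAt.fun_mul ?_ ?_
      | refine AnalyticAt.fun_pow ?_ _

theorem fieldIIZero_mem (c : ℝ) (d : ℂ) :
    of (fieldIIZero c d) (analyticAt_fieldIIZero c d) ∈ infSym (graphFun QII) := by
  refine isGraph_modelII.mem_infSym _ (Eventually.of_forall fun s β a₁ a₂ => ?_)
  obtain ⟨d1, d2, d3, d4⟩ := modelII_deriv s
  have h : modelII.theta (conj a₁) (conj a₂) s (fieldIIZero c d
      (modelII.pt (I * β) a₁ a₂ (conj a₁) (conj a₂) s)) =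
      2 * c * (I * β + conj a₁ * a₂ + conj a₂ * a₁) + 2 * conj d * (a₂ ^ 2 + 2 * a₁ * a₂)
      - 2 * (conj a₁ * (c * a₂ - 2 * conj d * a₂)
        + conj a₂ * (c * a₁ + d * (a₂ + 2 * a₁) - conj d * a₂))
      - 2 * d * (2 * conj a₁ * conj a₂ + conj a₂ ^ 2) := by
    simp only [CRModel.theta, CRModel.tau, d1, d2, d3, d4]
    simp only [fieldIIZero, CRModel.pt, CRModel.K,
      CRModel.z₁, CRModel.z₂, modelII, Matrix.cons_val]
    push_cast
    ring
  rw [h]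
  apply re_eq_zero_of_add_conj
  simp only [map_add, map_sub, map_mul, map_pow, Complex.conj_conj, Complex.conj_ofReal,
    Complex.conj_ofNat, conj_I]
  ring

theorem modelI_deriv {s : ℂ} (hs : 2 * s + 1 ≠ 0) :
    deriv (modelI.b 0 0) s = √2 * I * (2 * s ^ 2 + 2 * s) / (2 * s + 1) ^ 2 ∧
    deriv (modelI.b 0 1) s = (1 + I) * (2 * s ^ 2 + 2 * s + 1) / (2 * s + 1) ^ 2 ∧
    deriv (modelI.b 1 0) s = (I - 1) * (2 * s ^ 2 + 2 * s + 1) / (2 * s + 1) ^ 2 ∧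
    deriv (modelI.b 1 1) s = √2 * I * (2 * s ^ 2 + 2 * s) / (2 * s + 1) ^ 2 := by
  have h : HasDerivAt (fun s : ℂ => 2 * s + 1) 2 s := by
    simpa using ((hasDerivAt_id s).const_mul 2).add_const 1
  have h1 : HasDerivAt (fun s : ℂ => √2 * I * s ^ 2 / (2 * s + 1))
      (√2 * I * (2 * s ^ 2 + 2 * s) / (2 * s + 1) ^ 2) s :=
    (((hasDerivAt_pow 2 s).const_mul (√2 * I)).div h hs).congr_deriv (by norm_num; ring)
  have h2 : ∀ k : ℂ, HasDerivAt (fun s : ℂ => k * (s + 1) * s / (2 * s + 1))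
      (k * (2 * s ^ 2 + 2 * s + 1) / (2 * s + 1) ^ 2) s := fun k =>
    (((((hasDerivAt_id s).add_const 1).const_mul k).mul (hasDerivAt_id s)).div h hs).congr_deriv
      (by simp; ring)
  exact ⟨h1.deriv, (h2 _).deriv, (h2 _).deriv, h1.deriv⟩

theorem analyticAt_fieldIZero (c : ℝ) (d : ℂ) : AnalyticAt ℂ (fieldIZero c d) 0 := by
  have hd : AnalyticAt ℂ (fun p : C4 => (2 * p 3 + 1)⁻¹) 0 :=
    ((analyticAt_const.mul (analyticAt_coord 3 0)).add analyticAt_const).inv (by simp)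
  refine analyticAt_pi_iff.2 fun i => ?_
  fin_cases i <;> simp only [fieldIZero, Fin.zero_eta, Fin.mk_one, Fin.reduceFinMk, Matrix.cons_val,
    div_eq_mul_inv] <;>
    repeat first
      | exact analyticAt_const
      | exact hd
      | exact analyticAt_coord _ _
      | refine AnalyticAt.fun_add ?_ ?_
      | refine AnalyticAt.fun_sub ?_ ?_
      | refine AnalyticAt.fun_mul ?_ ?_
      | refine AnalyticAt.fun_pow ?_ _

theorem exp_pi_div_four : exp (I * Real.pi / 4) = (1 + I) / √2 ∧
    exp (-(I * Real.pi / 4)) = (1 - I) / √2 := by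
  have h0 : (√2 : ℂ) / 2 = 1 / √2 := by
    rw [div_eq_div_iff two_ne_zero sqrt_two_ne_zero, sqrt_two_mul_self, one_mul]
  have h1 : exp (I * Real.pi / 4) = (1 + I) / √2 := by
    rw [show I * (Real.pi : ℂ) / 4 = ((Real.pi / 4 : ℝ) : ℂ) * I by push_cast; ring, exp_mul_I,
      ← ofReal_cos, ← ofReal_sin, Real.cos_pi_div_four, Real.sin_pi_div_four]
    push_cast
    rw [h0]
    ring
  refine ⟨h1, ?_⟩
  have h2 := congrArg conj h1
  rw [← exp_conj] at h2
  simpa [Complex.conj_ofNat, neg_div, sub_eq_add_neg] using h2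

theorem fieldIZero_mem (c : ℝ) (d : ℂ) :
    of (fieldIZero c d) (analyticAt_fieldIZero c d) ∈ infSym (graphFun QI) := by
  have hU : ∀ᶠ s : ℂ in 𝓝 0, 2 * s + 1 ≠ 0 :=
    ContinuousAt.eventually_ne (by fun_prop) (by simp)
  refine isGraph_modelI.mem_infSym _ (hU.mono fun s hs β a₁ a₂ => ?_)
  obtain ⟨d1, d2, d3, d4⟩ := modelI_deriv hs
  have h : modelI.theta (conj a₁) (conj a₂) s (fieldIZero c d
      (modelI.pt (I * β) a₁ a₂ (conj a₁) (conj a₂) s)) =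
      2 * c * (I * β) + conj d * (-(1 + I) * a₁ ^ 2 + (1 - I) * a₂ ^ 2)
      - 2 * (conj a₁ * (d * ((1 + I) / √2) * a₁ - conj d * ((1 - I) / √2) * a₁)
        + conj a₂ * (d * ((1 - I) / √2) * a₂ - conj d * ((1 + I) / √2) * a₂))
      - d * (conj a₁ ^ 2 * (I - 1) + conj a₂ ^ 2 * (1 + I)) := by
    simp only [CRModel.theta, CRModel.tau, d1, d2, d3, d4]
    simp only [fieldIZero, CRModel.pt, CRModel.K,
      CRModel.z₁, CRModel.z₂, modelI, Matrix.cons_val, exp_pi_div_four]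
    generalize conj a₁ = A₁
    generalize conj a₂ = A₂
    generalize conj d = D
    have hR := sqrt_two_ne_zero
    obtain ⟨n, hn⟩ : ∃ n, n = 2 * s + 1 := ⟨_, rfl⟩
    rw [← hn] at hs ⊢
    push_cast
    field_simp
    rw [hn]
    ring_nf
    have h3 : (√2 : ℂ) ^ 3 = 2 * √2 := by rw [pow_succ, sqrt_two_sq]
    have h4 : (√2 : ℂ) ^ 4 = 4 := by
      rw [show (4 : ℕ) = 2 * 2 from rfl, pow_mul, sqrt_two_sq]
      norm_num
    simp only [sqrt_two_sq, h3, h4, I_sq, I_pow_three, I_pow_four]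
    ring_nf
  rw [h]
  apply re_eq_zero_of_add_conj
  simp only [map_add, map_sub, map_mul, map_pow, Complex.conj_conj, Complex.conj_ofReal, map_div₀,
    Complex.conj_ofNat, conj_I, map_neg, map_one]
  ring

end

section

/-! ### The grading -/

namespace HolGerm

/-- The real linear map to germs of vector fields given by a family depending linearly on
parameters. -/
def ofLinear {W : Type*} [AddCommGroup W] [Module ℝ W] (F : W → C4 → C4)
    (hF : ∀ w, AnalyticAt ℂ (F w) 0) (hadd : ∀ v w, F (v + w) = F v + F w)
    (hsmul : ∀ (t : ℝ) w, F (t • w) = (t : ℂ) • F w) : W →ₗ[ℝ] HolGerm where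
  toFun w := of (F w) (hF w)
  map_add' v w := by
    rw [of_add_of]
    exact of_eq_of (Eventually.of_forall fun p => by rw [hadd])
  map_smul' t w := by
    rw [RingHom.id_apply, smul_of]
    exact of_eq_of (Eventually.of_forall fun p => by rw [hsmul])

/-- The weights of the coordinates. -/
def weight : Fin 4 → ℕ := ![2, 1, 1, 0]

/-- The weighted dilations. -/
def dil (t : ℂ) (p : C4) : C4 := fun i => t ^ weight i * p i

/-- The weighted Euler field as a linear map. -/
def eulerCLM : C4 →L[ℂ] C4 :=
  ContinuousLinearMap.pi fun i => (weight i : ℂ) • ContinuousLinearMap.proj (R := ℂ) i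

/-- The weighted Euler field. -/
def euler : HolGerm := of eulerCLM (eulerCLM.analyticAt 0)

/-- Euler's identity: the weighted homogeneity of V is differentiated at t = 1, which gives DV(E) -
E(V) = -nV for the Euler field E. -/
theorem lie_euler {V : C4 → C4} (hV : AnalyticAt ℂ V 0) (n : ℕ)
    (h : ∀ t p i, t ^ n * V (dil t p) i = t ^ weight i * V p i) :
    ⁅euler, of V hV⁆ = -(n : ℝ) • of V hV := by
  rw [euler, of_lie_of, smul_of]
  refine of_eq_of ?_
  filter_upwards [hV.eventually_analyticAt] with p hp
  have h1 : HasDerivAt (fun t : ℂ => dil t p) (eulerCLM p) 1 := by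
    rw [hasDerivAt_pi]
    intro i
    exact ((hasDerivAt_pow (weight i) (1 : ℂ)).mul_const (p i)).congr_deriv (by simp [eulerCLM])
  have hp1 : dil 1 p = p := by
    funext i
    simp [dil]
  have h2 : HasDerivAt (fun t : ℂ => V (dil t p)) (fderiv ℂ V p (eulerCLM p)) 1 :=
    HasFDerivAt.comp_hasDerivAt (f := fun t : ℂ => dil t p) 1
      (by rw [hp1]; exact hp.differentiableAt.hasFDerivAt) h1
  funext i
  have h3 := (hasDerivAt_pow n (1 : ℂ)).mul (hasDerivAt_pi.1 h2 i)
  have h4 := ((hasDerivAt_pow (weight i) (1 : ℂ)).mul_const (V p i)).congr_of_eventuallyEq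
    (f₁ := fun t : ℂ => t ^ n * V (dil t p) i) (Eventually.of_forall fun t => h t p i)
  have h5 := h3.unique h4
  simp only [one_pow, mul_one, one_mul, hp1] at h5
  rw [VectorField.lieBracket, ContinuousLinearMap.fderiv]
  simp only [Pi.sub_apply, Pi.smul_apply, smul_eq_mul, eulerCLM, ContinuousLinearMap.coe_pi',
    _root_.smul_apply, ContinuousLinearMap.proj_apply] at h5 ⊢
  push_cast
  linear_combination h5

/-- The values at `0` of the coefficients. -/
def evL (i : Fin 4) : HolGerm →ₗ[ℝ] ℂ where
  toFun X := HolFun.ev (comp i X)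
  map_add' X Y := by rw [comp_add, map_add]
  map_smul' t X := by simp [comp_smul]

/-- The values at `0` of the partial derivatives of the coefficients. -/
def dL (j i : Fin 4) : HolGerm →ₗ[ℝ] ℂ where
  toFun X := HolFun.ev (HolFun.d j (comp i X))
  map_add' X Y := by rw [comp_add, HolFun.d_add, map_add]
  map_smul' t X := by simp [comp_smul, HolFun.d_mul]

end HolGerm

open HolGerm

/-- A Lie algebra of germs of vector fields parametrised linearly by elements of weights
`-2, -1, 0` is graded. -/
theorem exists_grading {h : Submodule ℝ HolGerm} (hlie : ∀ X ∈ h, ∀ Y ∈ h, ⁅X, Y⁆ ∈ h)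
    {W : Type*} [AddCommGroup W] [Module ℝ W] [Module.Finite ℝ W]
    (N₂ : ℝ →ₗ[ℝ] HolGerm) (N₁ : ℂ × ℂ →ₗ[ℝ] HolGerm) (N₀ : W →ₗ[ℝ] HolGerm)
    (m₂ : ∀ x, N₂ x ∈ h) (m₁ : ∀ x, N₁ x ∈ h) (m₀ : ∀ x, N₀ x ∈ h)
    (e₂ : ∀ x, ⁅euler, N₂ x⁆ = (-2 : ℝ) • N₂ x) (e₁ : ∀ x, ⁅euler, N₁ x⁆ = (-1 : ℝ) • N₁ x)
    (e₀ : ∀ x, ⁅euler, N₀ x⁆ = 0) (J : HolGerm →ₗ[ℝ] ℝ × (ℂ × ℂ) × W)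
    (hJ : ∀ b a w, J (N₂ b + N₁ a + N₀ w) = (b, a, w)) (hJ0 : ∀ X ∈ h, J X = 0 → X = 0) :
    ∃ (L : LieSubalgebra ℝ HolGerm) (a : ℤ → Submodule ℝ HolGerm),
      L.toSubmodule = h ∧ Module.finrank ℝ L = 5 + Module.finrank ℝ W ∧ IsGradedBy h a ∧
      (∀ X, X ∈ a (-2) ↔ ∃ b, X = N₂ b) ∧ (∀ X, X ∈ a (-1) ↔ ∃ a, X = N₁ a) ∧
      (∀ X, X ∈ a 0 ↔ ∃ w, X = N₀ w) ∧ ∀ X ∈ h, ∃ b a w, X = N₂ b + N₁ a + N₀ w := by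
  let T : ℝ × (ℂ × ℂ) × W →ₗ[ℝ] HolGerm := N₂.coprod (N₁.coprod N₀)
  have hT : ∀ b a w, T (b, a, w) = N₂ b + N₁ a + N₀ w := fun b a w => by
    simp [T, add_assoc]
  have hJT : ∀ v, J (T v) = v := fun ⟨b, a, w⟩ => by rw [hT, hJ]
  have hTm : ∀ v, T v ∈ h := fun ⟨b, a, w⟩ => by
    rw [hT]
    exact add_mem (add_mem (m₂ b) (m₁ a)) (m₀ w)
  -- The jet map J inverts T on its image and is injective on h, so the explicit fields exhaust h.
  have hTJ : ∀ X ∈ h, X = T (J X) := fun X hX => by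
    have := hJ0 (X - T (J X)) (sub_mem hX (hTm _)) (by rw [map_sub, hJT, sub_self])
    exact sub_eq_zero.1 this
  have hT_inj : Function.Injective T := Function.LeftInverse.injective hJT
  have hE : ∀ b a w, ⁅euler, T (b, a, w)⁆ = T (-2 * b, -a, 0) := fun b a w => by
    rw [hT, hT, lie_add, lie_add, e₂, e₁, e₀, map_neg, map_zero, ← smul_eq_mul, map_smul,
      neg_one_smul]
  let L : LieSubalgebra ℝ HolGerm := { h with lie_mem' := fun {x y} hx hy => hlie x hx y hy }
  have hL : L.toSubmodule = h := rfl
  -- With the degrees defined as eigenspaces of ad of the Euler field, independence is that of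
  -- eigenspaces and compatibility with the bracket is the Jacobi identity.
  let a : ℤ → Submodule ℝ HolGerm := fun k =>
    h ⊓ (LieAlgebra.ad ℝ HolGerm euler).eigenspace (k : ℝ)
  have ha : ∀ k X, X ∈ a k ↔ X ∈ h ∧ ⁅euler, X⁆ = (k : ℝ) • X := fun k X => by
    rw [Submodule.mem_inf, Module.End.mem_eigenspace_iff, LieAlgebra.ad_apply]
  have ha' : ∀ k b x w, T (b, x, w) ∈ a k ↔
      (k + 2 : ℝ) * b = 0 ∧ (k + 1 : ℝ) • x = 0 ∧ (k : ℝ) • w = 0 := fun k b x w => by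
    rw [ha, hE, ← map_smul, hT_inj.eq_iff]
    simp only [Prod.smul_mk, Prod.mk.injEq, smul_eq_mul]
    refine (and_iff_right (hTm _)).trans (and_congr ?_ (and_congr ?_ eq_comm))
    · constructor <;> intro h <;> linarith
    · rw [add_smul, one_smul, add_eq_zero_iff_eq_neg, eq_comm]
  have ha'' : ∀ k X, X ∈ a k → ∃ b x w, X = T (b, x, w) ∧
      (k + 2 : ℝ) * b = 0 ∧ (k + 1 : ℝ) • x = 0 ∧ (k : ℝ) • w = 0 := fun k X hX => by
    have h1 := hTJ X ((ha k X).1 hX).1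
    rw [h1] at hX
    exact ⟨_, _, _, h1, (ha' _ _ _ _).1 hX⟩
  have h₂ : ∀ X, X ∈ a (-2) ↔ ∃ b, X = N₂ b := fun X => by
    constructor
    · intro hX
      obtain ⟨b, x, w, rfl, -, h2, h3⟩ := ha'' _ _ hX
      rw [smul_eq_zero_iff_right (by norm_num)] at h2 h3
      exact ⟨b, by rw [hT, h2, h3, map_zero, map_zero, add_zero, add_zero]⟩
    · rintro ⟨b, rfl⟩
      have := (ha' (-2) b 0 0).2 (by simp)
      rwa [hT, map_zero, map_zero, add_zero, add_zero] at this
  have h₁ : ∀ X, X ∈ a (-1) ↔ ∃ x, X = N₁ x := fun X => by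
    constructor
    · intro hX
      obtain ⟨b, x, w, rfl, h1, -, h3⟩ := ha'' _ _ hX
      rw [smul_eq_zero_iff_right (by norm_num)] at h3
      have h1 : b = 0 := by norm_num at h1; exact h1
      exact ⟨x, by rw [hT, h1, h3, map_zero, map_zero, zero_add, add_zero]⟩
    · rintro ⟨b, rfl⟩
      have := (ha' (-1) 0 b 0).2 (by simp)
      rwa [hT, map_zero, map_zero, zero_add, add_zero] at this
  have h₀ : ∀ X, X ∈ a 0 ↔ ∃ w, X = N₀ w := fun X => by
    constructor
    · intro hX
      obtain ⟨b, x, w, rfl, h1, h2, -⟩ := ha'' _ _ hX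
      rw [smul_eq_zero_iff_right (by norm_num)] at h2
      have h1 : b = 0 := by norm_num at h1; exact h1
      exact ⟨w, by rw [hT, h1, h2, map_zero, map_zero, zero_add, zero_add]⟩
    · rintro ⟨b, rfl⟩
      have := (ha' 0 0 0 b).2 (by simp)
      rwa [hT, map_zero, map_zero, zero_add, zero_add] at this
  refine ⟨L, a, hL, ?_, ⟨?_, ?_, ?_, ?_⟩, h₂, h₁, h₀, fun X hX => ?_⟩
  · let e : (ℝ × (ℂ × ℂ) × W) ≃ₗ[ℝ] L.toSubmodule := LinearEquiv.ofBijective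
      (T.codRestrict L.toSubmodule hTm) ⟨fun x y hxy => hT_inj (congrArg Subtype.val hxy),
        fun X => ⟨J X, Subtype.ext (hTJ X X.2).symm⟩⟩
    have := e.finrank_eq
    rw [Module.finrank_prod, Module.finrank_prod, Module.finrank_prod, Module.finrank_self,
      Complex.finrank_real_complex] at this
    exact this.symm.trans (by ring)
  · exact ((Module.End.eigenspaces_iSupIndep (LieAlgebra.ad ℝ HolGerm euler)).comp
      Int.cast_injective).mono fun k => inf_le_right
  · refine le_antisymm (iSup_le fun k => inf_le_left) fun X hX => ?_
    rw [hTJ X hX]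
    obtain ⟨b, x, w⟩ := J X
    rw [hT]
    exact add_mem (add_mem (Submodule.mem_iSup_of_mem (-2) ((h₂ _).2 ⟨b, rfl⟩))
      (Submodule.mem_iSup_of_mem (-1) ((h₁ _).2 ⟨x, rfl⟩)))
      (Submodule.mem_iSup_of_mem 0 ((h₀ _).2 ⟨w, rfl⟩))
  · intro i j X hX Y hY
    rw [ha] at hX hY ⊢
    refine ⟨hlie _ hX.1 _ hY.1, ?_⟩
    rw [leibniz_lie, hX.2, hY.2, smul_lie, lie_smul, ← add_smul]
    push_cast
    rfl
  · intro k k2 k1 k0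
    refine (Submodule.eq_bot_iff _).2 fun X hX => ?_
    obtain ⟨b, x, w, rfl, h1, h2, h3⟩ := ha'' _ _ hX
    have c2 : (k + 2 : ℝ) ≠ 0 := fun h => k2 (by
      have : ((k + 2 : ℤ) : ℝ) = 0 := by push_cast; exact h
      have := Int.cast_eq_zero.1 this
      omega)
    have c1 : (k + 1 : ℝ) ≠ 0 := fun h => k1 (by
      have : ((k + 1 : ℤ) : ℝ) = 0 := by push_cast; exact h
      have := Int.cast_eq_zero.1 this
      omega)
    rw [smul_eq_zero_iff_right c1] at h2
    rw [smul_eq_zero_iff_right (Int.cast_ne_zero.2 k0)] at h3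
    rw [(mul_eq_zero.1 h1).resolve_left c2, h2, h3]
    exact map_zero T
  · exact ⟨(J X).1, (J X).2.1, (J X).2.2, (hTJ X hX).trans (hT _ _ _)⟩

end

/-! ### Jets of the explicit symmetries, and the gradings of the three models -/

section

open HolFun HolGerm

namespace HolGerm

theorem dL_of {V : C4 → C4} (hV : AnalyticAt ℂ V 0) {i j : Fin 4} {c : ℂ}
    (h : HasDerivAt (fun t : ℂ => V (t • (Pi.single j 1 : C4)) i) c 0) :
    dL j i (of V hV) = c := by
  have h1 : HasDerivAt (fun t : ℂ => t • (Pi.single j 1 : C4)) (Pi.single j 1) 0 := by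
    simpa using (hasDerivAt_id (0 : ℂ)).smul_const (Pi.single j 1 : C4)
  have h2 : HasDerivAt (fun t : ℂ => V (t • (Pi.single j 1 : C4)) i)
      (fderiv ℂ (fun p => V p i) 0 (Pi.single j 1)) 0 :=
    HasFDerivAt.comp_hasDerivAt (f := fun t : ℂ => t • (Pi.single j 1 : C4)) (0 : ℂ)
      (l := fun p => V p i)
      (by rw [zero_smul]; exact (analyticAt_apply hV i).differentiableAt.hasFDerivAt) h1
  exact h2.unique h

theorem evL_of {V : C4 → C4} (hV : AnalyticAt ℂ V 0) (i : Fin 4) :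
    evL i (of V hV) = V 0 i := rfl

end HolGerm

theorem analyticAt_fieldNegTwo (b : ℝ) : AnalyticAt ℂ (fieldNegTwo b) 0 := analyticAt_const

/-- The symmetries of weight `-2`. -/
def negTwoL : ℝ →ₗ[ℝ] HolGerm :=
  ofLinear fieldNegTwo analyticAt_fieldNegTwo
    (fun v w => by
      funext p i
      fin_cases i <;> simp [fieldNegTwo]
      ring)
    (fun t w => by
      funext p i
      fin_cases i <;> simp [fieldNegTwo]
      ring)

theorem lie_negTwoL (b : ℝ) : ⁅euler, negTwoL b⁆ = (-2 : ℝ) • negTwoL b := by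
  refine lie_euler (analyticAt_fieldNegTwo b) 2 fun t p i => ?_
  fin_cases i <;> simp [fieldNegTwo, weight]

theorem CRModel.IsGraph.negTwoL_mem {M : CRModel} {Q : ℂ → ℂ → ℂ → ℝ} (hQ : M.IsGraph Q) (b : ℝ) :
    negTwoL b ∈ infSym (graphFun Q) :=
  hQ.mem_infSym (analyticAt_fieldNegTwo b) (Eventually.of_forall fun s β a₁ a₂ => by
    simp [fieldNegTwo, CRModel.theta, CRModel.K])

/-- The symmetries of weight `-1`. -/
def CRModel.translationL (M : CRModel) : ℂ × ℂ →ₗ[ℝ] HolGerm :=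
  ofLinear (fun a => M.translation a.1 a.2) (fun _ => M.analyticAt_translation _ _)
    (fun v w => by
      funext p i
      fin_cases i <;> simp [CRModel.translation, CRModel.K, CRModel.z₁, CRModel.z₂] <;> ring)
    (fun t w => by
      funext p i
      fin_cases i <;> simp [CRModel.translation, CRModel.K, CRModel.z₁, CRModel.z₂] <;> ring)

theorem CRModel.lie_translationL (M : CRModel) (a : ℂ × ℂ) :
    ⁅euler, M.translationL a⁆ = (-1 : ℝ) • M.translationL a := by
  refine (lie_euler (M.analyticAt_translation a.1 a.2) 1 fun t p i => ?_).trans ?_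
  · fin_cases i <;>
      simp [weight, dil, CRModel.translation, CRModel.K, CRModel.z₁, CRModel.z₂] <;> ring
  · rw [Nat.cast_one]
    rfl

/-- The symmetries of weight `0` of the type I model. -/
def zeroLI : ℝ × ℂ →ₗ[ℝ] HolGerm :=
  ofLinear (fun v => fieldIZero v.1 v.2) (fun _ => analyticAt_fieldIZero _ _)
    (fun v w => by
      funext p i
      fin_cases i <;> simp [fieldIZero] <;> ring)
    (fun t w => by
      funext p i
      fin_cases i <;> simp [fieldIZero] <;> ring)

/-- The symmetries of weight `0` of the type II model. -/
def zeroLII : ℝ × ℂ →ₗ[ℝ] HolGerm :=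
  ofLinear (fun v => fieldIIZero v.1 v.2) (fun _ => analyticAt_fieldIIZero _ _)
    (fun v w => by
      funext p i
      fin_cases i <;> simp [fieldIIZero] <;> ring)
    (fun t w => by
      funext p i
      fin_cases i <;> simp [fieldIIZero] <;> ring)

/-- The symmetries of weight `0` of the type III model. -/
def zeroLIII : ℂ × ℂ →ₗ[ℝ] HolGerm :=
  ofLinear (fun v => fieldIIIZero v.1 v.2) (fun _ => analyticAt_fieldIIIZero _ _)
    (fun v w => by
      funext p i
      fin_cases i <;> simp [fieldIIIZero] <;> ring)
    (fun t w => by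
      funext p i
      fin_cases i <;> simp [fieldIIIZero] <;> ring)

theorem lie_zeroLI (v : ℝ × ℂ) : ⁅euler, zeroLI v⁆ = 0 := by
  refine (lie_euler (analyticAt_fieldIZero v.1 v.2) 0 fun t p i => ?_).trans (by rw [Nat.cast_zero, neg_zero, zero_smul])
  fin_cases i <;> simp [weight, dil, fieldIZero] <;> ring

theorem lie_zeroLII (v : ℝ × ℂ) : ⁅euler, zeroLII v⁆ = 0 := by
  refine (lie_euler (analyticAt_fieldIIZero v.1 v.2) 0 fun t p i => ?_).trans (by rw [Nat.cast_zero, neg_zero, zero_smul])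
  fin_cases i <;> simp [weight, dil, fieldIIZero] <;> ring

theorem lie_zeroLIII (v : ℂ × ℂ) : ⁅euler, zeroLIII v⁆ = 0 := by
  refine (lie_euler (analyticAt_fieldIIIZero v.1 v.2) 0 fun t p i => ?_).trans (by rw [Nat.cast_zero, neg_zero, zero_smul])
  fin_cases i <;> simp [weight, dil, fieldIIIZero] <;> ring

/-- The initial values that determine a symmetry of the type I model. -/
def jetI : HolGerm →ₗ[ℝ] ℝ × (ℂ × ℂ) × (ℝ × ℂ) :=
  ((2⁻¹ : ℝ) • imLm ∘ₗ evL 0).prod (((evL 1).prod (evL 2)).prod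
    (((2⁻¹ : ℝ) • reLm ∘ₗ dL 0 0).prod (evL 3)))

/-- The initial values that determine a symmetry of the type II model. -/
def jetII : HolGerm →ₗ[ℝ] ℝ × (ℂ × ℂ) × (ℝ × ℂ) :=
  ((2⁻¹ : ℝ) • imLm ∘ₗ evL 0).prod (((evL 1).prod (evL 2)).prod
    (((2⁻¹ : ℝ) • reLm ∘ₗ dL 0 0).prod ((2⁻¹ : ℝ) • evL 3)))

/-- The initial values that determine a symmetry of the type III model. -/
def jetIII : HolGerm →ₗ[ℝ] ℝ × (ℂ × ℂ) × (ℂ × ℂ) :=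
  ((2⁻¹ : ℝ) • imLm ∘ₗ evL 0).prod (((evL 1).prod (evL 2)).prod
    ((evL 3).prod ((2⁻¹ : ℝ) • (ofRealCLM.toLinearMap ∘ₗ reLm ∘ₗ dL 0 0
      + (LinearMap.mulLeft ℝ I) ∘ₗ ofRealCLM.toLinearMap ∘ₗ imLm ∘ₗ dL 3 3))))

theorem evL_negTwoL (b : ℝ) : evL 0 (negTwoL b) = 2 * b * I ∧ evL 1 (negTwoL b) = 0 ∧
    evL 2 (negTwoL b) = 0 ∧ evL 3 (negTwoL b) = 0 ∧ dL 0 0 (negTwoL b) = 0 ∧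
    dL 3 3 (negTwoL b) = 0 :=
  ⟨rfl, rfl, rfl, rfl, dL_of (analyticAt_fieldNegTwo b) (hasDerivAt_const _ _), dL_of (analyticAt_fieldNegTwo b) (hasDerivAt_const _ _)⟩

theorem CRModel.evL_translationL (M : CRModel) (a : ℂ × ℂ) : evL 0 (M.translationL a) = 0 ∧
    evL 1 (M.translationL a) = a.1 ∧ evL 2 (M.translationL a) = a.2 ∧
    evL 3 (M.translationL a) = 0 ∧ dL 0 0 (M.translationL a) = 0 ∧
    dL 3 3 (M.translationL a) = 0 := by
  refine ⟨?_, ?_, ?_, rfl, dL_of (M.analyticAt_translation a.1 a.2) ?_, dL_of (M.analyticAt_translation a.1 a.2) (hasDerivAt_const _ _)⟩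
  · exact (evL_of (M.analyticAt_translation a.1 a.2) _).trans (by simp [CRModel.translation, CRModel.K])
  · exact (evL_of (M.analyticAt_translation a.1 a.2) _).trans (by simp [CRModel.translation, CRModel.z₁, M.zero])
  · exact (evL_of (M.analyticAt_translation a.1 a.2) _).trans (by simp [CRModel.translation, CRModel.z₂, M.zero])
  · simpa [CRModel.translation, CRModel.K] using hasDerivAt_const (0 : ℂ) (0 : ℂ)

theorem evL_zeroLI (v : ℝ × ℂ) : evL 0 (zeroLI v) = 0 ∧
    evL 1 (zeroLI v) = 0 ∧ evL 2 (zeroLI v) = 0 ∧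
    evL 3 (zeroLI v) = v.2 ∧ dL 0 0 (zeroLI v) = 2 * v.1 := by
  refine ⟨?_, ?_, ?_, ?_, dL_of (analyticAt_fieldIZero v.1 v.2) ?_⟩
  any_goals exact (evL_of (analyticAt_fieldIZero v.1 v.2) _).trans (by simp [fieldIZero])
  simpa [fieldIZero] using (hasDerivAt_id (0 : ℂ)).const_mul (2 * (v.1 : ℂ))

theorem evL_zeroLII (v : ℝ × ℂ) : evL 0 (zeroLII v) = 0 ∧
    evL 1 (zeroLII v) = 0 ∧ evL 2 (zeroLII v) = 0 ∧
    evL 3 (zeroLII v) = 2 * v.2 ∧ dL 0 0 (zeroLII v) = 2 * v.1 := by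
  refine ⟨?_, ?_, ?_, ?_, dL_of (analyticAt_fieldIIZero v.1 v.2) ?_⟩
  any_goals exact (evL_of (analyticAt_fieldIIZero v.1 v.2) _).trans (by simp [fieldIIZero])
  simpa [fieldIIZero] using (hasDerivAt_id (0 : ℂ)).const_mul (2 * (v.1 : ℂ))

theorem evL_zeroLIII (v : ℂ × ℂ) : evL 0 (zeroLIII v) = 0 ∧
    evL 1 (zeroLIII v) = 0 ∧ evL 2 (zeroLIII v) = 0 ∧
    evL 3 (zeroLIII v) = v.1 ∧ dL 0 0 (zeroLIII v) = 2 * v.2.re ∧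
    dL 3 3 (zeroLIII v) = 2 * I * v.2.im := by
  refine ⟨?_, ?_, ?_, ?_, dL_of (analyticAt_fieldIIIZero v.1 v.2) ?_, dL_of (analyticAt_fieldIIIZero v.1 v.2) ?_⟩
  any_goals exact (evL_of (analyticAt_fieldIIIZero v.1 v.2) _).trans (by simp [fieldIIIZero])
  · simpa [fieldIIIZero] using (hasDerivAt_id (0 : ℂ)).const_mul (2 * (v.2.re : ℂ))
  · simpa [fieldIIIZero] using ((((hasDerivAt_pow 2 (0 : ℂ)).const_mul (conj v.1)).const_sub
      v.1).fun_add ((hasDerivAt_id (0 : ℂ)).const_mul (2 * I * (v.2.im : ℂ))))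

/-- The reality conditions make f(0) imaginary and f_w(0) real, so only one real number of each has
to be prescribed. -/
theorem CRModel.IsGraph.jet_eq_zero {M : CRModel} {Q : ℂ → ℂ → ℂ → ℝ} (hQ : M.IsGraph Q)
    {X : HolGerm} (hX : X ∈ infSym (graphFun Q)) (h0 : (evL 0 X).im = 0) (h1 : evL 1 X = 0)
    (h2 : evL 2 X = 0) (h3 : evL 3 X = 0) (h4 : (dL 0 0 X).re = 0) :
    (∀ i, ev (comp i X) = 0) ∧ ev (d 0 (comp 0 X)) = 0 := by
  have re := hQ.reality hX
  refine ⟨fun i => ?_, ?_⟩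
  · fin_cases i
    · refine Complex.ext ?_ h0
      have := congrArg Complex.re re.f
      simp at this ⊢
      linarith
    · exact h1
    · exact h2
    · exact h3
  · refine Complex.ext h4 ?_
    have := congrArg Complex.im re.fw
    simp at this ⊢
    linarith

theorem gradingI : ∃ (L : LieSubalgebra ℝ HolGerm) (a : ℤ → Submodule ℝ HolGerm),
    L.toSubmodule = infSym (graphFun QI) ∧ Module.finrank ℝ L = 8 ∧
    IsGradedBy (infSym (graphFun QI)) a ∧
    (∀ X, X ∈ a (-2) ↔ ∃ b, X = negTwoL b) ∧
    (∀ X, X ∈ a (-1) ↔ ∃ a, X = modelI.translationL a) ∧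
    (∀ X, X ∈ a 0 ↔ ∃ v, X = zeroLI v) ∧
    ∀ X ∈ infSym (graphFun QI), ∃ b a v, X = negTwoL b + modelI.translationL a + zeroLI v := by
  have := exists_grading (fun X hX Y hY => isGraph_modelI.lie_mem hX hY) negTwoL
    modelI.translationL zeroLI isGraph_modelI.negTwoL_mem
    (fun a => isGraph_modelI.translation_mem a.1 a.2) (fun v => fieldIZero_mem v.1 v.2) lie_negTwoL
    modelI.lie_translationL lie_zeroLI jetI (fun b a v => by
      obtain ⟨h1, h2, h3, h4, h5, -⟩ := evL_negTwoL b
      obtain ⟨i1, i2, i3, i4, i5, -⟩ := modelI.evL_translationL a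
      obtain ⟨j1, j2, j3, j4, j5⟩ := evL_zeroLI v
      simp [jetI, h1, h2, h3, h4, h5, i1, i2, i3, i4, i5, j1, j2, j3, j4, j5])
    (fun X hX h => by
      simp [jetI] at h
      obtain ⟨h0, ⟨h1, h2⟩, h4, h3⟩ := h
      obtain ⟨h5, h6⟩ := isGraph_modelI.jet_eq_zero hX h0 h1 h2 h3 h4
      exact modelI_eq_zero isGraph_modelI hX h5 h6)
  simpa [Module.finrank_prod] using this

theorem gradingII : ∃ (L : LieSubalgebra ℝ HolGerm) (a : ℤ → Submodule ℝ HolGerm),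
    L.toSubmodule = infSym (graphFun QII) ∧ Module.finrank ℝ L = 8 ∧
    IsGradedBy (infSym (graphFun QII)) a ∧
    (∀ X, X ∈ a (-2) ↔ ∃ b, X = negTwoL b) ∧
    (∀ X, X ∈ a (-1) ↔ ∃ a, X = modelII.translationL a) ∧
    (∀ X, X ∈ a 0 ↔ ∃ v, X = zeroLII v) ∧
    ∀ X ∈ infSym (graphFun QII), ∃ b a v, X = negTwoL b + modelII.translationL a + zeroLII v := by
  have := exists_grading (fun X hX Y hY => isGraph_modelII.lie_mem hX hY) negTwoL
    modelII.translationL zeroLII isGraph_modelII.negTwoL_mem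
    (fun a => isGraph_modelII.translation_mem a.1 a.2) (fun v => fieldIIZero_mem v.1 v.2)
    lie_negTwoL modelII.lie_translationL lie_zeroLII jetII (fun b a v => by
      obtain ⟨h1, h2, h3, h4, h5, -⟩ := evL_negTwoL b
      obtain ⟨i1, i2, i3, i4, i5, -⟩ := modelII.evL_translationL a
      obtain ⟨j1, j2, j3, j4, j5⟩ := evL_zeroLII v
      simp [jetII, h1, h2, h3, h4, h5, i1, i2, i3, i4, i5, j1, j2, j3, j4, j5])
    (fun X hX h => by
      simp [jetII] at h
      obtain ⟨h0, ⟨h1, h2⟩, h4, h3⟩ := h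
      obtain ⟨h5, h6⟩ := isGraph_modelII.jet_eq_zero hX h0 h1 h2 h3 h4
      exact modelII_eq_zero isGraph_modelII hX h5 h6)
  simpa [Module.finrank_prod] using this

theorem gradingIII : ∃ (L : LieSubalgebra ℝ HolGerm) (a : ℤ → Submodule ℝ HolGerm),
    L.toSubmodule = infSym (graphFun QIII) ∧ Module.finrank ℝ L = 9 ∧
    IsGradedBy (infSym (graphFun QIII)) a ∧
    (∀ X, X ∈ a (-2) ↔ ∃ b, X = negTwoL b) ∧
    (∀ X, X ∈ a (-1) ↔ ∃ a, X = modelIII.translationL a) ∧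
    (∀ X, X ∈ a 0 ↔ ∃ v, X = zeroLIII v) ∧
    ∀ X ∈ infSym (graphFun QIII),
      ∃ b a v, X = negTwoL b + modelIII.translationL a + zeroLIII v := by
  have := exists_grading (fun X hX Y hY => isGraph_modelIII.lie_mem hX hY) negTwoL
    modelIII.translationL zeroLIII isGraph_modelIII.negTwoL_mem
    (fun a => isGraph_modelIII.translation_mem a.1 a.2) (fun v => fieldIIIZero_mem v.1 v.2)
    lie_negTwoL modelIII.lie_translationL lie_zeroLIII jetIII (fun b a v => by
      obtain ⟨h1, h2, h3, h4, h5, h6⟩ := evL_negTwoL b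
      obtain ⟨i1, i2, i3, i4, i5, i6⟩ := modelIII.evL_translationL a
      obtain ⟨j1, j2, j3, j4, j5, j6⟩ := evL_zeroLIII v
      simp [jetIII, h1, h2, h3, h4, h5, h6, i1, i2, i3, i4, i5, i6, j1, j2, j3, j4, j5, j6]
      refine Prod.ext rfl (Complex.ext ?_ ?_) <;> simp)
    (fun X hX h => by
      simp [jetIII] at h
      obtain ⟨h0, ⟨h1, h2⟩, h3, h4⟩ := h
      have h4r := congrArg Complex.re h4
      have h4i := congrArg Complex.im h4
      simp at h4r h4i
      obtain ⟨h5, h6⟩ := isGraph_modelIII.jet_eq_zero hX h0 h1 h2 h3 h4r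
      exact modelIII_eq_zero isGraph_modelIII hX h5 h6 h4i)
  simpa [Module.finrank_prod] using this

end

section

open HolGerm

/-! ### Polynomial vector fields -/

theorem HolGerm.IsPolynomial.add {X Y : HolGerm} (hX : X.IsPolynomial) (hY : Y.IsPolynomial) :
    (X + Y).IsPolynomial := by
  obtain ⟨P, hP⟩ := hX
  obtain ⟨R, hR⟩ := hY
  refine ⟨P + R, ?_⟩
  change X.germ + Y.germ = _
  rw [hP, hR, ← Germ.coe_add]
  congr 1
  funext p i
  simp

theorem HolGerm.isPolynomial_of {V : C4 → C4} (hV : AnalyticAt ℂ V 0)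
    (P : Fin 4 → MvPolynomial (Fin 4) ℂ) (h : ∀ p i, V p i = MvPolynomial.eval p (P i)) :
    (of V hV).IsPolynomial :=
  ⟨P, congrArg _ (funext fun p => funext fun i => h p i)⟩

theorem isPolynomial_negTwoL (b : ℝ) : (negTwoL b).IsPolynomial :=
  isPolynomial_of (analyticAt_fieldNegTwo b)
    ![MvPolynomial.C (2 * b * I), 0, 0, 0] fun p i => by
    fin_cases i <;> simp [fieldNegTwo]

open MvPolynomial in
theorem isPolynomial_translationL_modelII (a : ℂ × ℂ) :
    (modelII.translationL a).IsPolynomial :=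
  isPolynomial_of (modelII.analyticAt_translation a.1 a.2)
    ![C (2 * conj a.2) * X 1 + C (2 * conj a.1) * X 2,
    C a.1 - C (conj a.1) * X 3 - C (conj a.2) * (X 3 + X 3 ^ 2), C a.2 - C (conj a.2) * X 3, 0]
    fun p i => by
    fin_cases i <;>
      simp [CRModel.translation, CRModel.K, CRModel.z₁, CRModel.z₂, modelII] <;> ring

open MvPolynomial in
theorem isPolynomial_zeroLII (v : ℝ × ℂ) : (zeroLII v).IsPolynomial :=
  isPolynomial_of (analyticAt_fieldIIZero v.1 v.2)
    ![C (2 * v.1 : ℂ) * X 0 + C (2 * conj v.2) * (X 2 ^ 2 + 2 * X 1 * X 2),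
    C (v.1 : ℂ) * X 1 + C v.2 * (X 2 + 2 * X 1) - C (conj v.2) * X 2
      - C (2 * conj v.2) * X 3 * (2 * X 2 + X 1 + X 2 * X 3),
    C (v.1 : ℂ) * X 2 - C (2 * conj v.2) * X 2 * (1 + X 3),
    2 * (C v.2 - C (conj v.2) * X 3) * (1 + X 3)]
    fun p i => by
    fin_cases i <;> simp [fieldIIZero]

open MvPolynomial in
theorem isPolynomial_translationL_modelIII (a : ℂ × ℂ) :
    (modelIII.translationL a).IsPolynomial :=
  isPolynomial_of (modelIII.analyticAt_translation a.1 a.2)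
    ![C (2 * conj a.1) * X 1 - C (2 * conj a.2) * X 2,
    C a.1 - C (2 * conj a.1) * X 3 + C (√3 * conj a.2) * X 3 ^ 2,
    C a.2 - C (√3 * conj a.1) * X 3 ^ 2 + C (2 * conj a.2) * X 3 ^ 3, 0]
    fun p i => by
    fin_cases i <;>
      simp [CRModel.translation, CRModel.K, CRModel.z₁, CRModel.z₂, modelIII] <;> ring

open MvPolynomial in
theorem isPolynomial_zeroLIII (v : ℂ × ℂ) : (zeroLIII v).IsPolynomial :=
  isPolynomial_of (analyticAt_fieldIIIZero v.1 v.2)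
    ![C (2 * v.2.re : ℂ) * X 0 + C (2 * conj v.1) * X 1 ^ 2,
    C v.2 * X 1 + C (√3 * conj v.1) * X 2 - C (4 * conj v.1) * X 1 * X 3,
    C (√3 * v.1) * X 1 + C (v.2 + 2 * I * v.2.im) * X 2 - C (2 * √3 * conj v.1) * X 1 * X 3 ^ 2,
    C v.1 - C (conj v.1) * X 3 ^ 2 + C (2 * I * v.2.im) * X 3]
    fun p i => by
    fin_cases i <;> simp [fieldIIIZero] <;> ring

theorem fieldINegOne_eq (a₁ a₂ : ℂ) : fieldINegOne a₁ a₂ = modelI.translation a₁ a₂ := by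
  funext p i
  fin_cases i <;>
    simp [fieldINegOne, CRModel.translation, CRModel.K, CRModel.z₁, CRModel.z₂, modelI] <;> ring

theorem fieldIINegOne_eq (a₁ a₂ : ℂ) : fieldIINegOne a₁ a₂ = modelII.translation a₁ a₂ := by
  funext p i
  fin_cases i <;>
    simp [fieldIINegOne, CRModel.translation, CRModel.K, CRModel.z₁, CRModel.z₂, modelII] <;> ring

theorem fieldIIINegOne_eq (a₁ a₂ : ℂ) : fieldIIINegOne a₁ a₂ = modelIII.translation a₁ a₂ := by
  funext p i
  fin_cases i <;>
    simp [fieldIIINegOne, CRModel.translation, CRModel.K, CRModel.z₁, CRModel.z₂, modelIII] <;> ring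

theorem analyticOnNhd_eval (P : MvPolynomial (Fin 4) ℂ) :
    AnalyticOnNhd ℂ (fun p : C4 => MvPolynomial.eval p P) Set.univ := fun q _ => by
  induction P using MvPolynomial.induction_on with
  | C a => simpa using analyticAt_const
  | add P R hP hR => simpa using hP.fun_add hR
  | mul_X P i hP => simpa using hP.fun_mul (HolFun.analyticAt_coord i q)

/-- Equality of germs at 0 extends to all of ℂ⁴, which permits evaluation at the pole ζ = -1/2. -/
theorem MvPolynomial.eval_eq_of_eventuallyEq {P R : MvPolynomial (Fin 4) ℂ}
    (h : ∀ᶠ p in 𝓝 (0 : C4), MvPolynomial.eval p P = MvPolynomial.eval p R) (p : C4) :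
    MvPolynomial.eval p P = MvPolynomial.eval p R :=
  congrFun ((analyticOnNhd_eval P).eq_of_eventuallyEq (analyticOnNhd_eval R) h) p

theorem eventually_two_mul_add_one_ne_zero : ∀ᶠ p in 𝓝 (0 : C4), 2 * p 3 + 1 ≠ 0 :=
  ((continuous_const.mul (continuous_apply (3 : Fin 4))).add continuous_const).continuousAt
    |>.eventually_ne (by simp)

/-- If the coefficient of ∂_{z₁} is a polynomial, then 2ζ + 1 divides its numerator, so the
numerator vanishes at ζ = -1/2. -/
theorem eq_zero_of_polynomial_typeI {b c : ℝ} {a₁ a₂ d : ℂ} {P : MvPolynomial (Fin 4) ℂ}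
    (h : ∀ᶠ p in 𝓝 (0 : C4),
      (fieldNegTwo b + fieldINegOne a₁ a₂ + fieldIZero c d) p 1 = MvPolynomial.eval p P) :
    d = 0 ∧ (1 + I) * conj a₂ = √2 * I * conj a₁ := by
  have h1 := MvPolynomial.eval_eq_of_eventuallyEq (P := P * (2 * .X 3 + 1))
    (R := .C a₁ * (2 * .X 3 + 1) - .C (conj a₁ * √2 * I) * .X 3 ^ 2
      - .C (conj a₂ * (1 + I)) * (.X 3 + 1) * .X 3
      + (.C (c : ℂ) * .X 1 + .C (d * exp (-(I * Real.pi / 4))) * .X 2) * (2 * .X 3 + 1)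
      + .C (2 * conj d) * (.C (-exp (I * Real.pi / 4)) * (.X 3 ^ 2 + .X 3 + .C (1 / 2)) * .X 2
        + .C I * (.X 3 ^ 2 + .X 3) * .X 1)) (by
    filter_upwards [h, eventually_two_mul_add_one_ne_zero] with p hp hn
    simp only [map_add, map_sub, map_mul, map_pow, map_ofNat, map_one, MvPolynomial.eval_C,
      MvPolynomial.eval_X]
    rw [← hp]
    simp only [fieldNegTwo, fieldINegOne, fieldIZero, Pi.add_apply, Matrix.cons_val]
    obtain ⟨n, hs⟩ : ∃ n, n = 2 * p 3 + 1 := ⟨_, rfl⟩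
    rw [← hs] at hn ⊢
    field_simp
    ring)
  simp only [map_add, map_sub, map_mul, map_pow, map_ofNat, map_one, MvPolynomial.eval_C,
    MvPolynomial.eval_X] at h1
  -- The residue at z = 0 gives the condition on (a₁, a₂); the change when z₁ becomes 1 isolates d.
  have e1 := h1 ![0, 0, 0, -1 / 2]
  have e2 := h1 ![0, 1, 0, -1 / 2]
  simp only [Matrix.cons_val] at e1 e2
  constructor
  · have : conj d * I = 0 := by linear_combination 2 * e2 - 2 * e1
    simpa [I_ne_zero] using this
  · linear_combination -4 * e1

/-- Under the condition the numerator in the ∂_{z₁}-coefficient becomes √2 i ā₁ ζ(2ζ + 1), and the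
denominator cancels. -/
theorem isPolynomial_typeI {a₁ a₂ : ℂ} (h : (1 + I) * conj a₂ = √2 * I * conj a₁) :
    (modelI.translationL (a₁, a₂)).IsPolynomial := by
  -- The divisibility condition for the ∂_{z₂}-coefficient is proportional to the one for ∂_{z₁},
  -- since (√2 i)² = (1 + i)(i - 1).
  have h' : √2 * I * conj a₂ = (I - 1) * conj a₁ := by
    have : (1 + I) * (√2 * I * conj a₂ - (I - 1) * conj a₁) = 0 := by
      linear_combination √2 * I * h + I * I * conj a₁ * sqrt_two_mul_self + conj a₁ * I_mul_I
    rcases mul_eq_zero.1 this with h1 | h1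
    · have := congrArg Complex.re h1
      simp at this
    · exact sub_eq_zero.1 h1
  refine ⟨![.C (2 * conj a₂) * .X 1 + .C (2 * conj a₁) * .X 2,
    .C a₁ - .C (√2 * I * conj a₁) * .X 3, .C a₂ - .C ((I - 1) * conj a₁) * .X 3, 0], ?_⟩
  refine Germ.coe_eq.2 ?_
  filter_upwards [eventually_two_mul_add_one_ne_zero] with p hp
  rw [← fieldINegOne_eq]
  funext i
  fin_cases i
  · simp [fieldINegOne]
    ring
  · simp only [fieldINegOne, Fin.mk_one, Matrix.cons_val, map_sub, map_mul, MvPolynomial.eval_C,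
      MvPolynomial.eval_X]
    obtain ⟨n, hs⟩ : ∃ n, n = 2 * p 3 + 1 := ⟨_, rfl⟩
    rw [← hs] at hp ⊢
    field_simp
    rw [hs]
    linear_combination -(p 3 + 1) * p 3 * h
  · simp only [fieldINegOne, Fin.reduceFinMk, Matrix.cons_val, map_sub, map_mul,
      MvPolynomial.eval_C, MvPolynomial.eval_X, map_one]
    obtain ⟨n, hs⟩ : ∃ n, n = 2 * p 3 + 1 := ⟨_, rfl⟩
    rw [← hs] at hp ⊢
    field_simp
    rw [hs]
    linear_combination -(p 3) ^ 2 * h'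
  · simp [fieldINegOne]

open MvPolynomial in
theorem isPolynomial_zeroLI (c : ℝ) : (zeroLI (c, 0)).IsPolynomial :=
  isPolynomial_of (analyticAt_fieldIZero c 0)
    ![C (2 * c : ℂ) * X 0, C (c : ℂ) * X 1, C (c : ℂ) * X 2, 0] fun p i => by
    fin_cases i <;> simp [fieldIZero]

theorem isPolynomial_iff_typeI {b c : ℝ} {a₁ a₂ d : ℂ} {X : HolGerm}
    (hX : X.germ = ((fieldNegTwo b + fieldINegOne a₁ a₂ + fieldIZero c d : C4 → C4) :
      Germ (𝓝 (0 : C4)) C4)) :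
    X.IsPolynomial ↔ d = 0 ∧ (1 + I) * conj a₂ = √2 * I * conj a₁ := by
  constructor
  · rintro ⟨P, hP⟩
    rw [hX, Germ.coe_eq] at hP
    exact eq_zero_of_polynomial_typeI (P := P 1) (hP.mono fun p hp => congrFun hp 1)
  · rintro ⟨rfl, h⟩
    have : X = negTwoL b + modelI.translationL (a₁, a₂) + zeroLI (c, 0) := by
      refine ext_germ (hX.trans ?_)
      rw [fieldINegOne_eq]
      rfl
    rw [this]
    exact ((isPolynomial_negTwoL b).add (isPolynomial_typeI h)).add (isPolynomial_zeroLI c)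

theorem typeI :
    ∃ (L : LieSubalgebra ℝ HolGerm) (a : ℤ → Submodule ℝ HolGerm),
      L.toSubmodule = infSym (graphFun QI) ∧
      Module.finrank ℝ L = 8 ∧
      IsGradedBy L.toSubmodule a ∧
      (∀ X, X ∈ a (-2) ↔ ∃ b : ℝ, X.germ = (fieldNegTwo b : Germ (𝓝 (0 : C4)) C4)) ∧
      (∀ X, X ∈ a (-1) ↔
        ∃ a₁ a₂ : ℂ, X.germ = (fieldINegOne a₁ a₂ : Germ (𝓝 (0 : C4)) C4)) ∧
      (∀ X, X ∈ a 0 ↔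
        ∃ (c : ℝ) (d : ℂ), X.germ = (fieldIZero c d : Germ (𝓝 (0 : C4)) C4)) ∧
      (∃ X ∈ a (-1), ¬ X.IsPolynomial) ∧
      (∃ X ∈ a 0, ¬ X.IsPolynomial) ∧
      (∀ (b c : ℝ) (a₁ a₂ d : ℂ) (X : HolGerm),
        X.germ = ((fieldNegTwo b + fieldINegOne a₁ a₂ + fieldIZero c d : C4 → C4) :
          Germ (𝓝 (0 : C4)) C4) →
        (X.IsPolynomial ↔ d = 0 ∧ (1 + I) * conj a₂ = √2 * I * conj a₁)) := by
  obtain ⟨L, a, hL, h8, hg, h2, h1, h0, -⟩ := gradingI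
  refine ⟨L, a, hL, h8, hL ▸ hg, fun X => (h2 X).trans (exists_congr fun b =>
    (germ_eq_iff (analyticAt_fieldNegTwo b)).symm), fun X => (h1 X).trans ?_,
    fun X => (h0 X).trans ?_, ⟨_, (h1 _).2 ⟨(1, 0), rfl⟩, fun h => ?_⟩,
    ⟨_, (h0 _).2 ⟨(0, 1), rfl⟩, fun h => ?_⟩, fun b c a₁ a₂ d X hX => isPolynomial_iff_typeI hX⟩
  · rw [Prod.exists]
    refine exists_congr fun a₁ => exists_congr fun a₂ => ?_
    rw [fieldINegOne_eq]
    exact (germ_eq_iff (modelI.analyticAt_translation a₁ a₂)).symm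
  · rw [Prod.exists]
    exact exists_congr fun c => exists_congr fun d => (germ_eq_iff (analyticAt_fieldIZero c d)).symm
  · have := (isPolynomial_iff_typeI (b := 0) (c := 0) (a₁ := 1) (a₂ := 0) (d := 0) (by
      refine Germ.coe_eq.2 (Eventually.of_forall fun p => ?_)
      rw [fieldINegOne_eq]
      funext i
      fin_cases i <;> simp [fieldNegTwo, fieldIZero] <;> rfl)).1 h
    simp [sqrt_two_ne_zero] at this
  · have := (isPolynomial_iff_typeI (b := 0) (c := 0) (a₁ := 0) (a₂ := 0) (d := 1) (by
      refine Germ.coe_eq.2 (Eventually.of_forall fun p => ?_)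
      funext i
      fin_cases i <;> simp [fieldNegTwo, fieldINegOne])).1 h
    exact one_ne_zero this.1

theorem typeII :
    ∃ (L : LieSubalgebra ℝ HolGerm) (a : ℤ → Submodule ℝ HolGerm),
      L.toSubmodule = infSym (graphFun QII) ∧
      Module.finrank ℝ L = 8 ∧
      IsGradedBy L.toSubmodule a ∧
      (∀ X, X ∈ a (-2) ↔ ∃ b : ℝ, X.germ = (fieldNegTwo b : Germ (𝓝 (0 : C4)) C4)) ∧
      (∀ X, X ∈ a (-1) ↔
        ∃ a₁ a₂ : ℂ, X.germ = (fieldIINegOne a₁ a₂ : Germ (𝓝 (0 : C4)) C4)) ∧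
      (∀ X, X ∈ a 0 ↔
        ∃ (c : ℝ) (d : ℂ), X.germ = (fieldIIZero c d : Germ (𝓝 (0 : C4)) C4)) ∧
      (∀ X ∈ L, X.IsPolynomial) := by
  obtain ⟨L, a, hL, h8, hg, h2, h1, h0, hall⟩ := gradingII
  refine ⟨L, a, hL, h8, hL ▸ hg, fun X => (h2 X).trans (exists_congr fun b =>
    (germ_eq_iff (analyticAt_fieldNegTwo b)).symm), fun X => (h1 X).trans ?_,
    fun X => (h0 X).trans ?_, fun X hX => ?_⟩
  · rw [Prod.exists]
    refine exists_congr fun a₁ => exists_congr fun a₂ => ?_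
    rw [fieldIINegOne_eq]
    exact (germ_eq_iff (modelII.analyticAt_translation a₁ a₂)).symm
  · rw [Prod.exists]
    exact exists_congr fun c => exists_congr fun d =>
      (germ_eq_iff (analyticAt_fieldIIZero c d)).symm
  · rw [← LieSubalgebra.mem_toSubmodule, hL] at hX
    obtain ⟨b, a, v, rfl⟩ := hall X hX
    exact ((isPolynomial_negTwoL b).add (isPolynomial_translationL_modelII a)).add
      (isPolynomial_zeroLII v)

end

section

/-! ### Subalgebras of type `G₂` -/

/-- The relations between the generators `E₀, E₁, F₀, H₀, H₁` of the contact parabolic subalgebra of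
`Lie(G₂)`. -/
structure G2Rel {G : Type*} [LieRing G] [LieAlgebra ℝ G] (x y f h₀ h₁ : G) : Prop where
  hh : ⁅h₀, h₁⁆ = 0
  h₀x : ⁅h₀, x⁆ = (2 : ℝ) • x
  h₀y : ⁅h₀, y⁆ = (-3 : ℝ) • y
  h₀f : ⁅h₀, f⁆ = (-2 : ℝ) • f
  h₁x : ⁅h₁, x⁆ = (-1 : ℝ) • x
  h₁y : ⁅h₁, y⁆ = (2 : ℝ) • y
  h₁f : ⁅h₁, f⁆ = f
  xf : ⁅x, f⁆ = h₀
  yf : ⁅y, f⁆ = 0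
  serre_x : ⁅x, ⁅x, ⁅x, ⁅x, y⁆⁆⁆⁆ = 0
  serre_y : ⁅y, ⁅x, y⁆⁆ = 0

/-- The spanning family of the contact parabolic subalgebra. -/
def g2Family {G : Type*} [LieRing G] (x y f h₀ h₁ : G) : Fin 9 → G :=
  ![h₀, h₁, x, f, y, ⁅x, y⁆, ⁅x, ⁅x, y⁆⁆, ⁅x, ⁅x, ⁅x, y⁆⁆⁆, ⁅⁅x, y⁆, ⁅x, ⁅x, y⁆⁆⁆]

theorem map_g2Family {G G' : Type*} [LieRing G] [LieAlgebra ℝ G] [LieRing G'] [LieAlgebra ℝ G']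
    (φ : G →ₗ⁅ℝ⁆ G') (x y f h₀ h₁ : G) :
    φ ∘ g2Family x y f h₀ h₁ = g2Family (φ x) (φ y) (φ f) (φ h₀) (φ h₁) := by
  funext i
  fin_cases i <;> simp [g2Family]

theorem forall_lie_mem_span {G : Type*} [LieRing G] [LieAlgebra ℝ G] {v : Fin 9 → G} {g : G}
    (h : ∀ i, ⁅g, v i⁆ ∈ Submodule.span ℝ (Set.range v)) {z : G}
    (hz : z ∈ Submodule.span ℝ (Set.range v)) : ⁅g, z⁆ ∈ Submodule.span ℝ (Set.range v) := by
  induction hz using Submodule.span_induction with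
  | mem z hz =>
    obtain ⟨i, rfl⟩ := hz
    exact h i
  | zero => simp
  | add a b _ _ ha hb =>
    rw [lie_add]
    exact add_mem ha hb
  | smul t a _ ha =>
    rw [lie_smul]
    exact Submodule.smul_mem _ t ha

namespace G2Rel

variable {G : Type*} [LieRing G] [LieAlgebra ℝ G] {x y f h₀ h₁ : G}

/-- The table of brackets of the five generators with the nine vectors. Each entry follows from the
relations and the Jacobi identity, by induction along the string y, e₁, e₂, e₃, e₄. -/
theorem lie_mem_span (r : G2Rel x y f h₀ h₁) {g z : G}
    (hg : g ∈ ({h₀, h₁, x, y, f} : Set G))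
    (hz : z ∈ Submodule.span ℝ (Set.range (g2Family x y f h₀ h₁))) :
    ⁅g, z⁆ ∈ Submodule.span ℝ (Set.range (g2Family x y f h₀ h₁)) := by
  obtain ⟨hh, h₀x, h₀y, h₀f, h₁x, h₁y, h₁f, xf, yf, sx, sy⟩ := r
  refine forall_lie_mem_span (fun i => ?_) hz
  set S := Submodule.span ℝ (Set.range (g2Family x y f h₀ h₁)) with hS
  have mem : ∀ i, g2Family x y f h₀ h₁ i ∈ S := fun i => Submodule.subset_span ⟨i, rfl⟩
  obtain ⟨e₁, he₁⟩ : ∃ e, e = ⁅x, y⁆ := ⟨_, rfl⟩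
  obtain ⟨e₂, he₂⟩ : ∃ e, e = ⁅x, e₁⁆ := ⟨_, rfl⟩
  obtain ⟨e₃, he₃⟩ : ∃ e, e = ⁅x, e₂⁆ := ⟨_, rfl⟩
  obtain ⟨e₄, he₄⟩ : ∃ e, e = ⁅e₁, e₂⁆ := ⟨_, rfl⟩
  have hv : g2Family x y f h₀ h₁ = ![h₀, h₁, x, f, y, e₁, e₂, e₃, e₄] := by
    simp only [g2Family, he₁, he₂, he₃, he₄]
  rw [← he₁, ← he₂, ← he₃] at sx
  rw [← he₁] at sy
  have skew : ∀ {a b c : G}, ⁅a, b⁆ = c → ⁅b, a⁆ = -c := fun h => by rw [← lie_skew, h]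
  have h₀e₁ : ⁅h₀, e₁⁆ = (-1 : ℝ) • e₁ := by
    rw [he₁, leibniz_lie, h₀x, h₀y, smul_lie, lie_smul]
    module
  have h₀e₂ : ⁅h₀, e₂⁆ = e₂ := by
    rw [he₂, leibniz_lie, h₀x, h₀e₁, smul_lie, lie_smul]
    module
  have h₀e₃ : ⁅h₀, e₃⁆ = (3 : ℝ) • e₃ := by
    rw [he₃, leibniz_lie, h₀x, h₀e₂, smul_lie]
    module
  have h₀e₄ : ⁅h₀, e₄⁆ = 0 := by
    rw [he₄, leibniz_lie, h₀e₁, h₀e₂, smul_lie]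
    module
  have h₁e₁ : ⁅h₁, e₁⁆ = e₁ := by
    rw [he₁, leibniz_lie, h₁x, h₁y, smul_lie, lie_smul]
    module
  have h₁e₂ : ⁅h₁, e₂⁆ = 0 := by
    rw [he₂, leibniz_lie, h₁x, h₁e₁, smul_lie]
    module
  have h₁e₃ : ⁅h₁, e₃⁆ = (-1 : ℝ) • e₃ := by
    rw [he₃, leibniz_lie, h₁x, h₁e₂, smul_lie, lie_zero]
    module
  have h₁e₄ : ⁅h₁, e₄⁆ = e₄ := by
    rw [he₄, leibniz_lie, h₁e₁, h₁e₂, lie_zero, add_zero]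
  have yx : ⁅y, x⁆ = -e₁ := skew he₁.symm
  have ye₂ : ⁅y, e₂⁆ = 0 := by
    rw [he₂, leibniz_lie, yx, sy, neg_lie, lie_self, lie_zero, neg_zero, add_zero]
  have ye₃ : ⁅y, e₃⁆ = -e₄ := by
    rw [he₃, leibniz_lie, yx, ye₂, neg_lie, lie_zero, add_zero, he₄]
  have ye₄ : ⁅y, e₄⁆ = 0 := by
    rw [he₄, leibniz_lie, sy, ye₂, zero_lie, lie_zero, add_zero]
  -- Expanding e₄ = [e₁, e₂] gives [x, e₄] = [e₁, e₃], while expanding e₄ = -[y, e₃] gives the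
  -- negative of this.
  have xe₄ : ⁅x, e₄⁆ = 0 := by
    have k1 : ⁅x, e₄⁆ = ⁅e₁, e₃⁆ := by
      rw [he₄, leibniz_lie, ← he₂, ← he₃, lie_self, zero_add]
    have k2 : -⁅x, e₄⁆ = ⁅e₁, e₃⁆ := by
      rw [← lie_neg, ← ye₃, leibniz_lie, sx, ← he₁, lie_zero, add_zero]
    have k3 : (2 : ℝ) • ⁅x, e₄⁆ = 0 := by
      rw [two_smul]
      nth_rw 1 [k1]
      rw [← k2, neg_add_cancel]
    exact (smul_eq_zero_iff_right two_ne_zero).1 k3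
  have fx : ⁅f, x⁆ = -h₀ := skew xf
  have fy : ⁅f, y⁆ = 0 := by rw [skew yf, neg_zero]
  have fe₁ : ⁅f, e₁⁆ = (3 : ℝ) • y := by
    rw [he₁, leibniz_lie, fx, fy, neg_lie, h₀y, lie_zero]
    module
  have fe₂ : ⁅f, e₂⁆ = (4 : ℝ) • e₁ := by
    rw [he₂, leibniz_lie, fx, fe₁, neg_lie, h₀e₁, lie_smul, ← he₁]
    module
  have fe₃ : ⁅f, e₃⁆ = (3 : ℝ) • e₂ := by
    rw [he₃, leibniz_lie, fx, fe₂, neg_lie, h₀e₂, lie_smul, ← he₂]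
    module
  have fe₄ : ⁅f, e₄⁆ = 0 := by
    rw [he₄, leibniz_lie, fe₁, fe₂, smul_lie, lie_smul, ye₂, lie_self]
    module
  rw [hv] at mem ⊢
  have m0 : h₀ ∈ S := mem 0
  have m1 : h₁ ∈ S := mem 1
  have m2 : x ∈ S := mem 2
  have m3 : f ∈ S := mem 3
  have m4 : y ∈ S := mem 4
  have m5 : e₁ ∈ S := mem 5
  have m6 : e₂ ∈ S := mem 6
  have m7 : e₃ ∈ S := mem 7
  have m8 : e₄ ∈ S := mem 8
  have sm : ∀ (t : ℝ) {z : G}, z ∈ S → t • z ∈ S := fun t z hz => S.smul_mem t hz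
  have z0 : (0 : G) ∈ S := S.zero_mem
  rcases hg with rfl | rfl | rfl | rfl | rfl <;>
    fin_cases i <;> simp only [Fin.zero_eta, Fin.mk_one, Fin.reduceFinMk, Matrix.cons_val, hh,
      h₀x, h₀y, h₀f, h₁x, h₁y, h₁f, xf, yf, sx, sy, h₀e₁, h₀e₂, h₀e₃, h₀e₄, h₁e₁, h₁e₂, h₁e₃,
      h₁e₄, yx, ye₂, ye₃, ye₄, xe₄, fx, fy, fe₁, fe₂, fe₃, fe₄, lie_self, skew hh, skew h₀x,
      skew h₀y, skew h₀f, skew h₁x, skew h₁y, skew h₁f, ← he₁, ← he₂, ← he₃, neg_zero, neg_mem_iff] <;>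
    first
      | assumption
      | (apply sm; assumption)

/-- A subspace that contains the generators and is stable under bracketing with them contains the
generated subalgebra, so the table of `lie_mem_span` suffices. -/
theorem lieSpan_eq (r : G2Rel x y f h₀ h₁) :
    (LieSubalgebra.lieSpan ℝ G {h₀, h₁, x, y, f}).toSubmodule =
      Submodule.span ℝ (Set.range (g2Family x y f h₀ h₁)) := by
  set S := Submodule.span ℝ (Set.range (g2Family x y f h₀ h₁)) with hS
  have mem : ∀ i, g2Family x y f h₀ h₁ i ∈ S := fun i => Submodule.subset_span ⟨i, rfl⟩
  apply le_antisymm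
  -- The elements of S that preserve S form a subalgebra, by the Jacobi identity; it contains the
  -- generators.
  · let N : LieSubalgebra ℝ G :=
      { carrier := {g | g ∈ S ∧ ∀ z ∈ S, ⁅g, z⁆ ∈ S}
        add_mem' := fun {a b} ha hb => ⟨add_mem ha.1 hb.1, fun z hz => by
          rw [add_lie]
          exact add_mem (ha.2 z hz) (hb.2 z hz)⟩
        zero_mem' := ⟨zero_mem _, fun z _ => by
          rw [zero_lie]
          exact zero_mem _⟩
        smul_mem' := fun t a ha => ⟨S.smul_mem t ha.1, fun z hz => by
          rw [smul_lie]
          exact S.smul_mem t (ha.2 z hz)⟩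
        lie_mem' := fun {a b} ha hb => ⟨ha.2 b hb.1, fun z hz => by
          rw [lie_lie]
          exact sub_mem (ha.2 _ (hb.2 z hz)) (hb.2 _ (ha.2 z hz))⟩ }
    have hN : LieSubalgebra.lieSpan ℝ G {h₀, h₁, x, y, f} ≤ N := by
      refine LieSubalgebra.lieSpan_le.2 fun g hg => ⟨?_, fun z hz => r.lie_mem_span hg hz⟩
      rcases hg with rfl | rfl | rfl | rfl | rfl
      exacts [mem 0, mem 1, mem 2, mem 4, mem 3]
    exact fun z hz => (hN hz).1
  · refine Submodule.span_le.2 ?_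
    rintro _ ⟨i, rfl⟩
    have hg : ∀ g ∈ ({h₀, h₁, x, y, f} : Set G),
        g ∈ LieSubalgebra.lieSpan ℝ G {h₀, h₁, x, y, f} :=
      fun g hg => LieSubalgebra.subset_lieSpan hg
    have hx := hg x (by simp)
    have h1 := LieSubalgebra.lie_mem _ hx (hg y (by simp))
    have h2 := LieSubalgebra.lie_mem _ hx h1
    have h3 := LieSubalgebra.lie_mem _ hx h2
    have h4 := LieSubalgebra.lie_mem _ h1 h2
    fin_cases i
    exacts [hg h₀ (by simp), hg h₁ (by simp), hx, hg f (by simp), hg y (by simp), h1, h2, h3, h4]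

/-- The relations hold componentwise. The subalgebra generated by the pairs in the product will be
the graph of the isomorphism, so no presentation of the parabolic is required. -/
theorem prod {G' : Type*} [LieRing G'] [LieAlgebra ℝ G'] {x' y' f' h₀' h₁' : G'}
    (r : G2Rel x y f h₀ h₁) (r' : G2Rel x' y' f' h₀' h₁') :
    G2Rel (x, x') (y, y') (f, f') (h₀, h₀') (h₁, h₁') where
  hh := Prod.ext r.hh r'.hh
  h₀x := Prod.ext r.h₀x r'.h₀x
  h₀y := Prod.ext r.h₀y r'.h₀y
  h₀f := Prod.ext r.h₀f r'.h₀f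
  h₁x := Prod.ext r.h₁x r'.h₁x
  h₁y := Prod.ext r.h₁y r'.h₁y
  h₁f := Prod.ext r.h₁f r'.h₁f
  xf := Prod.ext r.xf r'.xf
  yf := Prod.ext r.yf r'.yf
  serre_x := Prod.ext r.serre_x r'.serre_x
  serre_y := Prod.ext r.serre_y r'.serre_y

/-- A homomorphism that is injective on the spanning family is injective on the subalgebra. -/
theorem nonempty_lieEquiv_map {H : Type*} [LieRing H] [LieAlgebra ℝ H] (r : G2Rel x y f h₀ h₁)
    (φ : G →ₗ⁅ℝ⁆ H) (hr : G2Rel (φ x) (φ y) (φ f) (φ h₀) (φ h₁))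
    (hi : LinearIndependent ℝ (g2Family (φ x) (φ y) (φ f) (φ h₀) (φ h₁))) :
    Nonempty (LieSubalgebra.lieSpan ℝ G {h₀, h₁, x, y, f} ≃ₗ⁅ℝ⁆
      LieSubalgebra.lieSpan ℝ H {φ h₀, φ h₁, φ x, φ y, φ f}) := by
  rw [← map_g2Family] at hi
  set K := LieSubalgebra.lieSpan ℝ G {h₀, h₁, x, y, f} with hK
  have h1 : Function.Injective (φ.comp K.incl) := by
    rw [injective_iff_map_eq_zero]
    rintro ⟨z, hz⟩ h0
    -- Independence of the images means that the kernel of φ meets the span of the family, hence the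
    -- generated subalgebra, only in 0.
    have h2 := Submodule.range_ker_disjoint (f := (φ : G →ₗ[ℝ] H)) hi
    rw [← LieSubalgebra.mem_toSubmodule, hK, r.lieSpan_eq] at hz
    exact Subtype.ext (Submodule.disjoint_def.1 h2 z hz h0)
  have h3 : (φ.comp K.incl).range =
      LieSubalgebra.lieSpan ℝ H {φ h₀, φ h₁, φ x, φ y, φ f} := by
    rw [← LieSubalgebra.toSubmodule_inj, hr.lieSpan_eq, ← map_g2Family, Set.range_comp]
    have h4 := congrArg (Submodule.map (φ : G →ₗ[ℝ] H)) r.lieSpan_eq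
    rw [Submodule.map_span] at h4
    refine Eq.trans ?_ h4
    ext z
    simp only [LieSubalgebra.mem_toSubmodule, LieHom.mem_range, Submodule.mem_map]
    constructor
    · rintro ⟨⟨k, hk⟩, rfl⟩
      exact ⟨k, hk, rfl⟩
    · rintro ⟨k, hk, rfl⟩
      exact ⟨⟨k, hk⟩, rfl⟩
  exact ⟨(LieEquiv.ofInjective _ h1).trans (LieEquiv.ofEq _ _ (congrArg _ h3))⟩

/-- Two Lie algebras spanned by independent families satisfying the relations are isomorphic. -/
theorem nonempty_lieEquiv {G' : Type*} [LieRing G'] [LieAlgebra ℝ G'] {x' y' f' h₀' h₁' : G'}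
    (r : G2Rel x y f h₀ h₁) (r' : G2Rel x' y' f' h₀' h₁')
    (hi : LinearIndependent ℝ (g2Family x y f h₀ h₁))
    (hi' : LinearIndependent ℝ (g2Family x' y' f' h₀' h₁')) :
    Nonempty (LieSubalgebra.lieSpan ℝ G {h₀, h₁, x, y, f} ≃ₗ⁅ℝ⁆
      LieSubalgebra.lieSpan ℝ G' {h₀', h₁', x', y', f'}) := by
  -- Both projections of the subalgebra generated by the pairs are isomorphisms onto their images;
  -- composing one with the inverse of the other gives the claim.
  obtain ⟨e⟩ := (r.prod r').nonempty_lieEquiv_map (LieHom.fst ℝ G G') r hi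
  obtain ⟨e'⟩ := (r.prod r').nonempty_lieEquiv_map (LieHom.snd ℝ G G') r' hi'
  exact ⟨e.symm.trans e'⟩

end G2Rel

end

section

/-! ### The seven-dimensional representation of `Lie(G₂)` -/

/-- The projection from the free Lie algebra. -/
def g2Mk : FreeLieAlgebra ℝ (CartanMatrix.Generators (Fin 2)) →ₗ⁅ℝ⁆ LieAlgebra.g₂ ℝ where
  toFun u := (LieSubmodule.Quotient.mk u :
    FreeLieAlgebra ℝ (CartanMatrix.Generators (Fin 2)) ⧸
      CartanMatrix.Relations.toIdeal ℝ CartanMatrix.G₂)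
  map_add' _ _ := rfl
  map_smul' _ _ := rfl
  map_lie' := rfl

theorem g2Mk_eq_zero {u : FreeLieAlgebra ℝ (CartanMatrix.Generators (Fin 2))} :
    g2Mk u = 0 ↔ u ∈ CartanMatrix.Relations.toIdeal ℝ CartanMatrix.G₂ :=
  LieSubmodule.Quotient.mk_eq_zero'

theorem g2Mk_of_mem {u : FreeLieAlgebra ℝ (CartanMatrix.Generators (Fin 2))}
    (h : u ∈ CartanMatrix.Relations.toSet ℝ CartanMatrix.G₂) : g2Mk u = 0 :=
  g2Mk_eq_zero.2 (LieSubmodule.subset_lieSpan h)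

-- The relations are the Chevalley–Serre relations of G₂ that do not involve F₁, rewritten with
-- scalar multiples.
open CartanMatrix CartanMatrix.Relations in
theorem g2Rel_g2Gen : G2Rel (g2Gen (.E 0)) (g2Gen (.E 1)) (g2Gen (.F 0)) (g2Gen (.H 0))
    (g2Gen (.H 1)) := by
  have hg : ∀ x, g2Gen x = g2Mk (FreeLieAlgebra.of ℝ x) := fun x => rfl
  have hh := g2Mk_of_mem (u := HH ℝ ((0 : Fin 2), (1 : Fin 2))) (by simp [toSet])
  have he : ∀ i j, g2Mk (HE ℝ G₂ (i, j)) = 0 := fun i j => g2Mk_of_mem (by simp [toSet])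
  have hf : ∀ i j, g2Mk (HF ℝ G₂ (i, j)) = 0 := fun i j => g2Mk_of_mem (by simp [toSet])
  have ef : ∀ i j, g2Mk (EF ℝ (i, j)) = 0 := fun i j => g2Mk_of_mem (by simp [toSet])
  have ae : ∀ i j, g2Mk (adE ℝ G₂ (i, j)) = 0 := fun i j => g2Mk_of_mem (by simp [toSet])
  have he00 := he 0 0
  have he01 := he 0 1
  have he10 := he 1 0
  have he11 := he 1 1
  have hf00 := hf 0 0
  have hf10 := hf 1 0
  have ef00 := ef 0 0
  have ef10 := ef 1 0
  have ae01 := ae 0 1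
  have ae10 := ae 1 0
  -- The Serre relations apply ad E_i to [E_i, E_j] as many times as the negative of the Cartan
  -- entry: three further brackets with E₀, one with E₁.
  have t1 : (-(-3 : ℤ)).toNat = 3 := rfl
  have t2 : (-(-1 : ℤ)).toNat = 1 := rfl
  simp [HH] at hh
  simp [HE, G₂] at he00 he01 he10 he11
  simp [HF, G₂] at hf00 hf10
  simp [EF] at ef00 ef10
  simp [adE, G₂, t1, t2, pow_succ] at ae01 ae10
  simp only [hg]
  exact
    { hh := hh
      h₀x := by rw [sub_eq_zero.1 he00]; module
      h₀y := by rw [eq_neg_of_add_eq_zero_left he01]; module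
      h₀f := by rw [eq_neg_of_add_eq_zero_left hf00]; module
      h₁x := by rw [eq_neg_of_add_eq_zero_left he10]; module
      h₁y := by rw [sub_eq_zero.1 he11]; module
      h₁f := by rw [eq_neg_of_add_eq_zero_left hf10]; module
      xf := sub_eq_zero.1 ef00
      yf := ef10
      serre_x := ae01
      serre_y := by
        rw [← neg_eq_zero, ← lie_neg, lie_skew]
        exact ae10 }

/-- The matrices of the Chevalley generators in the seven-dimensional representation. -/
def g2Matrix : CartanMatrix.Generators (Fin 2) → Matrix (Fin 7) (Fin 7) ℤ
  | .H 0 => .single 0 0 1 - .single 1 1 1 + .single 2 2 2 - .single 4 4 2 + .single 5 5 1 - .single 6 6 1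
  | .H 1 => .single 1 1 1 - .single 2 2 1 + .single 4 4 1 - .single 5 5 1
  | .E 0 => .single 0 1 1 + .single 2 3 2 + .single 3 4 1 + .single 5 6 1
  | .E 1 => .single 1 2 1 + .single 4 5 1
  | .F 0 => .single 1 0 1 + .single 3 2 1 + .single 4 3 2 + .single 6 5 1
  | .F 1 => .single 2 1 1 + .single 5 4 1

/-- The commutator of integral matrices. -/
def intBracket (A B : Matrix (Fin 7) (Fin 7) ℤ) : Matrix (Fin 7) (Fin 7) ℤ := A * B - B * A

open CartanMatrix

theorem g2Matrix_HH (i j : Fin 2) : intBracket (g2Matrix (.H i)) (g2Matrix (.H j)) = 0 := by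
  revert i j
  decide +kernel

theorem g2Matrix_EF (i j : Fin 2) : intBracket (g2Matrix (.E i)) (g2Matrix (.F j)) =
    if i = j then g2Matrix (.H i) else 0 := by
  revert i j
  decide +kernel

theorem g2Matrix_HE (i j : Fin 2) : intBracket (g2Matrix (.H i)) (g2Matrix (.E j)) =
    G₂ i j • g2Matrix (.E j) := by
  revert i j
  decide +kernel

theorem g2Matrix_HF (i j : Fin 2) : intBracket (g2Matrix (.H i)) (g2Matrix (.F j)) =
    -(G₂ i j • g2Matrix (.F j)) := by
  revert i j
  decide +kernel

/-- The matrices of the iterated brackets of the `E i`. -/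
def g2MatrixE : Fin 4 → Matrix (Fin 7) (Fin 7) ℤ :=
  ![.single 0 2 1 - .single 1 3 2 + .single 3 5 1 - .single 4 6 1,
    -.single 0 3 4 + .single 1 4 2 + .single 2 5 2 - .single 3 6 2,
    .single 0 4 6 - .single 2 6 6,
    .single 0 5 6 + .single 1 6 6]

/-- The matrices of the iterated brackets of the `F i`. -/
def g2MatrixF : Fin 3 → Matrix (Fin 7) (Fin 7) ℤ :=
  ![-.single 2 0 1 + .single 3 1 1 - .single 5 3 2 + .single 6 4 1,
    -.single 3 0 2 + .single 4 1 2 + .single 5 2 2 - .single 6 3 4,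
    -.single 4 0 6 + .single 6 2 6]

theorem g2Matrix_adE : intBracket (g2Matrix (.E 0)) (g2Matrix (.E 1)) = g2MatrixE 0 ∧
    intBracket (g2Matrix (.E 0)) (g2MatrixE 0) = g2MatrixE 1 ∧
    intBracket (g2Matrix (.E 0)) (g2MatrixE 1) = g2MatrixE 2 ∧
    intBracket (g2Matrix (.E 0)) (g2MatrixE 2) = 0 ∧
    intBracket (g2MatrixE 0) (g2MatrixE 1) = g2MatrixE 3 ∧
    intBracket (g2Matrix (.E 1)) (g2MatrixE 0) = 0 ∧
    intBracket (g2Matrix (.E 1)) (g2Matrix (.E 0)) = -g2MatrixE 0 := by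
  decide +kernel

theorem g2Matrix_adF : intBracket (g2Matrix (.F 0)) (g2Matrix (.F 1)) = g2MatrixF 0 ∧
    intBracket (g2Matrix (.F 0)) (g2MatrixF 0) = g2MatrixF 1 ∧
    intBracket (g2Matrix (.F 0)) (g2MatrixF 1) = g2MatrixF 2 ∧
    intBracket (g2Matrix (.F 0)) (g2MatrixF 2) = 0 ∧
    intBracket (g2Matrix (.F 1)) (g2MatrixF 0) = 0 ∧
    intBracket (g2Matrix (.F 1)) (g2Matrix (.F 0)) = -g2MatrixF 0 := by
  decide +kernel

instance instLieRingMatrixSeven : LieRing (Matrix (Fin 7) (Fin 7) ℝ) := LieRing.ofAssociativeRing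

/-- Integral matrices as real matrices. -/
def castMatrix : Matrix (Fin 7) (Fin 7) ℤ →+* Matrix (Fin 7) (Fin 7) ℝ :=
  (Int.castRingHom ℝ).mapMatrix

theorem lie_castMatrix (A B : Matrix (Fin 7) (Fin 7) ℤ) :
    ⁅castMatrix A, castMatrix B⁆ = castMatrix (intBracket A B) := by
  rw [LieRing.of_associative_ring_bracket, intBracket, map_sub, map_mul, map_mul]

/-- The representation of the free Lie algebra. -/
def g2FreeRep : FreeLieAlgebra ℝ (Generators (Fin 2)) →ₗ⁅ℝ⁆ Matrix (Fin 7) (Fin 7) ℝ :=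
  FreeLieAlgebra.lift ℝ fun g => castMatrix (g2Matrix g)

theorem g2FreeRep_of (g : Generators (Fin 2)) :
    g2FreeRep (FreeLieAlgebra.of ℝ g) = castMatrix (g2Matrix g) :=
  FreeLieAlgebra.lift_of_apply _ _

-- The integral matrices satisfy all defining relations, which a finite computation decides, so the
-- representation of the free Lie algebra kills the ideal. This bounds the quotient from below.
open Relations in
theorem g2FreeRep_eq_zero {u : FreeLieAlgebra ℝ (Generators (Fin 2))}
    (hu : u ∈ toIdeal ℝ G₂) : g2FreeRep u = 0 := by
  have h : toIdeal ℝ G₂ ≤ g2FreeRep.ker := by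
    refine LieSubmodule.lieSpan_le.2 ?_
    obtain ⟨e1, e2, e3, e4, -, e5, e6⟩ := g2Matrix_adE
    obtain ⟨f1, f2, f3, f4, f5, f6⟩ := g2Matrix_adF
    have t1 : (-(-3 : ℤ)).toNat = 3 := rfl
    have t2 : (-(-1 : ℤ)).toNat = 1 := rfl
    rintro u (((((⟨⟨i, j⟩, rfl⟩ | ⟨⟨i, j⟩, rfl⟩) | ⟨⟨i, j⟩, rfl⟩) | ⟨⟨i, j⟩, rfl⟩) |
      ⟨⟨i, j⟩, rfl⟩) | ⟨⟨i, j⟩, rfl⟩) <;> rw [SetLike.mem_coe, LieHom.mem_ker]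
    · simp [HH, g2FreeRep_of, lie_castMatrix, g2Matrix_HH]
    · simp only [EF, Function.uncurry_apply_pair, Function.comp_apply]
      split_ifs with hij
      · rw [map_sub, LieHom.map_lie, g2FreeRep_of, g2FreeRep_of, g2FreeRep_of, lie_castMatrix,
          g2Matrix_EF, if_pos rfl, sub_self]
      · rw [LieHom.map_lie, g2FreeRep_of, g2FreeRep_of, lie_castMatrix, g2Matrix_EF, if_neg hij,
          map_zero]
    · simp [HE, g2FreeRep_of, lie_castMatrix, g2Matrix_HE]
    · simp [HF, g2FreeRep_of, lie_castMatrix, g2Matrix_HF]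
    · fin_cases i <;> fin_cases j <;>
        simp [adE, G₂, t1, t2, pow_succ, g2FreeRep_of, lie_castMatrix, e1, e2, e3, e4, e5, e6]
    · fin_cases i <;> fin_cases j <;>
        simp [adF, G₂, t1, t2, pow_succ, g2FreeRep_of, lie_castMatrix, f1, f2, f3, f4, f5, f6]
  exact LieHom.mem_ker.1 (h hu)

/-- Nine matrix entries from the first two rows form a triangular system for the nine coefficients;
only the entry (1, 1) involves two of them. -/
theorem linearIndependent_castMatrix : LinearIndependent ℝ
    (g2Family (castMatrix (g2Matrix (.E 0))) (castMatrix (g2Matrix (.E 1)))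
      (castMatrix (g2Matrix (.F 0))) (castMatrix (g2Matrix (.H 0)))
      (castMatrix (g2Matrix (.H 1)))) := by
  obtain ⟨e1, e2, e3, -, e4, -⟩ := g2Matrix_adE
  simp only [g2Family, lie_castMatrix, e1, e2, e3, e4]
  rw [Fintype.linearIndependent_iff]
  intro c hc
  have h : ∀ i j, _ := fun i j => congrFun (congrFun hc i) j
  have h00 := h 0 0
  have h11 := h 1 1
  have h01 := h 0 1
  have h10 := h 1 0
  have h12 := h 1 2
  have h02 := h 0 2
  have h03 := h 0 3
  have h04 := h 0 4
  have h05 := h 0 5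
  clear h hc
  simp [Fin.sum_univ_succ, Matrix.sum_apply, castMatrix, g2Matrix, g2MatrixE, Matrix.single_apply]
    at h00 h11 h01 h10 h12 h02 h03 h04 h05
  intro i
  rw [h00, neg_zero, zero_add] at h11
  fin_cases i
  exacts [h00, h11, h01, h10, h12, h02, h03, h04, h05]

/-- The nine brackets formed in the free Lie algebra have independent images under the matrix
representation. Its kernel contains that of the projection to the quotient, so independence holds in
the quotient as well. -/
theorem linearIndependent_g2Gen : LinearIndependent ℝ
    (g2Family (g2Gen (.E 0)) (g2Gen (.E 1)) (g2Gen (.F 0)) (g2Gen (.H 0)) (g2Gen (.H 1))) := by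
  have h1 := map_g2Family g2Mk (FreeLieAlgebra.of ℝ (.E 0)) (FreeLieAlgebra.of ℝ (.E 1))
    (FreeLieAlgebra.of ℝ (.F 0)) (FreeLieAlgebra.of ℝ (.H 0)) (FreeLieAlgebra.of ℝ (.H 1))
  have h2 := map_g2Family g2FreeRep (FreeLieAlgebra.of ℝ (.E 0)) (FreeLieAlgebra.of ℝ (.E 1))
    (FreeLieAlgebra.of ℝ (.F 0)) (FreeLieAlgebra.of ℝ (.H 0)) (FreeLieAlgebra.of ℝ (.H 1))
  have h3 := linearIndependent_castMatrix
  simp only [← g2FreeRep_of] at h3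
  rw [← h2] at h3
  change LinearIndependent ℝ (g2Family (g2Mk _) (g2Mk _) (g2Mk _) (g2Mk _) (g2Mk _))
  rw [← h1]
  have h4 := Submodule.range_ker_disjoint (f := g2FreeRep.toLinearMap) h3
  exact (LinearIndependent.of_comp g2FreeRep.toLinearMap h3).map (f := g2Mk.toLinearMap)
    (h4.mono_right fun u hu => g2FreeRep_eq_zero (g2Mk_eq_zero.1 hu))

end

section

open HolFun HolGerm

/-! ### Brackets of the symmetries of the type III model -/

theorem C_sqrt_three_mul_self : C (√3 : ℝ) * C (√3 : ℝ) = 3 := by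
  rw [← map_mul, ← pow_two, sqrt_three_sq]
  exact map_ofNat C 3

theorem comp_zeroLIII (c : ℂ) (r s : ℝ) :
    comp 0 (zeroLIII (c, r + I * s)) = 2 * C r * X 0 + 2 * C (conj c) * X 1 ^ 2 ∧
    comp 1 (zeroLIII (c, r + I * s)) = (C r + C (I * s)) * X 1 + C √3 * C (conj c) * X 2
      - 4 * C (conj c) * X 1 * X 3 ∧
    comp 2 (zeroLIII (c, r + I * s)) = C √3 * C c * X 1 + (C r + 3 * C (I * s)) * X 2
      - 2 * C √3 * C (conj c) * X 1 * X 3 ^ 2 ∧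
    comp 3 (zeroLIII (c, r + I * s)) = C c - C (conj c) * X 3 ^ 2 + 2 * C (I * s) * X 3 := by
  have h3 : (3 : HolFun) = C 3 := (map_ofNat C 3).symm
  have h4 : (4 : HolFun) = C 4 := (map_ofNat C 4).symm
  have hc : ∀ i, comp i (zeroLIII (c, r + I * s)) = HolFun.of
    (fun p => fieldIIIZero c (r + I * s) p i) (analyticAt_apply (analyticAt_fieldIIIZero _ _) i) :=
    fun i => rfl
  simp only [hc, pow_two, h3, h4, two_eq, HolFun.X, C_def, of_mul, of_add, of_sub]
  refine ⟨?_, ?_, ?_, ?_⟩ <;> rw [HolFun.of_eq_of] <;>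
    refine Eventually.of_forall fun p => ?_ <;>
    simp [fieldIIIZero, -mul_eq_mul_left_iff] <;> ring

theorem comp_translationL_modelIII (a₁ a₂ : ℂ) :
    comp 0 (modelIII.translationL (a₁, a₂)) = 2 * C (conj a₁) * X 1 - 2 * C (conj a₂) * X 2 ∧
    comp 1 (modelIII.translationL (a₁, a₂)) = C a₁ - 2 * C (conj a₁) * X 3
      + C √3 * C (conj a₂) * X 3 ^ 2 ∧
    comp 2 (modelIII.translationL (a₁, a₂)) = C a₂ - C √3 * C (conj a₁) * X 3 ^ 2
      + 2 * C (conj a₂) * X 3 ^ 3 ∧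
    comp 3 (modelIII.translationL (a₁, a₂)) = 0 := by
  obtain ⟨h0, h1, h2, h3⟩ := modelIII.comp_translation a₁ a₂
  obtain ⟨b1, b2, b3, b4⟩ := modelIII_bf
  obtain ⟨k1, k2, k3⟩ := modelIII_k
  rw [b1, b2] at h1
  rw [b3, b4] at h2
  refine ⟨h0.trans ?_, h1.trans (by ring), h2.trans (by ring), h3⟩
  rw [k1, k2, k3]
  simp [map_ofNat]
  ring

theorem comp_negTwoL (b : ℝ) : comp 0 (negTwoL b) = C (2 * b * I) ∧ comp 1 (negTwoL b) = 0 ∧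
    comp 2 (negTwoL b) = 0 ∧ comp 3 (negTwoL b) = 0 :=
  ⟨rfl, rfl, rfl, rfl⟩

/-- The parameter r multiplies the Euler field, central in degree 0. The parameters c and s give the
∂_ζ-coefficient c - c̄ζ² + 2isζ of an infinitesimal automorphism of the unit disc, that is, a copy
of sl₂(ℝ). -/
theorem lie_zeroLIII_zeroLIII (c c' : ℂ) (r s r' s' : ℝ) :
    ⁅zeroLIII (c, r + I * s), zeroLIII (c', r' + I * s')⁆ =
      zeroLIII (2 * (c * (I * s') - c' * (I * s)),
        (0 : ℝ) + I * ((2 * (c' * conj c).im : ℝ) : ℂ)) := by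
  have him : I * ((2 * (c' * conj c).im : ℝ) : ℂ) = c' * conj c - c * conj c' := by
    have := Complex.sub_conj (c' * conj c)
    rw [map_mul, Complex.conj_conj, mul_comm (conj c') c] at this
    rw [this, mul_comm]
  obtain ⟨z0, z1, z2, z3⟩ := comp_zeroLIII c r s
  obtain ⟨y0, y1, y2, y3⟩ := comp_zeroLIII c' r' s'
  obtain ⟨x0, x1, x2, x3⟩ := comp_zeroLIII (2 * (c * (I * s') - c' * (I * s))) 0
    (2 * (c' * conj c).im)
  have hR := C_sqrt_three_mul_self
  obtain ⟨W, hW⟩ : ∃ W, W = zeroLIII (2 * (c * (I * s') - c' * (I * s)),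
    (0 : ℝ) + I * ((2 * (c' * conj c).im : ℝ) : ℂ)) := ⟨_, rfl⟩
  rw [← hW] at x0 x1 x2 x3 ⊢
  rw [him] at x1 x2 x3
  simp only [map_add, map_sub, map_mul, Complex.conj_conj, conj_ofReal, conj_I, map_ofNat, map_neg,
    ofReal_zero, map_zero] at x0 x1 x2 x3 z1 z2 z3 y1 y2 y3
  have n3 : ∀ i, d i (3 : HolFun) = 0 := fun i => d_ofNat i 3
  have n4 : ∀ i, d i (4 : HolFun) = 0 := fun i => d_ofNat i 4
  refine ext_comp fun i => ?_
  fin_cases i <;>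
    simp only [Fin.zero_eta, Fin.mk_one, Fin.reduceFinMk, comp_lie, Fin.sum_univ_four, z0, z1, z2,
      z3, y0, y1, y2, y3, x0, x1, x2, x3, pow_two, d_add, d_sub, d_mul, d_C, d_two, n3, n4, d_X,
      Fin.isValue, Fin.reduceEq, if_true, if_false]
  · ring
  · linear_combination (C c * C (conj c') - C c' * C (conj c)) * X 1 * hR
  · linear_combination (C c' * C (conj c) - C c * C (conj c')) * X 2 * hR
  · ring

theorem lie_zeroLIII_translationL (c : ℂ) (r s : ℝ) (a₁ a₂ : ℂ) :
    ⁅zeroLIII (c, r + I * s), modelIII.translationL (a₁, a₂)⁆ =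
      modelIII.translationL (-2 * conj a₁ * c - (r + I * s) * a₁ - √3 * conj c * a₂,
        -(√3 * c * a₁) - (r + 3 * (I * s)) * a₂) := by
  obtain ⟨z0, z1, z2, z3⟩ := comp_zeroLIII c r s
  obtain ⟨y0, y1, y2, y3⟩ := comp_translationL_modelIII a₁ a₂
  obtain ⟨x0, x1, x2, x3⟩ := comp_translationL_modelIII
    (-2 * conj a₁ * c - (r + I * s) * a₁ - √3 * conj c * a₂)
    (-(√3 * c * a₁) - (r + 3 * (I * s)) * a₂)
  have hR := C_sqrt_three_mul_self
  simp only [map_add, map_sub, map_mul, Complex.conj_conj, conj_ofReal, conj_I, map_ofNat, map_neg,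
    ofReal_zero, map_zero, Complex.conj_ofNat] at x0 x1 x2 x3 z1 z2 z3
  have n3 : ∀ i, d i (3 : HolFun) = 0 := fun i => d_ofNat i 3
  have n4 : ∀ i, d i (4 : HolFun) = 0 := fun i => d_ofNat i 4
  refine ext_comp fun i => ?_
  fin_cases i <;>
    simp only [Fin.zero_eta, Fin.mk_one, Fin.reduceFinMk, comp_lie, Fin.sum_univ_four, z0, z1, z2,
      z3, y0, y1, y2, y3, x0, x1, x2, x3, pow_succ, pow_zero, d_add, d_sub, d_mul, d_C, d_two, n3,
      n4, d_X, d_one, d_zero, Fin.isValue, Fin.reduceEq, if_true, if_false]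
  · ring
  · linear_combination 2 * C (conj a₁) * C (conj c) * X 3 ^ 2 * hR
  · linear_combination (-2 * C (conj a₂) * C c * X 3 ^ 2
      + 2 * C (conj a₂) * C (conj c) * X 3 ^ 4) * hR
  · ring

/-- Degree -1 with this bracket is a Heisenberg algebra over degree -2: the bracket is a real
symplectic form on ℂ². -/
theorem lie_translationL_translationL (a₁ a₂ b₁ b₂ : ℂ) :
    ⁅modelIII.translationL (a₁, a₂), modelIII.translationL (b₁, b₂)⁆ =
      negTwoL (2 * (a₁ * conj b₁ - a₂ * conj b₂).im) := by
  obtain ⟨z0, z1, z2, z3⟩ := comp_translationL_modelIII a₁ a₂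
  obtain ⟨y0, y1, y2, y3⟩ := comp_translationL_modelIII b₁ b₂
  obtain ⟨x0, x1, x2, x3⟩ := comp_negTwoL (2 * (a₁ * conj b₁ - a₂ * conj b₂).im)
  have him : (2 * ((2 * (a₁ * conj b₁ - a₂ * conj b₂).im : ℝ) : ℂ) * I) =
      2 * ((a₁ * conj b₁ - a₂ * conj b₂) - (conj a₁ * b₁ - conj a₂ * b₂)) := by
    have := Complex.sub_conj (a₁ * conj b₁ - a₂ * conj b₂)
    simp only [map_sub, map_mul, Complex.conj_conj] at this
    rw [this]
    ring
  rw [him] at x0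
  simp only [map_sub, map_mul, map_ofNat] at x0
  refine ext_comp fun i => ?_
  fin_cases i <;>
    simp only [Fin.zero_eta, Fin.mk_one, Fin.reduceFinMk, comp_lie, Fin.sum_univ_four, z0, z1, z2,
      z3, y0, y1, y2, y3, x0, x1, x2, x3, pow_succ, pow_zero, d_add, d_sub, d_mul, d_C, d_two, 
      d_X, d_one, d_zero, Fin.isValue, Fin.reduceEq, if_true, if_false] <;> ring

end

/-! ### Type III as the contact parabolic of G₂ -/

section

open HolGerm

/-- The symmetry of weight `0` of the type III model with real parameters. -/
def zeroIII (c : ℂ) (r s : ℝ) : HolGerm := zeroLIII (c, r + I * s)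

theorem zeroIII_eq {c c' : ℂ} {r r' s s' : ℝ} (hc : c = c') (hr : r = r') (hs : s = s') :
    zeroIII c r s = zeroIII c' r' s' := by rw [hc, hr, hs]

theorem smul_zeroIII (t : ℝ) (c : ℂ) (r s : ℝ) :
    t • zeroIII c r s = zeroIII (t * c) (t * r) (t * s) := by
  rw [zeroIII, ← map_smul, zeroIII]
  refine congrArg _ (Prod.ext ?_ ?_) <;> simp
  ring

theorem zeroIII_zero : zeroIII 0 0 0 = 0 :=
  (congrArg zeroLIII (Prod.ext rfl (by simp) : ((0 : ℂ), ((0 : ℝ) : ℂ) + I * ((0 : ℝ) : ℂ)) = 0)).trans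
    (map_zero zeroLIII)

theorem lie_zeroIII (c c' : ℂ) (r s r' s' : ℝ) : ⁅zeroIII c r s, zeroIII c' r' s'⁆ =
    zeroIII (2 * (c * (I * s') - c' * (I * s))) 0 (2 * (c' * conj c).im) :=
  lie_zeroLIII_zeroLIII c c' r s r' s'

theorem lie_zeroIII_translationL (c : ℂ) (r s : ℝ) (a : ℂ × ℂ) :
    ⁅zeroIII c r s, modelIII.translationL a⁆ =
      modelIII.translationL (-2 * conj a.1 * c - (r + I * s) * a.1 - √3 * conj c * a.2,
        -(√3 * c * a.1) - (r + 3 * (I * s)) * a.2) :=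
  lie_zeroLIII_translationL c r s a.1 a.2

/-- The string obtained from (√3, 1) by repeated bracketing with the raising element has four
members, and thus fills degree -1 as a four-dimensional representation of sl₂(ℝ). The last bracket
shows that degree -2 is reached. -/
theorem bracketsIII :
    ⁅zeroIII (I / 2) 0 (1 / 2), modelIII.translationL (√3, 1)⁆ =
      modelIII.translationL (-I * √3, -3 * I) ∧
    ⁅zeroIII (I / 2) 0 (1 / 2), modelIII.translationL (-I * √3, -3 * I)⁆ =
      modelIII.translationL (2 * √3, -6) ∧
    ⁅zeroIII (I / 2) 0 (1 / 2), modelIII.translationL (2 * √3, -6)⁆ =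
      modelIII.translationL (-6 * I * √3, 6 * I) ∧
    ⁅zeroIII (I / 2) 0 (1 / 2), modelIII.translationL (-6 * I * √3, 6 * I)⁆ = 0 ∧
    ⁅modelIII.translationL (-I * √3, -3 * I), modelIII.translationL (2 * √3, -6)⁆ =
      negTwoL (-48) := by
  have hR : (√3 : ℂ) * √3 = 3 := by rw [← pow_two, sqrt_three_sq]
  have hR' : √3 * √3 = 3 := Real.mul_self_sqrt (by norm_num)
  refine ⟨?_, ?_, ?_, ?_, ?_⟩
  · rw [lie_zeroIII_translationL]
    refine congrArg _ (Prod.ext ?_ ?_) <;> simp [Complex.conj_ofNat]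
    · ring
    · linear_combination -I / 2 * hR
  · rw [lie_zeroIII_translationL]
    refine congrArg _ (Prod.ext ?_ ?_) <;> simp [Complex.conj_ofNat]
    · linear_combination -2 * √3 * I_mul_I
    · linear_combination I * I / 2 * hR + 6 * I_mul_I
  · rw [lie_zeroIII_translationL]
    refine congrArg _ (Prod.ext ?_ ?_) <;> simp [Complex.conj_ofNat]
    · ring
    · linear_combination -I * hR
  · rw [lie_zeroIII_translationL, ← map_zero modelIII.translationL]
    refine congrArg _ (Prod.ext ?_ ?_) <;> simp [Complex.conj_ofNat]
    · ring
    · linear_combination 3 * I * I * hR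
  · rw [lie_translationL_translationL]
    refine congrArg _ ?_
    simp [Complex.conj_ofNat]
    linear_combination -4 * hR'

/-- On the disc, E₀ and F₀ act by (i/2)(1 + ζ)²∂_ζ and (i/2)(1 - ζ)²∂_ζ, with double zeros at ∓1,
and H₀ by (1 - ζ²)∂_ζ. The translation with parameter (√3, 1) is the lowest weight vector of degree
-1: it has H₀-weight -3 and commutes with F₀. H₁ is minus half of H₀ minus half of the Euler field,
which gives it the weights -1 and 2 on E₀ and E₁. -/
theorem g2Rel_typeIII : G2Rel (zeroIII (I / 2) 0 (1 / 2)) (modelIII.translationL (√3, 1))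
    (zeroIII (I / 2) 0 (-1 / 2)) (zeroIII 1 0 0) (zeroIII (-1 / 2) (-1 / 2) 0) := by
  have hR : (√3 : ℂ) * √3 = 3 := by rw [← pow_two, sqrt_three_sq]
  have hR' : √3 * √3 = 3 := Real.mul_self_sqrt (by norm_num)
  obtain ⟨b1, b2, b3, b4, -⟩ := bracketsIII
  constructor
  · rw [lie_zeroIII, ← zeroIII_zero]
    apply zeroIII_eq <;> simp [Complex.conj_ofNat]
  · rw [lie_zeroIII, smul_zeroIII]
    apply zeroIII_eq <;> simp [Complex.conj_ofNat]
    ring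
  · rw [lie_zeroIII_translationL, ← map_smul]
    refine congrArg _ (Prod.ext ?_ ?_) <;> simp [Complex.conj_ofNat]
    · ring
    · exact hR
  · rw [lie_zeroIII, smul_zeroIII]
    apply zeroIII_eq <;> simp [Complex.conj_ofNat]
    · ring
    · norm_num
  · rw [lie_zeroIII, smul_zeroIII]
    apply zeroIII_eq <;> simp [Complex.conj_ofNat]
    · ring
    · norm_num
  · rw [lie_zeroIII_translationL, ← map_smul]
    refine congrArg _ (Prod.ext ?_ ?_) <;> simp [Complex.conj_ofNat]
    · ring
    · linear_combination hR / 2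
  · rw [lie_zeroIII]
    apply zeroIII_eq <;> simp [Complex.conj_ofNat]
    ring
  · rw [lie_zeroIII]
    apply zeroIII_eq <;> simp [Complex.conj_ofNat]
    linear_combination -I_mul_I
  · rw [← lie_skew, lie_zeroIII_translationL, neg_eq_zero, ← map_zero modelIII.translationL]
    refine congrArg _ (Prod.ext ?_ ?_) <;> simp [Complex.conj_ofNat]
    · ring
    · linear_combination -I / 2 * hR
  · rw [b1, b2, b3, b4]
  · rw [b1, lie_translationL_translationL, ← map_zero negTwoL]
    refine congrArg _ ?_
    simp [Complex.conj_ofNat]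

/-- The symmetries of the type III model are spanned by a family of type `G₂`. -/
theorem span_typeIII : Submodule.span ℝ (Set.range (g2Family (zeroIII (I / 2) 0 (1 / 2))
    (modelIII.translationL (√3, 1)) (zeroIII (I / 2) 0 (-1 / 2)) (zeroIII 1 0 0)
    (zeroIII (-1 / 2) (-1 / 2) 0))) = infSym (graphFun QIII) := by
  obtain ⟨L, a, hL, h9, hg, h2, h1, h0, hall⟩ := gradingIII
  obtain ⟨b1, b2, b3, -, b5⟩ := bracketsIII
  obtain ⟨w, hw⟩ : ∃ w : Fin 9 → HolGerm, w = ![zeroIII 1 0 0, zeroIII (-1 / 2) (-1 / 2) 0,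
      zeroIII (I / 2) 0 (1 / 2), zeroIII (I / 2) 0 (-1 / 2), modelIII.translationL (√3, 1),
      modelIII.translationL (-I * √3, -3 * I), modelIII.translationL (2 * √3, -6),
      modelIII.translationL (-6 * I * √3, 6 * I), negTwoL (-48)] := ⟨_, rfl⟩
  have hv : g2Family (zeroIII (I / 2) 0 (1 / 2)) (modelIII.translationL (√3, 1))
      (zeroIII (I / 2) 0 (-1 / 2)) (zeroIII 1 0 0) (zeroIII (-1 / 2) (-1 / 2) 0) = w := by
    simp only [g2Family, b1, b2, b3, b5, hw]
  have m2 : ∀ b, negTwoL b ∈ infSym (graphFun QIII) := isGraph_modelIII.negTwoL_mem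
  have m1 : ∀ a, modelIII.translationL a ∈ infSym (graphFun QIII) := fun a =>
    isGraph_modelIII.translation_mem a.1 a.2
  have m0 : ∀ c r s, zeroIII c r s ∈ infSym (graphFun QIII) := fun c r s => fieldIIIZero_mem _ _
  rw [hv]
  apply le_antisymm
  · refine Submodule.span_le.2 ?_
    rintro _ ⟨i, rfl⟩
    rw [hw]
    fin_cases i
    exacts [m0 _ _ _, m0 _ _ _, m0 _ _ _, m0 _ _ _, m1 _, m1 _, m1 _, m1 _, m2 _]
  · intro X hX
    have mem : ∀ i, w i ∈ Submodule.span ℝ (Set.range w) := fun i => Submodule.subset_span ⟨i, rfl⟩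
    generalize Submodule.span ℝ (Set.range w) = S at mem ⊢
    rw [hw] at mem
    have s0 := mem 0
    have s1 := mem 1
    have s2 := mem 2
    have s3 := mem 3
    have s4 := mem 4
    have s5 := mem 5
    have s6 := mem 6
    have s7 := mem 7
    have s8 := mem 8
    simp only [Fin.isValue, Matrix.cons_val] at s0 s1 s2 s3 s4 s5 s6 s7 s8
    have sm : ∀ (t : ℝ) {z : HolGerm}, z ∈ S → t • z ∈ S := fun t z hz => S.smul_mem t hz
    obtain ⟨b, a, v, rfl⟩ := hall X hX
    have hR : √3 * √3 = 3 := Real.mul_self_sqrt (by norm_num)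
    have hR0 : √3 ≠ 0 := by positivity
    refine add_mem (add_mem ?_ ?_) ?_
    · have : negTwoL b = (-b / 48) • negTwoL (-48) := by
        rw [← map_smul]
        refine congrArg _ ?_
        rw [smul_eq_mul]
        ring
      rw [this]
      exact sm _ s8
    -- In the string of `bracketsIII` the first entries are real or imaginary multiples of √3.
    -- Writing a₁ = √3(p + iq) reduces the expansion to two real 2 × 2 systems, one for the real and
    -- one for the imaginary parts.
    · obtain ⟨p, hp⟩ : ∃ p, p * √3 = a.1.re := ⟨a.1.re / √3, by field_simp⟩
      obtain ⟨q, hq⟩ : ∃ q, q * √3 = a.1.im := ⟨a.1.im / √3, by field_simp⟩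
      have : modelIII.translationL a = (p - (p - a.2.re) / 4) • modelIII.translationL (√3, 1)
          + (-(q + a.2.im) / 4) • modelIII.translationL (-I * √3, -3 * I)
          + ((p - a.2.re) / 8) • modelIII.translationL (2 * √3, -6)
          + ((a.2.im / 6 - (q + a.2.im) / 8)) • modelIII.translationL (-6 * I * √3, 6 * I) := by
        simp only [← map_smul, ← map_add]
        refine congrArg _ (Prod.ext (Complex.ext ?_ ?_) (Complex.ext ?_ ?_)) <;> simp
        · rw [← hp]
          ring
        · rw [← hq]
          ring
        · ring
        · ring
      rw [this]
      exact add_mem (add_mem (add_mem (sm _ s4) (sm _ s5)) (sm _ s6)) (sm _ s7)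
    · have : zeroLIII v = (v.1.re - v.2.re) • zeroIII 1 0 0
          + (-2 * v.2.re) • zeroIII (-1 / 2) (-1 / 2) 0
          + (v.1.im + v.2.im) • zeroIII (I / 2) 0 (1 / 2)
          + (v.1.im - v.2.im) • zeroIII (I / 2) 0 (-1 / 2) := by
        simp only [zeroIII, ← map_smul, ← map_add]
        refine congrArg _ (Prod.ext (Complex.ext ?_ ?_) (Complex.ext ?_ ?_)) <;> simp <;> ring
      rw [this]
      exact add_mem (add_mem (add_mem (sm _ s0) (sm _ s1)) (sm _ s2)) (sm _ s3)

theorem typeIII :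
    ∃ (L : LieSubalgebra ℝ HolGerm) (a : ℤ → Submodule ℝ HolGerm),
      L.toSubmodule = infSym (graphFun QIII) ∧
      Module.finrank ℝ L = 9 ∧
      IsGradedBy L.toSubmodule a ∧
      (∀ X, X ∈ a (-2) ↔ ∃ b : ℝ, X.germ = (fieldNegTwo b : Germ (𝓝 (0 : C4)) C4)) ∧
      (∀ X, X ∈ a (-1) ↔
        ∃ a₁ a₂ : ℂ, X.germ = (fieldIIINegOne a₁ a₂ : Germ (𝓝 (0 : C4)) C4)) ∧
      (∀ X, X ∈ a 0 ↔
        ∃ c₁ c₂ : ℂ, X.germ = (fieldIIIZero c₁ c₂ : Germ (𝓝 (0 : C4)) C4)) ∧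
      (∀ X ∈ L, X.IsPolynomial) ∧
      Nonempty (L ≃ₗ⁅ℝ⁆ g2ContactParabolic) := by
  obtain ⟨L, a, hL, h9, hg, h2, h1, h0, hall⟩ := gradingIII
  refine ⟨L, a, hL, h9, hL ▸ hg, fun X => (h2 X).trans (exists_congr fun b =>
    (germ_eq_iff (analyticAt_fieldNegTwo b)).symm), fun X => (h1 X).trans ?_,
    fun X => (h0 X).trans ?_, fun X hX => ?_, ?_⟩
  · rw [Prod.exists]
    refine exists_congr fun a₁ => exists_congr fun a₂ => ?_
    rw [fieldIIINegOne_eq]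
    exact (germ_eq_iff (modelIII.analyticAt_translation a₁ a₂)).symm
  · rw [Prod.exists]
    exact exists_congr fun c => exists_congr fun d =>
      (germ_eq_iff (analyticAt_fieldIIIZero c d)).symm
  · rw [← LieSubalgebra.mem_toSubmodule, hL] at hX
    obtain ⟨b, a, v, rfl⟩ := hall X hX
    exact ((isPolynomial_negTwoL b).add (isPolynomial_translationL_modelIII a)).add
      (isPolynomial_zeroLIII v)
  · have hs := span_typeIII
    rw [← hL] at hs
    -- Nine vectors spanning a space of dimension nine are independent; the dimension is the one
    -- obtained from the grading.
    have hi := linearIndependent_iff_card_eq_finrank_span.2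
      (show Fintype.card (Fin 9) = Set.finrank ℝ (Set.range (g2Family (zeroIII (I / 2) 0 (1 / 2))
        (modelIII.translationL (√3, 1)) (zeroIII (I / 2) 0 (-1 / 2)) (zeroIII 1 0 0)
        (zeroIII (-1 / 2) (-1 / 2) 0))) by
        rw [Set.finrank, hs, Fintype.card_fin]
        exact h9.symm)
    obtain ⟨e⟩ := g2Rel_typeIII.nonempty_lieEquiv g2Rel_g2Gen hi linearIndependent_g2Gen
    have hL' : L = LieSubalgebra.lieSpan ℝ HolGerm {zeroIII 1 0 0, zeroIII (-1 / 2) (-1 / 2) 0,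
        zeroIII (I / 2) 0 (1 / 2), modelIII.translationL (√3, 1), zeroIII (I / 2) 0 (-1 / 2)} := by
      rw [← LieSubalgebra.toSubmodule_inj, g2Rel_typeIII.lieSpan_eq, hs]
    exact ⟨(LieEquiv.ofEq _ _ (congrArg _ hL')).trans e⟩

end

end

theorem mainTheorem6 :
    -- type I
    (∃ (L : LieSubalgebra ℝ HolGerm) (a : ℤ → Submodule ℝ HolGerm),
      L.toSubmodule = infSym (graphFun QI) ∧
      Module.finrank ℝ L = 8 ∧
      IsGradedBy L.toSubmodule a ∧
      (∀ X, X ∈ a (-2) ↔ ∃ b : ℝ, X.germ = (fieldNegTwo b : Germ (𝓝 (0 : C4)) C4)) ∧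
      (∀ X, X ∈ a (-1) ↔
        ∃ a₁ a₂ : ℂ, X.germ = (fieldINegOne a₁ a₂ : Germ (𝓝 (0 : C4)) C4)) ∧
      (∀ X, X ∈ a 0 ↔
        ∃ (c : ℝ) (d : ℂ), X.germ = (fieldIZero c d : Germ (𝓝 (0 : C4)) C4)) ∧
      (∃ X ∈ a (-1), ¬ X.IsPolynomial) ∧
      (∃ X ∈ a 0, ¬ X.IsPolynomial) ∧
      (∀ (b c : ℝ) (a₁ a₂ d : ℂ) (X : HolGerm),
        X.germ = ((fieldNegTwo b + fieldINegOne a₁ a₂ + fieldIZero c d : C4 → C4) :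
          Germ (𝓝 (0 : C4)) C4) →
        (X.IsPolynomial ↔ d = 0 ∧ (1 + I) * conj a₂ = √2 * I * conj a₁))) ∧
    -- type II
    (∃ (L : LieSubalgebra ℝ HolGerm) (a : ℤ → Submodule ℝ HolGerm),
      L.toSubmodule = infSym (graphFun QII) ∧
      Module.finrank ℝ L = 8 ∧
      IsGradedBy L.toSubmodule a ∧
      (∀ X, X ∈ a (-2) ↔ ∃ b : ℝ, X.germ = (fieldNegTwo b : Germ (𝓝 (0 : C4)) C4)) ∧
      (∀ X, X ∈ a (-1) ↔
        ∃ a₁ a₂ : ℂ, X.germ = (fieldIINegOne a₁ a₂ : Germ (𝓝 (0 : C4)) C4)) ∧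
      (∀ X, X ∈ a 0 ↔
        ∃ (c : ℝ) (d : ℂ), X.germ = (fieldIIZero c d : Germ (𝓝 (0 : C4)) C4)) ∧
      (∀ X ∈ L, X.IsPolynomial)) ∧
    -- type III
    (∃ (L : LieSubalgebra ℝ HolGerm) (a : ℤ → Submodule ℝ HolGerm),
      L.toSubmodule = infSym (graphFun QIII) ∧
      Module.finrank ℝ L = 9 ∧
      IsGradedBy L.toSubmodule a ∧
      (∀ X, X ∈ a (-2) ↔ ∃ b : ℝ, X.germ = (fieldNegTwo b : Germ (𝓝 (0 : C4)) C4)) ∧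
      (∀ X, X ∈ a (-1) ↔
        ∃ a₁ a₂ : ℂ, X.germ = (fieldIIINegOne a₁ a₂ : Germ (𝓝 (0 : C4)) C4)) ∧
      (∀ X, X ∈ a 0 ↔
        ∃ c₁ c₂ : ℂ, X.germ = (fieldIIIZero c₁ c₂ : Germ (𝓝 (0 : C4)) C4)) ∧
      (∀ X ∈ L, X.IsPolynomial) ∧
      Nonempty (L ≃ₗ⁅ℝ⁆ g2ContactParabolic)) := by
  exact ⟨typeI, typeII, typeIII⟩
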